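/- Work over $\mathbb{C}$. Let $\mathbb{P}(1,1,1,1,2)$ have weighted homogeneous coordinates $x_0,x_1,x_2,x_3$ (weight $1$) and $w$ (weight $2$), let $\sigma(x_0,\dots,x_3)$ be a quadratic form defining a smooth quadric surface in $\mathbb{P}^3$, and let $Y=\{\sigma=0\}\subset\mathbb{P}(1,1,1,1,2)$ be the type II degeneration of $\mathbb{P}^3$, that is, the cone over the smooth quadric surface with vertex $[0:0:0:0:1]$. For $d\ge 1$ let $B_{d,Y}=\{\sigma=p=0\}\subset Y$ be a general member of $|\mathcal{O}_Y(d)|$, where $p(x_0,\dots,x_3,w)$ is a weighted homogeneous polynomial of degree $d$; "general" means that $p$ ranges over some nonempty Zariski open subset of the space of these polynomials. Suppose that $d$ is odd with $d\ge5$ or even with $d\ge4$. Then $(Y,B_{d,Y})$ is a degeneration of pairs $(\mathbb{P}^3,B_d)$ with $B_d\in|\mathcal{O}_{\mathbb{P}^3}(d)|$: there are a flat projective family $\mathcal{Y}\to\mathbb{A}^1$ and a $\mathbb{Q}$-Cartier divisor $\mathcal{B}\subset\mathcal{Y}$, flat over $\mathbb{A}^1$, whose fibre over $0$ is $(Y,B_{d,Y})$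 and whose fibre over every $t\neq0$ is $\mathbb{P}^3$ together with a hypersurface of degree $d$. Moreover: (1) If $d$ is odd with $d\ge5$, then $B_{d,Y}$ passes through the vertex of $Y$, has a cyclic quotient singularity of type $\frac14(1,1)$ there, and is a smooth surface elsewhere. (2) If $d$ is even with $d\ge4$, then $B_{d,Y}$ is a smooth surface and a complete intersection of weighted degrees $(2,d)$ in $\mathbb{P}(1,1,1,1,2)$; by the above, it deforms to hypersurfaces of degree $d$ in $\mathbb{P}^3$. -/

import Mathlib

open AlgebraicGeometry CategoryTheory

noncomputable section

namespace TypeII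

/-! ### Closed subschemes of `Proj` cut out by homogeneous ideals -/

section Quotient

variable {R A : Type} [CommRing R] [CommRing A] [Algebra R A]
  (𝒜 : ℕ → Submodule R A) [GradedAlgebra 𝒜]

/-- The grading of `A ⧸ I` induced by the grading of `A`. -/
def quotientGrading (I : HomogeneousIdeal 𝒜) (n : ℕ) : Submodule R (A ⧸ I.toIdeal) :=
  (𝒜 n).map (Ideal.Quotient.mkₐ R I.toIdeal).toLinearMap

theorem mk_mem_quotientGrading (I : HomogeneousIdeal 𝒜) {n : ℕ} {a : A} (ha : a ∈ 𝒜 n) :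
    Ideal.Quotient.mk I.toIdeal a ∈ quotientGrading 𝒜 I n :=
  ⟨a, ha, rfl⟩

instance quotientGrading.gradedMonoid (I : HomogeneousIdeal 𝒜) :
    SetLike.GradedMonoid (quotientGrading 𝒜 I) where
  one_mem := ⟨1, SetLike.GradedOne.one_mem, map_one (Ideal.Quotient.mk I.toIdeal)⟩
  mul_mem := by
    rintro i j _ _ ⟨a, ha, rfl⟩ ⟨b, hb, rfl⟩
    exact ⟨a * b, SetLike.GradedMul.mul_mem ha hb, map_mul (Ideal.Quotient.mk I.toIdeal) a b⟩

/-- The `n`-th homogeneous component, as a map `A ⧸ I → (A ⧸ I)_n`. -/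
def quotientComponent (I : HomogeneousIdeal 𝒜) (n : ℕ) :
    (A ⧸ I.toIdeal) →+ quotientGrading 𝒜 I n :=
  QuotientAddGroup.lift I.toIdeal.toAddSubgroup
    { toFun := fun a => ⟨Ideal.Quotient.mk I.toIdeal (DirectSum.decompose 𝒜 a n : A),
        mk_mem_quotientGrading 𝒜 I (DirectSum.decompose 𝒜 a n).2⟩
      map_zero' := by ext; simp
      map_add' := fun a b => by ext; simp }
    (fun a ha => by
      have h := I.isHomogeneous n ha
      apply Subtype.ext
      exact Ideal.Quotient.eq_zero_iff_mem.mpr h)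

theorem quotientComponent_mk (I : HomogeneousIdeal 𝒜) (n : ℕ) (a : A) :
    (quotientComponent 𝒜 I n (Ideal.Quotient.mk I.toIdeal a) : A ⧸ I.toIdeal) =
      Ideal.Quotient.mk I.toIdeal (DirectSum.decompose 𝒜 a n : A) :=
  rfl

theorem quotientGrading_isInternal (I : HomogeneousIdeal 𝒜) :
    DirectSum.IsInternal (quotientGrading 𝒜 I) := by
  classical
  constructor
  · rw [injective_iff_map_eq_zero]
    intro x hx
    -- each component of `x` is recovered from the sum by `quotientComponent`
    have key : ∀ (y : DirectSum ℕ fun n => quotientGrading 𝒜 I n) (n : ℕ),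
        quotientComponent 𝒜 I n (DirectSum.coeAddMonoidHom (quotientGrading 𝒜 I) y) = y n := by
      intro y n
      induction y using DirectSum.induction_on with
      | zero => simp
      | of i z =>
        obtain ⟨_, a, ha, rfl⟩ := z
        apply Subtype.ext
        rw [DirectSum.coeAddMonoidHom_of]
        change (quotientComponent 𝒜 I n (Ideal.Quotient.mk I.toIdeal a) : A ⧸ I.toIdeal) = _
        rw [quotientComponent_mk]
        by_cases h : i = n
        · subst h
          rw [DirectSum.decompose_of_mem_same 𝒜 ha, DirectSum.of_eq_same]
          rfl
        · rw [DirectSum.decompose_of_mem_ne 𝒜 ha h, DirectSum.of_eq_of_ne _ _ _ (Ne.symm h)]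
          simp
      | add y z hy hz => rw [map_add, map_add, hy, hz]; rfl
    ext n
    rw [← key x n, hx]
    simp
  · intro x
    obtain ⟨a, rfl⟩ := Ideal.Quotient.mk_surjective x
    induction a using DirectSum.Decomposition.inductionOn 𝒜 with
    | zero => exact ⟨0, by simp⟩
    | @homogeneous i m =>
      exact ⟨DirectSum.of (fun n => quotientGrading 𝒜 I n) i
        ⟨_, mk_mem_quotientGrading 𝒜 I m.2⟩, by rw [DirectSum.coeAddMonoidHom_of]⟩
    | add a b ha hb =>
      obtain ⟨y, hy⟩ := ha
      obtain ⟨z, hz⟩ := hb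
      exact ⟨y + z, by rw [map_add, map_add, hy, hz]⟩

instance quotientGrading.gradedAlgebra (I : HomogeneousIdeal 𝒜) :
    GradedAlgebra (quotientGrading 𝒜 I) where
  __ := quotientGrading.gradedMonoid 𝒜 I
  __ := (quotientGrading_isInternal 𝒜 I).chooseDecomposition

/-- The structure morphism `Proj 𝒜 ⟶ Spec R` of a graded `R`-algebra. -/
def projStr : Proj 𝒜 ⟶ Spec (.of R) :=
  Proj.toSpecZero 𝒜 ≫ Spec.map (CommRingCat.ofHom (algebraMap R (𝒜 0)))

/-- The closed subscheme `V₊(I) = Proj (A ⧸ I)` of `Proj 𝒜`. -/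
abbrev projV (I : HomogeneousIdeal 𝒜) : Scheme := Proj (quotientGrading 𝒜 I)

/-- The quotient map `A → A ⧸ I` as a graded ring homomorphism. -/
def quotientHom (I : HomogeneousIdeal 𝒜) : GradedRingHom 𝒜 (quotientGrading 𝒜 I) where
  __ := Ideal.Quotient.mk I.toIdeal
  map_mem := fun ha => mk_mem_quotientGrading 𝒜 I ha

/-- For `I ≤ J`, the quotient map `A ⧸ I → A ⧸ J` as a graded ring homomorphism. -/
def factorHom {I J : HomogeneousIdeal 𝒜} (h : I ≤ J) :
    GradedRingHom (quotientGrading 𝒜 I) (quotientGrading 𝒜 J) where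
  __ := Ideal.Quotient.factor (S := I.toIdeal) (T := J.toIdeal) h
  map_mem := by
    rintro n _ ⟨a, ha, rfl⟩
    exact mk_mem_quotientGrading 𝒜 J ha

theorem irrelevant_le_map_quotientHom (I : HomogeneousIdeal 𝒜) :
    HomogeneousIdeal.irrelevant (quotientGrading 𝒜 I) ≤
      (HomogeneousIdeal.irrelevant 𝒜).map (quotientHom 𝒜 I) := by
  rw [HomogeneousIdeal.irrelevant_le]
  rintro n hn _ ⟨a, ha, rfl⟩
  exact Ideal.mem_map_of_mem (quotientHom 𝒜 I)
    (HomogeneousIdeal.mem_irrelevant_of_mem 𝒜 hn ha)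

theorem irrelevant_le_map_factorHom {I J : HomogeneousIdeal 𝒜} (h : I ≤ J) :
    HomogeneousIdeal.irrelevant (quotientGrading 𝒜 J) ≤
      (HomogeneousIdeal.irrelevant (quotientGrading 𝒜 I)).map (factorHom 𝒜 h) := by
  rw [HomogeneousIdeal.irrelevant_le]
  rintro n hn _ ⟨a, ha, rfl⟩
  exact Ideal.mem_map_of_mem (factorHom 𝒜 h)
    (HomogeneousIdeal.mem_irrelevant_of_mem _ hn (mk_mem_quotientGrading 𝒜 I ha))

/-- The inclusion `V₊(I) ⟶ Proj 𝒜`. -/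
def projV.ι (I : HomogeneousIdeal 𝒜) : projV 𝒜 I ⟶ Proj 𝒜 :=
  Proj.map (quotientHom 𝒜 I) (irrelevant_le_map_quotientHom 𝒜 I)

/-- The inclusion `V₊(J) ⟶ V₊(I)` for `I ≤ J`. -/
def projV.incl {I J : HomogeneousIdeal 𝒜} (h : I ≤ J) : projV 𝒜 J ⟶ projV 𝒜 I :=
  Proj.map (factorHom 𝒜 h) (irrelevant_le_map_factorHom 𝒜 h)

/-- The homogeneous ideal generated by one homogeneous element. -/
def span₁ {m : ℕ} (f : 𝒜 m) : HomogeneousIdeal 𝒜 :=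
  ⟨Ideal.span {(f : A)}, Ideal.homogeneous_span 𝒜 _ (by rintro _ rfl; exact ⟨m, f.2⟩)⟩

/-- The homogeneous ideal generated by two homogeneous elements. -/
def span₂ {m n : ℕ} (f : 𝒜 m) (g : 𝒜 n) : HomogeneousIdeal 𝒜 :=
  ⟨Ideal.span {(f : A), (g : A)}, Ideal.homogeneous_span 𝒜 _
    (by rintro _ (rfl | rfl); exacts [⟨m, f.2⟩, ⟨n, g.2⟩])⟩

theorem span₁_le_span₂ {m n : ℕ} (f : 𝒜 m) (g : 𝒜 n) : span₁ 𝒜 f ≤ span₂ 𝒜 f g :=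
  Ideal.span_mono (by simp)

end Quotient

/-! ### Projective 3-space and `ℙ(1,1,1,1,2)` -/

/-- The standard grading of `ℂ[x₀,…,x₃]`. -/
abbrev stdGrading : ℕ → Submodule ℂ (MvPolynomial (Fin 4) ℂ) :=
  MvPolynomial.homogeneousSubmodule (Fin 4) ℂ

instance stdGrading.gradedAlgebra : GradedAlgebra stdGrading :=
  MvPolynomial.gradedAlgebra

/-- `ℙ³` over `ℂ`. -/
abbrev P3 : Scheme := Proj stdGrading

/-- The weights `(1,1,1,1,2)` of the variables `x₀, x₁, x₂, x₃, w`. -/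
def wt : Fin 5 → ℕ := ![1, 1, 1, 1, 2]

/-- The grading of `ℂ[x₀,…,x₃,w]` with weights `(1,1,1,1,2)`. -/
abbrev wtGrading : ℕ → Submodule ℂ (MvPolynomial (Fin 5) ℂ) :=
  MvPolynomial.weightedHomogeneousSubmodule ℂ wt

instance wtGrading.gradedAlgebra : GradedAlgebra wtGrading :=
  MvPolynomial.weightedGradedAlgebra ℂ wt

/-- The weighted projective space `ℙ(1,1,1,1,2)` over `ℂ`. -/
abbrev P11112 : Scheme := Proj wtGrading

/-! ### The type II threefold and its surfaces -/

/-- The quadric surface `σ = 0` in `ℙ³` is smooth: the partial derivatives of `σ` have no common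
zero in `ℂ⁴` besides the origin. -/
def IsSmoothQuadric (σ : stdGrading 2) : Prop :=
  ∀ x : Fin 4 → ℂ, (∀ i, MvPolynomial.eval x (MvPolynomial.pderiv i (σ : MvPolynomial (Fin 4) ℂ)) = 0)
    → x = 0

/-- `σ(x₀,…,x₃)` regarded as an element of weighted degree `2` of `ℂ[x₀,…,x₃,w]`. -/
def coneEq (σ : stdGrading 2) : wtGrading 2 :=
  ⟨MvPolynomial.rename Fin.castSucc (σ : MvPolynomial (Fin 4) ℂ), by
    have h : (σ : MvPolynomial (Fin 4) ℂ).IsWeightedHomogeneous (wt ∘ Fin.castSucc) 2 := by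
      have h1 : wt ∘ Fin.castSucc = (1 : Fin 4 → ℕ) := by decide
      rw [h1]
      exact σ.2
    intro m hm
    obtain ⟨u, rfl, hu⟩ := MvPolynomial.coeff_rename_ne_zero _ _ _ hm
    rw [← h hu, Finsupp.weight_apply, Finsupp.weight_apply,
      Finsupp.sum_mapDomain_index (by simp) (by intros; simp [add_mul])]
    rfl⟩

/-- The type II threefold `Y`: the cone in `ℙ(1,1,1,1,2)` over the quadric surface `σ = 0`. -/
abbrev coneY (σ : stdGrading 2) : Scheme := projV wtGrading (span₁ wtGrading (coneEq σ))

/-- The structure morphism of `Y`. -/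
def coneY.str (σ : stdGrading 2) : coneY σ ⟶ Spec (.of ℂ) := projStr _

/-- The vertex of the cone `Y` is the point `[0:0:0:0:1]`, where `x₀,…,x₃` vanish. -/
def IsVertex (σ : stdGrading 2) (y : coneY σ) : Prop :=
  ∀ i : Fin 4, y ∉ Proj.basicOpen (quotientGrading wtGrading (span₁ wtGrading (coneEq σ)))
    (Ideal.Quotient.mk _ (MvPolynomial.X i.castSucc))

/-- The member `B = {σ = p = 0}` of the linear system `|𝒪_Y(d)|` defined by a weighted homogeneous
polynomial `p` of degree `d`. -/
abbrev surfB (σ : stdGrading 2) {d : ℕ} (p : wtGrading d) : Scheme :=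
  projV wtGrading (span₂ wtGrading (coneEq σ) p)

/-- The structure morphism of `B`. -/
def surfB.str (σ : stdGrading 2) {d : ℕ} (p : wtGrading d) : surfB σ p ⟶ Spec (.of ℂ) :=
  projStr _

/-- The inclusion of `B` into `Y`. -/
def surfB.toY (σ : stdGrading 2) {d : ℕ} (p : wtGrading d) : surfB σ p ⟶ coneY σ :=
  projV.incl wtGrading (span₁_le_span₂ wtGrading (coneEq σ) p)

/-- The inclusion of `Y` into `ℙ(1,1,1,1,2)`. -/
def coneY.ι (σ : stdGrading 2) : coneY σ ⟶ P11112 := projV.ι wtGrading _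

/-- A property holds for a general `p` of weighted degree `d` (equivalently, for a general member
of the linear system) if it holds on a nonempty Zariski open subset of the vector space of these
polynomials; `F` is a polynomial in the coefficients of `p`. -/
def ForGeneral (d : ℕ) (P : wtGrading d → Prop) : Prop :=
  ∃ F : MvPolynomial (Fin 5 →₀ ℕ) ℂ,
    (∃ p : wtGrading d,
      MvPolynomial.eval (fun m => MvPolynomial.coeff m (p : MvPolynomial (Fin 5) ℂ)) F ≠ 0) ∧
    ∀ p : wtGrading d,
      MvPolynomial.eval (fun m => MvPolynomial.coeff m (p : MvPolynomial (Fin 5) ℂ)) F ≠ 0 → P p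

/-- A closed subscheme `ι : B ⟶ ℙ(1,1,1,1,2)` is a complete intersection of multidegree `(m, n)`:
it is `V₊(f, g)` for a regular sequence `f, g` of weighted homogeneous polynomials of degrees
`m` and `n`. -/
def IsCompleteIntersection (m n : ℕ) {B : Scheme} (ι : B ⟶ P11112) : Prop :=
  ∃ (f : wtGrading m) (g : wtGrading n),
    RingTheory.Sequence.IsRegular (MvPolynomial (Fin 5) ℂ)
      [(f : MvPolynomial (Fin 5) ℂ), (g : MvPolynomial (Fin 5) ℂ)] ∧
    ∃ e : B ≅ projV wtGrading (span₂ wtGrading f g), e.hom ≫ projV.ι wtGrading _ = ι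

/-! ### Cyclic quotient singularities -/

/-- The power series invariant under the action of `μ_r` by
`ζ · (u₁,…,uₙ) = (ζ^{a₁} u₁,…,ζ^{aₙ} uₙ)`: the completed local ring of `𝔸ⁿ / μ_r` at the origin. -/
def cyclicInvariants (r : ℕ) {n : ℕ} (a : Fin n → ℕ) : Subalgebra ℂ (MvPowerSeries (Fin n) ℂ) where
  carrier := {f | ∀ ζ : ℂ, ζ ^ r = 1 → MvPowerSeries.rescale (fun i => ζ ^ a i) f = f}
  mul_mem' := fun hf hg ζ h => by rw [map_mul, hf ζ h, hg ζ h]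
  add_mem' := fun hf hg ζ h => by rw [map_add, hf ζ h, hg ζ h]
  algebraMap_mem' := fun c ζ _ => by
    classical
    ext m
    rw [MvPowerSeries.coeff_rescale, MvPowerSeries.algebraMap_apply, MvPowerSeries.coeff_C]
    split_ifs with hm
    · subst hm; simp
    · simp

/-- The `ℂ`-algebra structure of the local ring of a `ℂ`-scheme at a point. -/
def stalkAlgebraMap {X : Scheme} (s : X ⟶ Spec (.of ℂ)) (x : X) : ℂ →+* X.presheaf.stalk x :=
  ((Scheme.ΓSpecIso (.of ℂ)).inv ≫ s.appTop ≫ X.presheaf.germ ⊤ x trivial).hom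

/-- `x` is a cyclic quotient singularity of type `(1/r)(a₁,…,aₙ)`: the completed local ring at `x`
is isomorphic, as a `ℂ`-algebra, to that of `𝔸ⁿ / μ_r` at the origin. -/
def IsCyclicQuotientSingularity (r : ℕ) {n : ℕ} (a : Fin n → ℕ) {X : Scheme}
    (s : X ⟶ Spec (.of ℂ)) (x : X) : Prop :=
  letI : Algebra ℂ (X.presheaf.stalk x) := (stalkAlgebraMap s x).toAlgebra
  Nonempty (AdicCompletion (IsLocalRing.maximalIdeal (X.presheaf.stalk x)) (X.presheaf.stalk x)
    ≃ₐ[ℂ] cyclicInvariants r a)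

/-! ### Degenerations of pairs -/

/-- The affine line over `ℂ`, with coordinate `t`. -/
abbrev A1 : Scheme := Spec (.of (Polynomial ℂ))

/-- The point `t = c` of the affine line. -/
def A1.pt (c : ℂ) : Spec (.of ℂ) ⟶ A1 :=
  Spec.map (CommRingCat.ofHom (Polynomial.evalRingHom c))

/-- `π : 𝒴 ⟶ 𝔸¹` is projective: `𝒴` is `Proj` of a graded `ℂ[t]`-algebra of finite type whose
degree `0` part is a quotient of `ℂ[t]`. -/
def IsProjectiveOverA1 {𝒴 : Scheme} (π : 𝒴 ⟶ A1) : Prop :=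
  ∃ (A : Type) (_ : CommRing A) (_ : Algebra (Polynomial ℂ) A)
    (𝒜 : ℕ → Submodule (Polynomial ℂ) A) (_ : GradedAlgebra 𝒜),
    Algebra.FiniteType (Polynomial ℂ) A ∧
    Function.Surjective (algebraMap (Polynomial ℂ) (𝒜 0)) ∧
    ∃ e : 𝒴 ≅ Proj 𝒜, e.hom ≫ projStr 𝒜 = π

/-- The pair `j : B ⟶ Y` over `ℂ` is the fibre over `t = c` of the family of pairs
`i : ℬ ⟶ 𝒴` over the affine line. -/
def IsFibrePair {ℬ 𝒴 B Y : Scheme} (i : ℬ ⟶ 𝒴) (π : 𝒴 ⟶ A1) (c : ℂ)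
    (j : B ⟶ Y) (s : Y ⟶ Spec (.of ℂ)) : Prop :=
  ∃ (u : Y ⟶ 𝒴) (v : B ⟶ ℬ), IsPullback u s π (A1.pt c) ∧ IsPullback v j i u

/-- The closed subscheme `i : ℬ ⟶ 𝒴` is a `ℚ`-Cartier divisor: for some `n ≥ 1` there is locally
a function `f` with `n ℬ = div f`, i.e. `f` generates the `n`-th power of the ideal of `ℬ` at all
points of codimension at most one. -/
def IsQCartier {ℬ 𝒴 : Scheme} (i : ℬ ⟶ 𝒴) : Prop :=
  ∃ n : ℕ, 0 < n ∧ ∀ y : 𝒴, ∃ U : 𝒴.affineOpens, y ∈ U.1 ∧ ∃ f ∈ nonZeroDivisors Γ(𝒴, U.1),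
    ∀ (x : 𝒴) (hx : x ∈ U.1), ringKrullDim (𝒴.presheaf.stalk x) ≤ 1 →
      Ideal.span {(𝒴.presheaf.germ U.1 x hx).hom f} =
        ((i.ker.ideal U).map (𝒴.presheaf.germ U.1 x hx).hom) ^ n

/-- The pair `j : B ⟶ Y` is a degeneration of pairs `(ℙ³, B_d)` with `B_d ∈ |𝒪(d)|`: there are a
flat projective family `𝒴` over the affine line and a closed subscheme `ℬ` of `𝒴`, flat over the
affine line and `ℚ`-Cartier, with fibre `(Y, B)` over `t = 0` and with fibre `ℙ³` together with a
hypersurface of degree `d` over every `t ≠ 0`. (When `Y` is normal and irreducible the canonical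
divisor of `𝒴` satisfies `d K + 4 ℬ ∼ 0`, so it is `ℚ`-Cartier if and only if `ℬ` is, for `d ≥ 1`.)
In particular `ℬ` is then a flat projective deformation of `B` to hypersurfaces of degree `d`
in `ℙ³`. -/
def IsDegenerationOfPairs (d : ℕ) {B Y : Scheme} (j : B ⟶ Y) (s : Y ⟶ Spec (.of ℂ)) : Prop :=
  ∃ (ℬ 𝒴 : Scheme) (i : ℬ ⟶ 𝒴) (π : 𝒴 ⟶ A1),
    IsClosedImmersion i ∧ IsProjectiveOverA1 π ∧ Flat π ∧ Flat (i ≫ π) ∧ IsQCartier i ∧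
    IsFibrePair i π 0 j s ∧
    ∀ c : ℂ, c ≠ 0 → ∃ f : stdGrading d, f ≠ 0 ∧
      IsFibrePair i π c (projV.ι stdGrading (span₁ stdGrading f)) (projStr stdGrading)

end TypeII

end

namespace TypeII
open Limits

/-! The degeneration is the family `t w = σ` in `ℙ(1,1,1,1,2) × 𝔸¹`, with the divisor `p = 0`. For
`t = c ≠ 0` the equation eliminates `w = σ / c`, so the fibre is `ℙ³` with the hypersurface `p(x, σ
/ c) = 0`; for `t = 0` it is the cone with `B`. Both fibre statements are instances of
`isFibrePair_of_graded`. Over `ℂ[t]` flatness is absence of torsion: `t w - σ` and all its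
specializations `c w - σ` are prime, and none of the latter divides `p` as soon as `p` is nonzero
somewhere on `σ = w = 0` (`mem_of_C_linear_mul_mem`). Twice the divisor is locally cut out by `p² /
sᴺ`, where `s` is a variable: `𝒪(1)` may fail to be invertible only at the vertex, whose local ring
has dimension at least two (`two_le_ringKrullDim_stalk_vertex`), so the vertex does not matter in
codimension one.

Smoothness away from the vertex is the Jacobian criterion, expressed by the ideal generated by `σ`,
`p` and the `2 × 2` minors of their Jacobian matrix. That this ideal contains all forms of a fixed
degree `n` is an open condition on `p`, a determinant being nonzero
(`exists_eval_ne_zero_of_forall_mem_singIdeal`), so one example per degree suffices. With `σ = ∑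
ℓᵢ²` the examples are a Fermat form `∑ 2^(i e) ℓᵢ^(e + 2)` plus a power of `w`, or plus a power of
`w` times `ℓ₀`. At a singular point the numbers `4ⁱ |ℓᵢ|²` agree for the nonzero `ℓᵢ`, which is
incompatible with `∑ ℓᵢ² = 0` because `1/4 + 1/16 + 1/64 < 1` (`eq_zero_of_sum_sq_of_fermat`). For
even `d` the pure power of `w` in `p` keeps `B` away from the vertex.

For odd `d` the lowest term of `p` at the vertex is a power of `w` times a linear form, and
generically its plane is not tangent to the quadric. Then `σ = X Z - Y W` and, up to a constant, `p
= wⁿ (W - Y) + ∑ ℓₖ Qₖ` with `Qₖ` in the ideal of the vertex (`exists_vertexNormalForm`). On the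
double cover `w = 1` this is a perturbation of the quadric cone `X Z = Y²`, which is `𝔸² / ±1`.
Setting `X = u c`, `Z = v d`, `Y = u d`, `W = v c` turns the equation into a fixed point problem for
power series `c = u + ⋯`, `d = v + ⋯` (`exists_segreEval_eq_zero`). Uniqueness of the solution makes
it equivariant under fourth roots of unity, so the local ring maps to `ℂ⟦u, v⟧^μ₄`. The `k`-th power
of the maximal ideal corresponds to order at least `4 k`: every invariant leading term comes from a
form of degree `2 k` (`exists_sub_segreEval_mem`), and a form whose leading term vanishes lies in
`(W - Y, X Z - Y W)`, hence is one step deeper in the filtration (`VertexChart.mem_pow_succ`).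
Passing to completions gives the isomorphism. -/

theorem isPullback_of_ker_le {ZX ZY X Y : Scheme.{0}} {iX : ZX ⟶ X} {iY : ZY ⟶ Y} {g : ZX ⟶ ZY}
    {f : X ⟶ Y} [IsClosedImmersion iX] [IsClosedImmersion iY] (h : iX ≫ f = g ≫ iY)
    {ι : Type*} (U : ι → X.affineOpens) (hU : ⨆ k, (U k).1 = ⊤) (V : ι → Y.Opens)
    (e : ∀ k, (U k).1 ≤ f ⁻¹ᵁ V k)
    (H : ∀ k, RingHom.ker (iX.app (U k).1).hom ≤
      (RingHom.ker (iY.app (V k)).hom).map (f.appLE (V k) (U k).1 (e k)).hom) :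
    IsPullback iX g f iY := by
  -- Both `ZX` and the fibre product are closed subschemes of `X`, so the comparison map is an
  -- isomorphism once their ideal sheaves agree. Only one inclusion is not formal, and it is checked
  -- on the given affine cover.
  suffices IsIso (pullback.lift _ _ h) by
    exact IsPullback.of_iso_pullback ⟨h⟩ (asIso (pullback.lift _ _ h)) (pullback.lift_fst _ _ _)
      (pullback.lift_snd _ _ _)
  refine IsClosedImmersion.isIso_of_ker_eq iX (pullback.fst f iY) _ (pullback.lift_fst _ _ _) ?_
  apply le_antisymm
  · refine Scheme.IdealSheafData.le_of_iSup_eq_top U hU fun k => ?_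
    rw [Scheme.Hom.ker_apply, Scheme.Hom.ker_apply]
    refine (H k).trans (Ideal.map_le_iff_le_comap.mpr fun z hz => ?_)
    rw [Ideal.mem_comap, RingHom.mem_ker]
    have h1 : pullback.fst f iY ⁻¹ᵁ (U k).1 ≤ pullback.snd f iY ⁻¹ᵁ (iY ⁻¹ᵁ V k) := by
      rw [← Scheme.Hom.comp_preimage, ← pullback.condition, Scheme.Hom.comp_preimage]
      exact fun x hx => e k hx
    have h2 : f.appLE (V k) (U k).1 (e k) ≫ (pullback.fst f iY).app (U k).1 =
        iY.app (V k) ≫ (pullback.snd f iY).appLE _ _ h1 := by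
      rw [Scheme.Hom.app_eq_appLE, Scheme.Hom.app_eq_appLE, Scheme.Hom.appLE_comp_appLE, Scheme.Hom.appLE_comp_appLE]
      simp only [pullback.condition]
    have h3 := congr($(h2).hom z)
    simp only [CommRingCat.hom_comp, RingHom.comp_apply] at h3
    rw [h3, RingHom.mem_ker.mp hz, map_zero]
  · conv_rhs => rw [← pullback.lift_fst _ _ h]
    exact Scheme.Hom.le_ker_comp _ _
theorem mem_of_graded {A B σ τ : Type} [CommRing A] [CommRing B] [SetLike σ A] [SetLike τ B]
    {𝒜 : ℕ → σ} {ℬ : ℕ → τ} (f : GradedRingHom 𝒜 ℬ) {n : ℕ} {a : A} (ha : a ∈ 𝒜 n) :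
    f a ∈ ℬ n :=
  f.map_mem ha

/-! ### Closed immersions and intersections in `Proj` from graded surjections. -/

section ProjMap

open HomogeneousLocalization

variable {A B C D σ τ υ φ : Type} [CommRing A] [CommRing B] [CommRing C] [CommRing D]
  [SetLike σ A] [AddSubgroupClass σ A] [SetLike τ B] [AddSubgroupClass τ B]
  [SetLike υ C] [AddSubgroupClass υ C] [SetLike φ D] [AddSubgroupClass φ D]
  {𝒜 : ℕ → σ} {ℬ : ℕ → τ} {𝒞 : ℕ → υ} {𝒟 : ℕ → φ}
  [GradedRing 𝒜] [GradedRing ℬ] [GradedRing 𝒞] [GradedRing 𝒟]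

theorem exists_mem_of_surjective (f : 𝒜 →+*ᵍ ℬ) (hf : Function.Surjective f) {n : ℕ} {b : B}
    (hb : b ∈ ℬ n) : ∃ a ∈ 𝒜 n, f a = b := by
  obtain ⟨a, rfl⟩ := hf b
  refine ⟨DirectSum.decompose 𝒜 a n, SetLike.coe_mem _, ?_⟩
  rw [GradedRingHom.map_directSumDecompose, DirectSum.decompose_of_mem_same _ hb]

theorem irrelevant_le_map_of_surjective (f : 𝒜 →+*ᵍ ℬ) (hf : Function.Surjective f) :
    HomogeneousIdeal.irrelevant ℬ ≤ (HomogeneousIdeal.irrelevant 𝒜).map f := by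
  rw [HomogeneousIdeal.irrelevant_le]
  intro n hn b hb
  obtain ⟨a, ha, rfl⟩ := exists_mem_of_surjective f hf hb
  exact Ideal.mem_map_of_mem f (HomogeneousIdeal.mem_irrelevant_of_mem 𝒜 hn ha)

theorem awayMap_surjective (f : 𝒜 →+*ᵍ ℬ) (hf : Function.Surjective f) {d : ℕ} {s : A}
    (hs : s ∈ 𝒜 d) : Function.Surjective (Away.map f s) := by
  intro y
  obtain ⟨n, b, hb, rfl⟩ := Away.mk_surjective _ (mem_of_graded f hs) y
  obtain ⟨a, ha, rfl⟩ := exists_mem_of_surjective f hf hb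
  exact ⟨Away.mk 𝒜 hs n a ha, Away.map_mk ..⟩

theorem away_mk_eq_zero_iff {d : ℕ} {s : A} (hs : s ∈ 𝒜 d) (n : ℕ) (a : A)
    (ha : a ∈ 𝒜 (n • d)) : Away.mk 𝒜 hs n a ha = 0 ↔ ∃ k : ℕ, s ^ k * a = 0 := by
  rw [ext_iff_val, Away.val_mk, val_zero, Localization.mk_eq_mk', IsLocalization.mk'_eq_zero_iff]
  constructor
  · rintro ⟨⟨_, k, rfl⟩, h⟩
    exact ⟨k, h⟩
  · rintro ⟨k, h⟩
    exact ⟨⟨_, k, rfl⟩, h⟩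

theorem away_mk_pow_mul {d : ℕ} {s : A} (hs : s ∈ 𝒜 d) (n k : ℕ) (a : A) (ha : a ∈ 𝒜 (n • d))
    (ha' : s ^ k * a ∈ 𝒜 ((k + n) • d)) :
    Away.mk 𝒜 hs (k + n) (s ^ k * a) ha' = Away.mk 𝒜 hs n a ha := by
  rw [ext_iff_val, Away.val_mk, Away.val_mk, Localization.mk_eq_mk_iff, Localization.r_iff_exists]
  exact ⟨1, by simp only [OneMemClass.coe_one, one_mul]; ring⟩

/-- An element of the kernel of `Away.map f s` is a fraction whose numerator is killed by `f`. -/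
theorem exists_of_awayMap_eq_zero (f : 𝒜 →+*ᵍ ℬ) {d : ℕ} {s : A} (hs : s ∈ 𝒜 d)
    {x : Away 𝒜 s} (hx : Away.map f s x = 0) :
    ∃ (n : ℕ) (a : A) (ha : a ∈ 𝒜 (n • d)), f a = 0 ∧ x = Away.mk 𝒜 hs n a ha := by
  obtain ⟨n, a, ha, rfl⟩ := Away.mk_surjective _ hs x
  rw [Away.map_mk, away_mk_eq_zero_iff] at hx
  obtain ⟨k, hk⟩ := hx
  have h1 : s ^ k * a ∈ 𝒜 ((k + n) • d) := by
    rw [add_smul]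
    exact SetLike.mul_mem_graded (SetLike.pow_mem_graded k hs) ha
  exact ⟨k + n, s ^ k * a, h1, by rw [map_mul, map_pow, hk], (away_mk_pow_mul hs n k a ha h1).symm⟩

/-- The affine open `D₊(s)`. -/
def affineBasicOpen (𝒜 : ℕ → σ) [GradedRing 𝒜] {m : ℕ} (hm : 0 < m) (s : 𝒜 m) :
    (Proj 𝒜).affineOpens :=
  ⟨Proj.basicOpen 𝒜 (s : A), Proj.isAffineOpen_basicOpen 𝒜 (s : A) s.2 hm⟩

theorem iSup_affineBasicOpen (𝒜 : ℕ → σ) [GradedRing 𝒜] :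
    ⨆ s : (Σ i : {i : ℕ // 0 < i}, 𝒜 i), (affineBasicOpen 𝒜 s.1.2 s.2).1 = ⊤ := by
  refine Proj.iSup_basicOpen_eq_top 𝒜 (fun s : (Σ i : {i : ℕ // 0 < i}, 𝒜 i) => (s.2 : A)) ?_
  rw [HomogeneousIdeal.toIdeal_irrelevant_le]
  intro i hi x hx
  exact Ideal.subset_span ⟨⟨⟨i, hi⟩, ⟨x, hx⟩⟩, rfl⟩

theorem awayToSection_bijective {m : ℕ} (hm : 0 < m) {s : A} (hs : s ∈ 𝒜 m) :
    Function.Bijective (Proj.awayToSection 𝒜 s).hom := by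
  rw [← Proj.basicOpenIsoAway_hom 𝒜 s hs hm]
  exact ConcreteCategory.bijective_of_isIso (Proj.basicOpenIsoAway 𝒜 s hs hm).hom

theorem map_app_awayToSection (f : 𝒜 →+*ᵍ ℬ)
    (hf : HomogeneousIdeal.irrelevant ℬ ≤ (HomogeneousIdeal.irrelevant 𝒜).map f)
    {i : ℕ} {s : A} (hs : s ∈ 𝒜 i) (x : Away 𝒜 s) :
    ((Proj.map f hf).app (Proj.basicOpen 𝒜 s)).hom ((Proj.awayToSection 𝒜 s).hom x) =
      (Proj.awayToSection ℬ (f s)).hom (Away.map f s x) := by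
  have h := congr($(Proj.awayToSection_comp_appLE f hf hs).hom x)
  rw [Scheme.Hom.app_eq_appLE]
  exact h

theorem map_appLE_awayToSection (f : 𝒜 →+*ᵍ ℬ)
    (hf : HomogeneousIdeal.irrelevant ℬ ≤ (HomogeneousIdeal.irrelevant 𝒜).map f)
    {i : ℕ} {s : A} (hs : s ∈ 𝒜 i) (x : Away 𝒜 s) :
    ((Proj.map f hf).appLE (Proj.basicOpen 𝒜 s) (Proj.basicOpen ℬ (f s)) le_rfl).hom
      ((Proj.awayToSection 𝒜 s).hom x) = (Proj.awayToSection ℬ (f s)).hom (Away.map f s x) :=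
  congr($(Proj.awayToSection_comp_appLE f hf hs).hom x)

/-- Local on the target: over `D₊(s)` the map is given by the degree zero part of the localized
surjection, and numerators lift to homogeneous elements of the same degree. -/
theorem isClosedImmersion_map (f : 𝒜 →+*ᵍ ℬ) (hf : Function.Surjective f)
    (hf' : HomogeneousIdeal.irrelevant ℬ ≤ (HomogeneousIdeal.irrelevant 𝒜).map f) :
    IsClosedImmersion (Proj.map f hf') := by
  refine @HasAffineProperty.of_iSup_eq_top @IsClosedImmersion _
    IsClosedImmersion.hasAffineProperty _ _ _ _ _ (iSup_affineBasicOpen 𝒜) ?_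
  rintro ⟨⟨m, hm⟩, s⟩
  refine ⟨Proj.isAffineOpen_basicOpen ℬ (f s) (mem_of_graded f s.2) hm, ?_⟩
  have h1 : Function.Surjective ((Proj.map f hf').app (Proj.basicOpen 𝒜 (s : A))).hom := by
    intro y
    obtain ⟨z, rfl⟩ := (awayToSection_bijective hm (mem_of_graded f s.2)).2 y
    obtain ⟨x, rfl⟩ := awayMap_surjective f hf s.2 z
    exact ⟨_, map_app_awayToSection f hf' s.2 x⟩
  have h2 : ∀ W, W = Proj.basicOpen 𝒜 (s : A) →
      Function.Surjective ((Proj.map f hf').app W).hom := by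
    rintro _ rfl
    exact h1
  rw [morphismRestrict_appTop]
  exact Function.Surjective.comp (f := ((Proj.map f hf').app _).hom) (ConcreteCategory.bijective_of_isIso
    ((Proj ℬ).presheaf.map (eqToHom (image_morphismRestrict_preimage (Proj.map f hf') _ ⊤)).op)).2
    (h2 _ (Scheme.Opens.ι_image_top _))


theorem ker_map_app_basicOpen (f : 𝒜 →+*ᵍ ℬ)
    (hf : HomogeneousIdeal.irrelevant ℬ ≤ (HomogeneousIdeal.irrelevant 𝒜).map f)
    {i : ℕ} (hi : 0 < i) {s : A} (hs : s ∈ 𝒜 i) {y : Γ(Proj 𝒜, Proj.basicOpen 𝒜 s)}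
    (hy : y ∈ RingHom.ker ((Proj.map f hf).app (Proj.basicOpen 𝒜 s)).hom) :
    ∃ (n : ℕ) (a : A) (ha : a ∈ 𝒜 (n • i)), f a = 0 ∧
      y = (Proj.awayToSection 𝒜 s).hom (Away.mk 𝒜 hs n a ha) := by
  obtain ⟨x, rfl⟩ := (awayToSection_bijective hi hs).2 y
  rw [RingHom.mem_ker, map_app_awayToSection f hf hs] at hy
  obtain ⟨n, a, ha, h1, rfl⟩ := exists_of_awayMap_eq_zero f hs
    ((map_eq_zero_iff _ (awayToSection_bijective hi (mem_of_graded f hs)).1).mp hy)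
  exact ⟨n, a, ha, h1, rfl⟩

theorem mk_mem_ker_map_app_basicOpen (f : 𝒜 →+*ᵍ ℬ)
    (hf : HomogeneousIdeal.irrelevant ℬ ≤ (HomogeneousIdeal.irrelevant 𝒜).map f)
    {i : ℕ} {s : A} (hs : s ∈ 𝒜 i) {n : ℕ} {a : A} (ha : a ∈ 𝒜 (n • i)) (h : f a = 0) :
    (Proj.awayToSection 𝒜 s).hom (Away.mk 𝒜 hs n a ha) ∈
      RingHom.ker ((Proj.map f hf).app (Proj.basicOpen 𝒜 s)).hom := by
  rw [RingHom.mem_ker, map_app_awayToSection f hf hs, Away.map_mk,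
    (away_mk_eq_zero_iff (mem_of_graded f hs) n (f a) (mem_of_graded f ha)).mpr ⟨0, by rw [h, mul_zero]⟩, map_zero]
  rfl

/-- The intersection of two closed subschemes of `Proj 𝒜` given by surjections
`𝒜 → ℬ` and `𝒜 → 𝒞` is the closed subscheme given by the sum of their kernels. -/
theorem isPullback_map {f : 𝒜 →+*ᵍ ℬ} {g : 𝒜 →+*ᵍ 𝒞} {f' : 𝒞 →+*ᵍ 𝒟} {g' : ℬ →+*ᵍ 𝒟}
    (hf : Function.Surjective f) (hg : Function.Surjective g) (hf' : Function.Surjective f')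
    (hg' : Function.Surjective g') (w : f'.comp g = g'.comp f)
    (hker : ∀ a, f' (g a) = 0 → ∃ b, f b = 0 ∧ g b = g a) :
    IsPullback (Proj.map f' (irrelevant_le_map_of_surjective f' hf'))
      (Proj.map g' (irrelevant_le_map_of_surjective g' hg'))
      (Proj.map g (irrelevant_le_map_of_surjective g hg))
      (Proj.map f (irrelevant_le_map_of_surjective f hf)) := by
  have := isClosedImmersion_map f' hf' (irrelevant_le_map_of_surjective f' hf')
  have := isClosedImmersion_map f hf (irrelevant_le_map_of_surjective f hf)
  have hcov : ⨆ s : (Σ i : {i : ℕ // 0 < i}, 𝒜 i),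
      (affineBasicOpen 𝒞 s.1.2 ⟨g s.2, mem_of_graded g s.2.2⟩).1 = ⊤ := by
    have h := congr((Proj.map g (irrelevant_le_map_of_surjective g hg)) ⁻¹ᵁ
      $(iSup_affineBasicOpen 𝒜))
    rw [Scheme.Hom.preimage_iSup] at h
    exact h
  refine isPullback_of_ker_le ?_ _ hcov
    (fun s => Proj.basicOpen 𝒜 (s.2 : A)) (fun s => le_rfl) ?_
  · rw [← Proj.map_comp, ← Proj.map_comp]
    simp only [w]
  · rintro ⟨⟨i, hi⟩, s, hs⟩ y hy
    obtain ⟨n, c, hc, h1, rfl⟩ := ker_map_app_basicOpen f' _ hi (mem_of_graded g hs) hy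
    obtain ⟨a, ha, rfl⟩ := exists_mem_of_surjective g hg hc
    obtain ⟨b, hb, hab⟩ := hker a h1
    -- The element `b` need not be homogeneous; its component of the degree of `a` has the same two
    -- properties.
    have h2 : f (DirectSum.decompose 𝒜 b (n • i)) = 0 := by
      rw [GradedRingHom.map_directSumDecompose, hb]; simp
    have h3 : g (DirectSum.decompose 𝒜 b (n • i)) = g a := by
      rw [GradedRingHom.map_directSumDecompose, hab, DirectSum.decompose_of_mem_same _ hc]
    have h4 := Ideal.mem_map_of_mem ((Proj.map g (irrelevant_le_map_of_surjective g hg)).appLE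
      (Proj.basicOpen 𝒜 s) (Proj.basicOpen 𝒞 (g s)) le_rfl).hom
      (mk_mem_ker_map_app_basicOpen f (irrelevant_le_map_of_surjective f hf) hs
      (SetLike.coe_mem (DirectSum.decompose 𝒜 b (n • i))) h2)
    rw [map_appLE_awayToSection _ _ hs, Away.map_mk] at h4
    simp only [h3] at h4
    exact h4
end ProjMap

/-! ### The structure morphism of `Proj`: base change and flatness. -/

section ProjStr

open HomogeneousLocalization

variable {R R' A B : Type} [CommRing R] [CommRing R'] [CommRing A] [CommRing B]
  [Algebra R A] [Algebra R' B] {𝒜 : ℕ → Submodule R A} {ℬ : ℕ → Submodule R' B}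
  [GradedAlgebra 𝒜] [GradedAlgebra ℬ]

/-- The structure map of the chart `D₊(s)` of `Proj 𝒜`. -/
def awayAlgebraMap (𝒜 : ℕ → Submodule R A) [GradedAlgebra 𝒜] (s : A) : R →+* Away 𝒜 s :=
  (fromZeroRingHom 𝒜 _).comp (algebraMap R (𝒜 0))

theorem awayι_projStr {m : ℕ} (hm : 0 < m) {s : A} (hs : s ∈ 𝒜 m) :
    Proj.awayι 𝒜 s hs hm ≫ projStr 𝒜 = Spec.map (CommRingCat.ofHom (awayAlgebraMap 𝒜 s)) := by
  rw [projStr, Proj.awayι_toSpecZero_assoc, ← Spec.map_comp]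
  rfl

theorem val_awayAlgebraMap (s : A) (r : R) :
    (awayAlgebraMap 𝒜 s r).val = algebraMap A _ (algebraMap R A r) := rfl

theorem awayAlgebraMap_mul_mk {m : ℕ} {s : A} (hs : s ∈ 𝒜 m) (r : R) (n : ℕ) (a : A)
    (ha : a ∈ 𝒜 (n • m)) :
    awayAlgebraMap 𝒜 s r * Away.mk 𝒜 hs n a ha =
      Away.mk 𝒜 hs n (r • a) (Submodule.smul_mem _ r ha) := by
  rw [ext_iff_val, val_mul, val_awayAlgebraMap, Away.val_mk, Away.val_mk,
    ← Localization.mk_one_eq_algebraMap, Localization.mk_mul, one_mul, Algebra.smul_def]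

theorem projStr_appLE {m : ℕ} (hm : 0 < m) {s : A} (hs : s ∈ 𝒜 m) :
    (Scheme.ΓSpecIso (.of R)).inv ≫ (projStr 𝒜).appLE ⊤ (Proj.basicOpen 𝒜 s) le_top =
      CommRingCat.ofHom (awayAlgebraMap 𝒜 s) ≫ Proj.awayToSection 𝒜 s := by
  have h1 : (Proj.basicOpen 𝒜 s).ι ≫ projStr 𝒜 = (Proj.basicOpen 𝒜 s).toSpecΓ ≫
      Spec.map (CommRingCat.ofHom (awayAlgebraMap 𝒜 s) ≫ Proj.awayToSection 𝒜 s) := by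
    have h2 : (Proj.basicOpen 𝒜 s).ι = Proj.basicOpenToSpec 𝒜 s ≫ Proj.awayι 𝒜 s hs hm := by
      rw [Proj.awayι, ← Proj.basicOpenIsoSpec_hom 𝒜 s hs hm, Iso.hom_inv_id_assoc]
    rw [h2, Category.assoc, awayι_projStr, Proj.basicOpenToSpec, Category.assoc, Spec.map_comp]
  have h3 := congr($(h1).appTop)
  rw [Scheme.Hom.comp_appTop, Scheme.Hom.comp_appTop, Scheme.Opens.toSpecΓ_appTop] at h3
  have h4 : (projStr 𝒜).appLE ⊤ (Proj.basicOpen 𝒜 s) le_top =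
      ((projStr 𝒜).appTop ≫ (Proj.basicOpen 𝒜 s).ι.appTop) ≫ (Proj.basicOpen 𝒜 s).topIso.hom := by
    rw [Category.assoc, Scheme.Opens.ι_appTop, Scheme.Opens.topIso_hom]
    change (projStr 𝒜).app ⊤ ≫ _ = (projStr 𝒜).app ⊤ ≫ _
    congr 1
  rw [h4, h3, Category.assoc, Category.assoc, Iso.inv_hom_id, Category.comp_id,
    Scheme.ΓSpecIso_naturality, Iso.inv_hom_id_assoc]

theorem map_projStr (f : 𝒜 →+*ᵍ ℬ)
    (hf : HomogeneousIdeal.irrelevant ℬ ≤ (HomogeneousIdeal.irrelevant 𝒜).map f) (ρ : R →+* R')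
    (h : ∀ r, f (algebraMap R A r) = algebraMap R' B (ρ r)) :
    Proj.map f hf ≫ projStr 𝒜 = projStr ℬ ≫ Spec.map (CommRingCat.ofHom ρ) := by
  suffices H : ∀ (m : ℕ) (hm : 0 < m) (s : A) (hs : s ∈ 𝒜 m),
      Proj.awayι ℬ (f s) (f.2 hs) hm ≫ Proj.map f hf ≫ projStr 𝒜 =
        Proj.awayι ℬ (f s) (f.2 hs) hm ≫ projStr ℬ ≫ Spec.map (CommRingCat.ofHom ρ) from
    (Proj.mapAffineOpenCover f hf).openCover.hom_ext _ _ fun s ↦ H s.1 s.1.2 s.2 s.2.2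
  intro m hm s hs
  rw [Proj.awayι_comp_map_assoc f hf hm _ hs, awayι_projStr,
    ← Category.assoc, awayι_projStr, ← Spec.map_comp, ← Spec.map_comp]
  congr 1
  ext r
  have h1 : (algebraMap R (𝒜 0) r : A) = algebraMap R A r := rfl
  have h2 : (algebraMap R' (ℬ 0) (ρ r) : B) = algebraMap R' B (ρ r) := rfl
  change val (Away.map f _ (HomogeneousLocalization.mk ⟨0, algebraMap R (𝒜 0) r, 1, one_mem _⟩)) =
    val (HomogeneousLocalization.mk ⟨0, algebraMap R' (ℬ 0) (ρ r), 1, one_mem _⟩)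
  rw [Away.map, map_mk]
  simp [h1, h2, h]

/-- Base change of `Proj 𝒜` along a surjection of base rings. -/
theorem isPullback_projStr (f : 𝒜 →+*ᵍ ℬ) (hf : Function.Surjective f) (ρ : R →+* R')
    (hρ : Function.Surjective ρ) (h : ∀ r, f (algebraMap R A r) = algebraMap R' B (ρ r))
    (hker : ∀ a, f a = 0 → ∃ r a', ρ r = 0 ∧ a = r • a') :
    IsPullback (Proj.map f (irrelevant_le_map_of_surjective f hf)) (projStr ℬ) (projStr 𝒜)
      (Spec.map (CommRingCat.ofHom ρ)) := by
  have := isClosedImmersion_map f hf (irrelevant_le_map_of_surjective f hf)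
  have : IsClosedImmersion (Spec.map (CommRingCat.ofHom ρ)) :=
    IsClosedImmersion.spec_of_surjective _ hρ
  refine isPullback_of_ker_le (map_projStr f _ ρ h) _ (iSup_affineBasicOpen 𝒜)
    (fun s => ⊤) (fun s => le_top) ?_
  rintro ⟨⟨i, hi⟩, s, hs⟩ y hy
  obtain ⟨n, a, ha, h1, rfl⟩ := ker_map_app_basicOpen f _ hi hs hy
  obtain ⟨r, a', hr, rfl⟩ := hker a h1
  -- Again the cofactor `a'` is replaced by its component in the degree of `a`, so that it defines a
  -- function on the chart.
  have h2 : r • (DirectSum.decompose 𝒜 a' (n • i) : A) = r • a' := by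
    rw [← Submodule.coe_smul, ← DirectSum.smul_apply, ← DirectSum.decompose_smul,
      DirectSum.decompose_of_mem_same _ ha]
  have h3 : (Scheme.ΓSpecIso (.of R)).inv.hom r ∈
      RingHom.ker ((Spec.map (CommRingCat.ofHom ρ)).app ⊤).hom := by
    have h4 := congr($(Scheme.ΓSpecIso_inv_naturality (CommRingCat.ofHom ρ)).hom r)
    simp only [CommRingCat.hom_comp, RingHom.comp_apply, CommRingCat.hom_ofHom, hr, map_zero] at h4
    exact h4.symm
  have h5 := Ideal.mem_map_of_mem
    ((projStr 𝒜).appLE ⊤ (Proj.basicOpen 𝒜 s) le_top).hom h3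
  have h6 := congr($(projStr_appLE hi hs).hom r)
  simp only [CommRingCat.hom_comp, RingHom.comp_apply, CommRingCat.hom_ofHom] at h6
  rw [h6] at h5
  have h7 := Ideal.mul_mem_right ((Proj.awayToSection 𝒜 s).hom (Away.mk 𝒜 hs n
    (DirectSum.decompose 𝒜 a' (n • i) : A) (SetLike.coe_mem _))) _ h5
  rw [← map_mul, awayAlgebraMap_mul_mk] at h7
  simp only [h2] at h7
  exact h7

/-- `Proj` of a torsion-free graded algebra over a principal ideal domain is flat. -/
theorem flat_projStr [IsDomain R] [IsPrincipalIdealRing R]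
    (h : ∀ (r : R) (a : A), r ≠ 0 → r • a = 0 → a = 0) : Flat (projStr 𝒜) := by
  suffices H : ∀ (m : ℕ) (hm : 0 < m) (s : A) (hs : s ∈ 𝒜 m),
      Flat (Proj.awayι 𝒜 s hs hm ≫ projStr 𝒜) from
    have : IsZariskiLocalAtSource @Flat.{0} := HasRingHomProperty.instIsZariskiLocalAtSource
    IsZariskiLocalAtSource.of_openCover (P := @Flat) (Proj.affineOpenCover 𝒜).openCover
      fun s ↦ H s.1 s.1.2 s.2 s.2.2
  intro m hm s hs
  rw [awayι_projStr, Flat.SpecMap_iff]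
  let : Algebra R (Away 𝒜 s) := (awayAlgebraMap 𝒜 s).toAlgebra
  have : Module.IsTorsionFree R (Away 𝒜 s) := by
    rw [Module.isTorsionFree_iff_smul_eq_zero]
    intro r x hx
    by_contra! hrx
    obtain ⟨n, a, ha, rfl⟩ := Away.mk_surjective _ hs x
    rw [Algebra.smul_def, RingHom.algebraMap_toAlgebra, awayAlgebraMap_mul_mk,
      away_mk_eq_zero_iff] at hx
    obtain ⟨k, hk⟩ := hx
    rw [mul_smul_comm] at hk
    exact hrx.2 ((away_mk_eq_zero_iff hs n a ha).mpr ⟨k, h r _ hrx.1 hk⟩)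
  exact inferInstanceAs (Module.Flat R (Away 𝒜 s))

end ProjStr

/-! ### Diagonalization of the quadratic form. -/

section Quadric

open MvPolynomial

/-- The linear form with coefficients `c`. -/
noncomputable def linForm (c : Fin 4 → ℂ) : MvPolynomial (Fin 4) ℂ := ∑ j, C (c j) * X j

theorem eval_linForm (c x : Fin 4 → ℂ) : eval x (linForm c) = c ⬝ᵥ x := by
  simp [linForm, dotProduct]

theorem isHomogeneous_linForm (c : Fin 4 → ℂ) : (linForm c).IsHomogeneous 1 :=
  IsHomogeneous.sum _ _ _ fun i _ => by simpa using (isHomogeneous_C _ (c i)).mul (isHomogeneous_X ℂ i)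

/-- The Gram matrix of a quadratic form. -/
noncomputable def gram (σ : MvPolynomial (Fin 4) ℂ) : Matrix (Fin 4) (Fin 4) ℂ :=
  fun i j => coeff 0 (pderiv i (pderiv j σ)) / 2

/-- Euler's relation for the linear form `∂ⱼσ`, whose own partial derivatives are constants. -/
theorem pderiv_eq_gram {σ : MvPolynomial (Fin 4) ℂ} (hσ : σ.IsHomogeneous 2) (j : Fin 4) :
    pderiv j σ = ∑ i, C (2 * gram σ i j) * X i := by
  have h1 : (pderiv j σ).IsHomogeneous 1 := hσ.pderiv
  have h2 := h1.sum_X_mul_pderiv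
  rw [one_smul] at h2
  rw [← h2]
  refine Finset.sum_congr rfl fun i _ => ?_
  have h3 : (pderiv i (pderiv j σ)).IsHomogeneous 0 := h1.pderiv
  rw [← totalDegree_zero_iff_isHomogeneous, totalDegree_eq_zero_iff_eq_C] at h3
  rw [h3, mul_comm]
  congr 2
  simp only [gram]
  ring

theorem eval_eq_gram {σ : MvPolynomial (Fin 4) ℂ} (hσ : σ.IsHomogeneous 2) (x : Fin 4 → ℂ) :
    eval x σ = ∑ i, ∑ j, gram σ i j * x i * x j := by
  have h := congr(eval x $(hσ.sum_X_mul_pderiv))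
  simp only [pderiv_eq_gram hσ] at h
  simp only [map_sum, map_mul, eval_X, eval_C, nsmul_eq_mul, map_natCast] at h
  rw [Finset.sum_comm]
  have h2 : eval x σ = (∑ j, x j * ∑ i, 2 * gram σ i j * x i) / 2 := by
    rw [h]; push_cast; ring
  rw [h2, Finset.sum_div]
  refine Finset.sum_congr rfl fun j _ => ?_
  rw [Finset.mul_sum, Finset.sum_div]
  exact Finset.sum_congr rfl fun i _ => by ring

theorem gram_symm (σ : MvPolynomial (Fin 4) ℂ) (i j : Fin 4) : gram σ i j = gram σ j i := by
  by_cases h : i = j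
  · rw [h]
  · simp [gram, coeff_pderiv, h, Ne.symm h, add_comm]

/-- A nondegenerate quadratic form over `ℂ` is a sum of squares of independent linear forms. -/
theorem exists_sum_sq (σ : stdGrading 2) (hσ : IsSmoothQuadric σ) :
    ∃ N N' : Matrix (Fin 4) (Fin 4) ℂ, N * N' = 1 ∧ N' * N = 1 ∧
      (σ : MvPolynomial (Fin 4) ℂ) = ∑ i, linForm (N i) ^ 2 := by
  set G := gram (σ : MvPolynomial (Fin 4) ℂ)
  have hh : (σ : MvPolynomial (Fin 4) ℂ).IsHomogeneous 2 := σ.2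
  set Q₁ : QuadraticForm ℂ (Fin 4 → ℂ) := G.toQuadraticForm'
  set Q₂ : QuadraticForm ℂ (Fin 4 → ℂ) := QuadraticMap.weightedSumSquares ℂ (1 : Fin 4 → ℂ)
  have hQ₁ : ∀ x, Q₁ x = ∑ i, ∑ j, G i j * x i * x j := by
    intro x
    simp only [Q₁, Matrix.toQuadraticForm', LinearMap.BilinMap.toQuadraticMap_apply,
      Matrix.toLinearMap₂'_apply, smul_eq_mul]
    exact Finset.sum_congr rfl fun i _ => Finset.sum_congr rfl fun j _ => by ring
  have hQ₂ : ∀ x, Q₂ x = ∑ i, x i ^ 2 := by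
    intro x
    simp [Q₂, QuadraticMap.weightedSumSquares_apply, sq]
  -- Nondegenerate forms of equal rank over an algebraically closed field are equivalent. For `σ`, a
  -- vector orthogonal to all basis vectors is a zero of all partial derivatives, so smoothness is
  -- nondegeneracy.
  obtain ⟨e⟩ := QuadraticForm.equivalent_of_isAlgClosed Q₁ Q₂ (by
    intro x hx
    refine hσ x fun i => ?_
    have h := QuadraticMap.associated_isOrtho.mp (hx (Pi.single i 1))
    rw [QuadraticMap.isOrtho_def, hQ₁, hQ₁, hQ₁] at h
    rw [pderiv_eq_gram hh]
    have hs := gram_symm (σ : MvPolynomial (Fin 4) ℂ)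
    have h01 := hs 0 1; have h02 := hs 0 2; have h03 := hs 0 3
    have h12 := hs 1 2; have h13 := hs 1 3; have h23 := hs 2 3
    simp only [map_sum, map_mul, eval_C, eval_X]
    fin_cases i <;> simp [Fin.sum_univ_four, G] at h ⊢
    · linear_combination h - x 1 * h01 - x 2 * h02 - x 3 * h03
    · linear_combination h + x 0 * h01 - x 2 * h12 - x 3 * h13
    · linear_combination h + x 0 * h02 + x 1 * h12 - x 3 * h23
    · linear_combination h + x 0 * h03 + x 1 * h13 + x 2 * h23) (by
    intro x hx
    ext i
    have h := QuadraticMap.associated_isOrtho.mp (hx (Pi.single i 1))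
    rw [QuadraticMap.isOrtho_def, hQ₂, hQ₂, hQ₂] at h
    fin_cases i <;> simp [Fin.sum_univ_four] at h ⊢ <;> linear_combination h / 2)
  refine ⟨LinearMap.toMatrix' e.toLinearEquiv.toLinearMap,
    LinearMap.toMatrix' e.toLinearEquiv.symm.toLinearMap, ?_, ?_, ?_⟩
  · rw [← LinearMap.toMatrix'_comp, LinearEquiv.comp_symm, LinearMap.toMatrix'_id]
  · rw [← LinearMap.toMatrix'_comp, LinearEquiv.symm_comp, LinearMap.toMatrix'_id]
  · refine MvPolynomial.funext fun x => ?_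
    rw [eval_eq_gram hh, ← hQ₁, ← e.map_app, hQ₂, map_sum]
    refine Finset.sum_congr rfl fun i _ => ?_
    rw [map_pow, eval_linForm]
    congr 1
    exact (congrFun (LinearMap.toMatrix'_mulVec e.toLinearEquiv.toLinearMap x) i).symm

end Quadric

/-! ### The split form `X Z - Y W` and irreducibility of the equations. -/

section SplitForm

open MvPolynomial

theorem linForm_sum (K : Fin 4 → ℂ) (N : Matrix (Fin 4) (Fin 4) ℂ) :
    linForm (fun j => ∑ k, K k * N k j) = ∑ k, C (K k) * linForm (N k) := by
  simp only [linForm, Finset.mul_sum, map_sum, Finset.sum_mul, map_mul]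
  rw [Finset.sum_comm]
  exact Finset.sum_congr rfl fun i _ => Finset.sum_congr rfl fun j _ => by ring

theorem linForm_mul (K N : Matrix (Fin 4) (Fin 4) ℂ) (i : Fin 4) :
    linForm ((K * N) i) = ∑ k, C (K i k) * linForm (N k) :=
  linForm_sum (K i) N

/-- The linear substitution `Xᵢ ↦ ∑ⱼ Mᵢⱼ Xⱼ`. -/
noncomputable def linSubst (M : Matrix (Fin 4) (Fin 4) ℂ) :
    MvPolynomial (Fin 4) ℂ →ₐ[ℂ] MvPolynomial (Fin 4) ℂ :=
  aeval fun i => linForm (M i)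

@[simp]
theorem linSubst_X (M : Matrix (Fin 4) (Fin 4) ℂ) (i : Fin 4) :
    linSubst M (X i) = linForm (M i) := aeval_X _ _

theorem linSubst_linForm (M : Matrix (Fin 4) (Fin 4) ℂ) (c : Fin 4 → ℂ) :
    linSubst M (linForm c) = ∑ j, C (c j) * linForm (M j) := by
  simp only [linForm, map_sum, map_mul, linSubst_X, algHom_C, algebraMap_eq]

theorem linSubst_comp {M M' : Matrix (Fin 4) (Fin 4) ℂ} (h : M' * M = 1) :
    (linSubst M).comp (linSubst M') = AlgHom.id ℂ _ := by
  ext1 i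
  rw [AlgHom.comp_apply, linSubst_X, linSubst_linForm, ← linForm_mul, h]
  simp [linForm, Matrix.one_apply, ite_mul]

/-- An invertible linear substitution as an automorphism of the polynomial ring. -/
noncomputable def linEquiv {M M' : Matrix (Fin 4) (Fin 4) ℂ} (h : M * M' = 1) (h' : M' * M = 1) :
    MvPolynomial (Fin 4) ℂ ≃ₐ[ℂ] MvPolynomial (Fin 4) ℂ :=
  AlgEquiv.ofAlgHom (linSubst M) (linSubst M') (linSubst_comp h') (linSubst_comp h)

/-- If `σ` is a sum of four squares and `l = ∑ kᵢ ℓᵢ` is anisotropic, then `σ = X Z - Y W` in linear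
coordinates with `W - Y` proportional to `l`. -/
theorem exists_split_form {N N' : Matrix (Fin 4) (Fin 4) ℂ} (h : N * N' = 1) (h' : N' * N = 1)
    (k : Fin 4 → ℂ) (hk : ∑ i, k i ^ 2 ≠ 0) :
    ∃ (M M' : Matrix (Fin 4) (Fin 4) ℂ) (κ : ℂ), M * M' = 1 ∧ M' * M = 1 ∧ κ ≠ 0 ∧
      ∑ i, linForm (N i) ^ 2 =
        linForm (M 0) * linForm (M 1) - linForm (M 2) * linForm (M 3) ∧
      ∑ i, C (k i) * linForm (N i) = C κ * (linForm (M 3) - linForm (M 2)) := by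
  -- Dividing by a square root of `∑ kᵢ²` normalizes `k` to a vector `q` with `∑ qᵢ² = 1`.
  obtain ⟨s, hs⟩ := IsAlgClosed.exists_pow_nat_eq (∑ i, k i ^ 2) (n := 2) (by norm_num)
  have hs0 : s ≠ 0 := by rintro rfl; exact hk (by rw [← hs]; simp)
  set q : Fin 4 → ℂ := fun i => k i / s
  have hq : q 0 ^ 2 + q 1 ^ 2 + q 2 ^ 2 + q 3 ^ 2 = 1 := by
    have : k 0 ^ 2 + k 1 ^ 2 + k 2 ^ 2 + k 3 ^ 2 = s ^ 2 := by rw [hs, Fin.sum_univ_four]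
    simp only [q, div_pow]
    field_simp
    exact this
  -- Quaternion multiplication completes the unit vector `q`, as first row, to an orthogonal matrix.
  -- In the new coordinates `y = H ℓ` the given linear form is `s y₀`.
  set H : Matrix (Fin 4) (Fin 4) ℂ :=
    !![q 0, q 1, q 2, q 3; -q 1, q 0, -q 3, q 2; -q 2, q 3, q 0, -q 1; -q 3, -q 2, q 1, q 0]
  have hH : H * H.transpose = 1 := by
    ext i j
    fin_cases i <;> fin_cases j <;> simp [H, Matrix.mul_apply, Fin.sum_univ_four] <;> grind
  have hH' : H.transpose * H = 1 := mul_eq_one_comm.mp hH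
  set I := Complex.I
  have hI : I ^ 2 = -1 := Complex.I_sq
  -- The coordinates `X = y₁ + i y₂`, `Z = y₁ - i y₂`, `Y = -y₀ + i y₃`, `W = y₀ + i y₃` satisfy `X
  -- Z - Y W = ∑ yᵢ²` and `W - Y = 2 y₀`, whence `κ = s / 2`.
  set K : Matrix (Fin 4) (Fin 4) ℂ := !![0, 1, I, 0; 0, 1, -I, 0; -1, 0, 0, I; 1, 0, 0, I]
  set K' : Matrix (Fin 4) (Fin 4) ℂ :=
    !![0, 0, -1/2, 1/2; 1/2, 1/2, 0, 0; -I/2, I/2, 0, 0; 0, 0, -I/2, -I/2]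
  have hK : K * K' = 1 := by
    ext i j
    fin_cases i <;> fin_cases j <;> simp [K, K', Matrix.mul_apply, Fin.sum_univ_four] <;> grind
  have hK' : K' * K = 1 := mul_eq_one_comm.mp hK
  refine ⟨K * H * N, N' * H.transpose * K', s / 2, ?_, ?_, by simpa using hs0, ?_, ?_⟩
  · calc K * H * N * (N' * H.transpose * K') = K * (H * (N * N') * H.transpose) * K' := by
          simp only [Matrix.mul_assoc]
      _ = 1 := by rw [h, Matrix.mul_one, hH, Matrix.mul_one, hK]
  · calc N' * H.transpose * K' * (K * H * N) = N' * (H.transpose * (K' * K) * H) * N := by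
          simp only [Matrix.mul_assoc]
      _ = 1 := by rw [hK', Matrix.mul_one, hH', Matrix.mul_one, h']
  · have hC : C (σ := Fin 4) (q 0) ^ 2 + C (q 1) ^ 2 + C (q 2) ^ 2 + C (q 3) ^ 2 = 1 := by
      rw [← map_one C, ← hq]; simp
    have hCI : C (σ := Fin 4) I ^ 2 = -1 := by rw [← map_pow, hI]; simp
    rw [Matrix.mul_assoc]
    simp only [linForm_mul, Fin.sum_univ_four]
    simp [K, H]
    grind
  · have hCI : C (σ := Fin 4) (s / 2) * C (q 0) = C (k 0) * C (1 / 2) := by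
      rw [← map_mul, ← map_mul]; congr 1; simp only [q]; field_simp
    have hCI1 : C (σ := Fin 4) (s / 2) * C (q 1) = C (k 1) * C (1 / 2) := by
      rw [← map_mul, ← map_mul]; congr 1; simp only [q]; field_simp
    have hCI2 : C (σ := Fin 4) (s / 2) * C (q 2) = C (k 2) * C (1 / 2) := by
      rw [← map_mul, ← map_mul]; congr 1; simp only [q]; field_simp
    have hCI3 : C (σ := Fin 4) (s / 2) * C (q 3) = C (k 3) * C (1 / 2) := by
      rw [← map_mul, ← map_mul]; congr 1; simp only [q]; field_simp
    have h2 : C (σ := Fin 4) (1 / 2 : ℂ) * 2 = 1 := by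
      rw [show (2 : MvPolynomial (Fin 4) ℂ) = C 2 from rfl, ← map_mul]; norm_num
    rw [Matrix.mul_assoc]
    simp only [linForm_mul, Fin.sum_univ_four]
    simp [K, H]
    grind

/-- A smooth quadric is irreducible. -/
theorem prime_of_isSmoothQuadric (σ : stdGrading 2) (hσ : IsSmoothQuadric σ) :
    Prime (σ : MvPolynomial (Fin 4) ℂ) := by
  obtain ⟨N, N', h, h', hN⟩ := exists_sum_sq σ hσ
  obtain ⟨M, M', κ, hM, hM', -, hs, -⟩ := exists_split_form h h' ![1, 0, 0, 0]
    (by simp [Fin.sum_univ_four])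
  have h1 : (σ : MvPolynomial (Fin 4) ℂ) = linEquiv hM hM' (X 0 * X 1 + (- (X 2 * X 3))) := by
    rw [hN, hs]
    change _ = linSubst M _
    simp [sub_eq_add_neg]
  rw [h1, MulEquiv.prime_iff (linEquiv hM hM')]
  -- The form `X Z - Y W` is linear in `Z`, with coefficient `X` coprime to `Y W`.
  refine (irreducible_mul_X_add _ _ _ (X_ne_zero 0) (by simp) ?_ ?_).prime
  · rw [vars_neg]
    intro hmem
    have := vars_mul _ _ hmem
    simp at this
  · have hp : Prime (X 0 : MvPolynomial (Fin 4) ℂ) := X_prime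
    refine (hp.irreducible.isRelPrime_iff_not_dvd).mpr fun hd => ?_
    rw [dvd_neg] at hd
    rcases hp.dvd_or_dvd hd with h | h <;> rw [X_dvd_X] at h <;> simp at h

/-- Adjoining the unused variable `w` preserves primality; the inclusion of variables is factored
through its range, so that what remains is the inclusion of a subset of the variables. -/
theorem prime_coneEq (σ : stdGrading 2) (hσ : IsSmoothQuadric σ) :
    Prime (coneEq σ : MvPolynomial (Fin 5) ℂ) := by
  let e := Equiv.ofInjective (Fin.castSucc : Fin 4 → Fin 5) (Fin.castSucc_injective 4)
  have h1 : (coneEq σ : MvPolynomial (Fin 5) ℂ) =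
      rename Subtype.val (renameEquiv ℂ e (σ : MvPolynomial (Fin 4) ℂ)) := by
    simp only [coneEq, renameEquiv_apply, rename_rename]
    rfl
  rw [h1, prime_rename_iff, MulEquiv.prime_iff (renameEquiv ℂ e)]
  exact prime_of_isSmoothQuadric σ hσ

theorem last_notMem_vars_coneEq (σ : stdGrading 2) :
    Fin.last 4 ∉ (coneEq σ : MvPolynomial (Fin 5) ℂ).vars := by
  classical
  intro h
  have h2 := vars_rename (Fin.castSucc : Fin 4 → Fin 5) (σ : MvPolynomial (Fin 4) ℂ) h
  rw [Finset.mem_image] at h2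
  obtain ⟨i, -, hi⟩ := h2
  exact (Fin.castSucc_lt_last i).ne hi

/-- All fibres of the family `t w = σ` are irreducible. -/
theorem prime_fibreEq (σ : stdGrading 2) (hσ : IsSmoothQuadric σ) (c : ℂ) :
    Prime (C c * X 4 - (coneEq σ : MvPolynomial (Fin 5) ℂ)) := by
  by_cases hc : c = 0
  · subst hc
    simpa using (prime_coneEq σ hσ).neg
  · rw [sub_eq_add_neg]
    refine (irreducible_mul_X_add _ _ (4 : Fin 5) (by simpa using hc) (by simp) ?_ ?_).prime
    · rw [vars_neg]
      exact last_notMem_vars_coneEq σ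
    · exact IsUnit.isRelPrime_left ((isUnit_iff_ne_zero.mpr hc).map C)

end SplitForm

/-! ### The family `t w = σ` and torsion-freeness over `ℂ[t]`. -/

section Family

open MvPolynomial

theorem mem_span₂_iff {R A : Type} [CommRing R] [CommRing A] [Algebra R A]
    (𝒜 : ℕ → Submodule R A) [GradedAlgebra 𝒜] {m n : ℕ} (f : 𝒜 m) (g : 𝒜 n) (a : A) :
    a ∈ (span₂ 𝒜 f g).toIdeal ↔ ∃ b c, a = f * b + g * c := by
  change a ∈ Ideal.span {(f : A), (g : A)} ↔ _
  rw [Ideal.mem_span_pair]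
  simp only [mul_comm, eq_comm]

theorem mem_span₁_iff {R A : Type} [CommRing R] [CommRing A] [Algebra R A]
    (𝒜 : ℕ → Submodule R A) [GradedAlgebra 𝒜] {m : ℕ} (f : 𝒜 m) (a : A) :
    a ∈ (span₁ 𝒜 f).toIdeal ↔ (f : A) ∣ a := by
  exact Ideal.mem_span_singleton

/-- The grading of `ℂ[t][x₀,…,x₃,w]` with weights `(1,1,1,1,2)` and `t` of degree `0`. -/
noncomputable abbrev famGrading :
    ℕ → Submodule (Polynomial ℂ) (MvPolynomial (Fin 5) (Polynomial ℂ)) :=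
  weightedHomogeneousSubmodule (Polynomial ℂ) wt

noncomputable instance famGrading.gradedAlgebra : GradedAlgebra famGrading :=
  weightedGradedAlgebra (Polynomial ℂ) wt

/-- Specialization of the parameter to `t = c`. -/
noncomputable abbrev specialize (c : ℂ) :
    MvPolynomial (Fin 5) (Polynomial ℂ) →+* MvPolynomial (Fin 5) ℂ :=
  map (Polynomial.evalRingHom c)

theorem isWeightedHomogeneous_map {R R' : Type*} [CommSemiring R] [CommSemiring R'] (f : R →+* R')
    {φ : MvPolynomial (Fin 5) R} {n : ℕ} (h : φ.IsWeightedHomogeneous wt n) :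
    (map f φ).IsWeightedHomogeneous wt n := by
  intro m hm
  rw [coeff_map] at hm
  exact h fun h0 => hm (by rw [h0, map_zero])

theorem specialize_map_C (c : ℂ) (f : MvPolynomial (Fin 5) ℂ) :
    specialize c (map Polynomial.C f) = f := by
  rw [map_map]
  convert map_id f
  ext; simp

/-- The equation `t w - σ` of the family. -/
noncomputable def famEq (σ : stdGrading 2) : famGrading 2 :=
  ⟨C Polynomial.X * X 4 - map Polynomial.C (coneEq σ : MvPolynomial (Fin 5) ℂ), by
    refine Submodule.sub_mem _ ?_ (isWeightedHomogeneous_map _ (coneEq σ).2)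
    have h := (isWeightedHomogeneous_C wt (Polynomial.X : Polynomial ℂ)).mul
      (isWeightedHomogeneous_X (Polynomial ℂ) wt (4 : Fin 5))
    rwa [zero_add] at h⟩

/-- `p` as a polynomial with coefficients in `ℂ[t]`. -/
noncomputable def famP {d : ℕ} (p : wtGrading d) : famGrading d :=
  ⟨map Polynomial.C (p : MvPolynomial (Fin 5) ℂ), isWeightedHomogeneous_map _ p.2⟩

theorem specialize_famEq (σ : stdGrading 2) (c : ℂ) :
    specialize c (famEq σ) = C c * X 4 - (coneEq σ : MvPolynomial (Fin 5) ℂ) := by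
  simp only [famEq, map_sub, map_mul, specialize_map_C]
  simp

theorem specialize_famP {d : ℕ} (p : wtGrading d) (c : ℂ) :
    specialize c (famP p) = (p : MvPolynomial (Fin 5) ℂ) :=
  specialize_map_C c _

theorem specialize_eq_zero_iff (c : ℂ) (f : MvPolynomial (Fin 5) (Polynomial ℂ)) :
    specialize c f = 0 ↔ C (Polynomial.X - Polynomial.C c) ∣ f := by
  rw [C_dvd_iff_dvd_coeff, MvPolynomial.ext_iff]
  simp [coeff_map, Polynomial.dvd_iff_isRoot]

theorem specialize_surjective (c : ℂ) : Function.Surjective (specialize c) :=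
  fun f => ⟨_, specialize_map_C c f⟩

/-- The equation is linear in `w` with prime coefficient `t`, and `t` does not divide `σ` because
`σ` survives specialization at `t = 0`. -/
theorem prime_famEq (σ : stdGrading 2) (hσ : IsSmoothQuadric σ) :
    Prime (famEq σ : MvPolynomial (Fin 5) (Polynomial ℂ)) := by
  simp only [famEq, sub_eq_add_neg]
  refine (irreducible_mul_X_add _ _ (4 : Fin 5) (by simp) (by simp) ?_ ?_).prime
  · rw [vars_neg, vars_map_of_injective _ (Polynomial.C_injective)]
    exact last_notMem_vars_coneEq σ
  · have hp : Prime (C (Polynomial.X : Polynomial ℂ) : MvPolynomial (Fin 5) (Polynomial ℂ)) :=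
      (prime_C_iff _).mpr Polynomial.prime_X
    refine (hp.irreducible.isRelPrime_iff_not_dvd).mpr fun hd => ?_
    replace hd := (dvd_neg (a := C Polynomial.X)
      (b := map Polynomial.C (coneEq σ : MvPolynomial (Fin 5) ℂ))).mp hd
    have h1 := (specialize_eq_zero_iff 0 (map Polynomial.C (coneEq σ : MvPolynomial (Fin 5) ℂ))).mpr
      (by simpa using hd)
    rw [specialize_map_C] at h1
    exact (prime_coneEq σ hσ).ne_zero h1

/-- The open condition on `p` used for flatness: `p` does not vanish identically on `σ = w = 0`. -/
def NonvanishingOnQuadric (σ : stdGrading 2) {d : ℕ} (p : wtGrading d) : Prop :=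
  ∃ x : Fin 5 → ℂ, x 4 = 0 ∧ eval x (coneEq σ : MvPolynomial (Fin 5) ℂ) = 0 ∧
    eval x (p : MvPolynomial (Fin 5) ℂ) ≠ 0

variable {σ : stdGrading 2} {d : ℕ} {p : wtGrading d}

/-- All fibre equations `c w - σ` vanish at a point with `w = σ = 0`, so one such point serves every
`c` simultaneously. -/
theorem NonvanishingOnQuadric.not_dvd (hp : NonvanishingOnQuadric σ p) (c : ℂ) :
    ¬ (C c * X 4 - (coneEq σ : MvPolynomial (Fin 5) ℂ)) ∣ (p : MvPolynomial (Fin 5) ℂ) := by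
  rintro ⟨g, hg⟩
  obtain ⟨x, h4, h0, h⟩ := hp
  apply h
  rw [hg]
  simp [h4, h0]

theorem NonvanishingOnQuadric.not_famEq_dvd (hp : NonvanishingOnQuadric σ p) :
    ¬ (famEq σ : MvPolynomial (Fin 5) (Polynomial ℂ)) ∣ famP p := by
  intro h
  have h1 := map_dvd (specialize 0) h
  rw [specialize_famEq, specialize_famP] at h1
  exact hp.not_dvd 0 h1

/-- The family equation has positive weight, hence no constant term, while `r` is its own constant
term. -/
theorem famEq_not_dvd_C (σ : stdGrading 2) {r : Polynomial ℂ} (hr : r ≠ 0) :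
    ¬ (famEq σ : MvPolynomial (Fin 5) (Polynomial ℂ)) ∣ C r := by
  intro h
  have h1 := map_dvd (constantCoeff (R := Polynomial ℂ) (σ := Fin 5)) h
  have h2 : constantCoeff (famEq σ : MvPolynomial (Fin 5) (Polynomial ℂ)) = 0 := by
    by_contra h2
    have h3 := (famEq σ).2 h2
    simp at h3
  rw [h2, constantCoeff_C, zero_dvd_iff] at h1
  exact hr h1

theorem mk_smul_eq {I : HomogeneousIdeal famGrading} (r : Polynomial ℂ)
    (f : MvPolynomial (Fin 5) (Polynomial ℂ)) :
    r • (Ideal.Quotient.mk I.toIdeal f) = Ideal.Quotient.mk I.toIdeal (C r * f) := by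
  rw [← smul_eq_C_mul]
  rfl

theorem torsionFree_family (hσ : IsSmoothQuadric σ) (r : Polynomial ℂ)
    (a : MvPolynomial (Fin 5) (Polynomial ℂ) ⧸ (span₁ famGrading (famEq σ)).toIdeal) (hr : r ≠ 0)
    (h : r • a = 0) : a = 0 := by
  obtain ⟨f, rfl⟩ := Ideal.Quotient.mk_surjective a
  rw [mk_smul_eq, Ideal.Quotient.eq_zero_iff_mem, mem_span₁_iff] at h
  rw [Ideal.Quotient.eq_zero_iff_mem, mem_span₁_iff]
  exact ((prime_famEq σ hσ).dvd_or_dvd h).resolve_left (famEq_not_dvd_C σ hr)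

/-- Flatness of the divisor at `t = c`. In a relation `(t - c) a = F b + p e`, specialization gives
`F_c ∣ p e_c`, so the prime `F_c` divides `e_c`. Hence `e = F e₁ + (t - c) e₂`, and `F` divides `(t
- c)(a - p e₂)`; being prime and not dividing `t - c`, it divides `a - p e₂`. -/
theorem mem_of_C_linear_mul_mem (hσ : IsSmoothQuadric σ) (hp : NonvanishingOnQuadric σ p) (c : ℂ)
    (a : MvPolynomial (Fin 5) (Polynomial ℂ))
    (h : C (Polynomial.X - Polynomial.C c) * a ∈ (span₂ famGrading (famEq σ) (famP p)).toIdeal) :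
    a ∈ (span₂ famGrading (famEq σ) (famP p)).toIdeal := by
  rw [mem_span₂_iff] at h ⊢
  obtain ⟨b, e, h⟩ := h
  have h0 : specialize c (C (Polynomial.X - Polynomial.C c)) = 0 := by simp
  have h1 := congr(specialize c $h)
  rw [map_mul, h0, zero_mul, map_add, map_mul, map_mul, specialize_famEq, specialize_famP] at h1
  obtain ⟨e', he'⟩ := ((prime_fibreEq σ hσ c).dvd_or_dvd (a := (p : MvPolynomial (Fin 5) ℂ))
    (b := specialize c e) ⟨- specialize c b, by linear_combination -h1⟩).resolve_left (hp.not_dvd c)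
  obtain ⟨e₁, rfl⟩ := specialize_surjective c e'
  rw [← specialize_famEq, ← map_mul, ← sub_eq_zero, ← map_sub, specialize_eq_zero_iff] at he'
  obtain ⟨e₂, he₂⟩ := he'
  have h2 : (famEq σ : MvPolynomial (Fin 5) (Polynomial ℂ)) ∣
      C (Polynomial.X - Polynomial.C c) * (a - (famP p).1 * e₂) :=
    ⟨b + (famP p).1 * e₁, by linear_combination h + (famP p).1 * he₂⟩
  obtain ⟨g, hg⟩ := ((prime_famEq σ hσ).dvd_or_dvd h2).resolve_left
    (famEq_not_dvd_C σ (Polynomial.X_sub_C_ne_zero c))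
  exact ⟨g, e₂, by linear_combination hg⟩

/-- Over `ℂ` a nonzero `r` is a constant times linear factors, which are cancelled one at a time. -/
theorem mem_of_C_mul_mem (hσ : IsSmoothQuadric σ) (hp : NonvanishingOnQuadric σ p)
    (r : Polynomial ℂ) (hr : r ≠ 0) (a : MvPolynomial (Fin 5) (Polynomial ℂ))
    (h : C r * a ∈ (span₂ famGrading (famEq σ) (famP p)).toIdeal) :
    a ∈ (span₂ famGrading (famEq σ) (famP p)).toIdeal := by
  induction hn : r.natDegree generalizing r with
  | zero =>
    obtain ⟨c, rfl⟩ := Polynomial.natDegree_eq_zero.mp hn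
    have hc : c ≠ 0 := by simpa using hr
    have h2 := Ideal.mul_mem_left _ (C (Polynomial.C c⁻¹)) h
    rwa [← mul_assoc, ← map_mul, ← map_mul, inv_mul_cancel₀ hc, map_one, map_one, one_mul] at h2
  | succ n ih =>
    obtain ⟨c, hc⟩ := IsAlgClosed.exists_root r (by
      rw [Polynomial.degree_eq_natDegree hr, hn]; exact_mod_cast Nat.succ_ne_zero n)
    obtain ⟨q, rfl⟩ := Polynomial.dvd_iff_isRoot.mpr hc
    have hq : q ≠ 0 := right_ne_zero_of_mul hr
    rw [map_mul, mul_assoc] at h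
    refine ih q hq (mem_of_C_linear_mul_mem hσ hp c _ h) ?_
    rw [Polynomial.natDegree_mul (Polynomial.X_sub_C_ne_zero c) hq,
      Polynomial.natDegree_X_sub_C] at hn
    omega

theorem torsionFree_divisor (hσ : IsSmoothQuadric σ) (hp : NonvanishingOnQuadric σ p)
    (r : Polynomial ℂ)
    (a : MvPolynomial (Fin 5) (Polynomial ℂ) ⧸ (span₂ famGrading (famEq σ) (famP p)).toIdeal)
    (hr : r ≠ 0) (h : r • a = 0) : a = 0 := by
  obtain ⟨f, rfl⟩ := Ideal.Quotient.mk_surjective a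
  rw [mk_smul_eq, Ideal.Quotient.eq_zero_iff_mem] at h
  exact Ideal.Quotient.eq_zero_iff_mem.mpr (mem_of_C_mul_mem hσ hp r hr f h)

theorem famGrading_zero_eq_C {f : MvPolynomial (Fin 5) (Polynomial ℂ)} (hf : f ∈ famGrading 0) :
    ∃ r, f = C r := by
  refine ⟨coeff 0 f, ?_⟩
  ext1 m
  classical
  rw [coeff_C]
  split_ifs with h
  · rw [h]
  · by_contra hm
    have h1 := hf hm
    rw [Finsupp.weight_apply, Finsupp.sum_fintype _ _ (by simp)] at h1
    apply h
    ext i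
    have h2 := (Finset.sum_eq_zero_iff.mp h1) i (Finset.mem_univ _)
    have h3 : wt i ≠ 0 := by fin_cases i <;> simp [wt]
    simp only [smul_eq_mul, mul_eq_zero, h3, or_false] at h2
    exact h2.symm

theorem isProjectiveOverA1_projStr (I : HomogeneousIdeal famGrading) :
    IsProjectiveOverA1 (projStr (quotientGrading famGrading I)) := by
  refine ⟨_, _, _, quotientGrading famGrading I, inferInstance, ?_, ?_, Iso.refl _, by simp⟩
  · exact Algebra.FiniteType.of_surjective (Ideal.Quotient.mkₐ (Polynomial ℂ) I.toIdeal)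
      (Ideal.Quotient.mkₐ_surjective _ _)
  · rintro ⟨_, f, hf, rfl⟩
    obtain ⟨r, rfl⟩ := famGrading_zero_eq_C hf
    exact ⟨r, rfl⟩

end Family

/-! ### The fibres of the family. -/

section Fibres

open MvPolynomial

/-- A graded ring homomorphism killing `I` factors through the quotient by `I`. -/
noncomputable def quotLift {R A B τ : Type} [CommRing R] [CommRing A] [Algebra R A] [CommRing B]
    [SetLike τ B] {𝒜 : ℕ → Submodule R A} [GradedAlgebra 𝒜] {ℬ : ℕ → τ} (I : HomogeneousIdeal 𝒜)
    (f : 𝒜 →+*ᵍ ℬ) (h : ∀ a ∈ I.toIdeal, f a = 0) : quotientGrading 𝒜 I →+*ᵍ ℬ where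
  __ := Ideal.Quotient.lift I.toIdeal (f : A →+* B) h
  map_mem := by
    rintro n _ ⟨a, ha, rfl⟩
    exact mem_of_graded f ha

theorem factorHom_surjective {R A : Type} [CommRing R] [CommRing A] [Algebra R A]
    (𝒜 : ℕ → Submodule R A) [GradedAlgebra 𝒜] {I J : HomogeneousIdeal 𝒜} (h : I ≤ J) :
    Function.Surjective (factorHom 𝒜 h) := by
  intro x
  obtain ⟨a, rfl⟩ := Ideal.Quotient.mk_surjective x
  exact ⟨Ideal.Quotient.mk _ a, rfl⟩

theorem quotientHom_surjective {R A : Type} [CommRing R] [CommRing A] [Algebra R A]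
    (𝒜 : ℕ → Submodule R A) [GradedAlgebra 𝒜] (I : HomogeneousIdeal 𝒜) :
    Function.Surjective (quotientHom 𝒜 I) :=
  Ideal.Quotient.mk_surjective

/-- Specialization at `t = c` as a graded ring homomorphism. -/
noncomputable def specializeHom (c : ℂ) : famGrading →+*ᵍ wtGrading where
  __ := specialize c
  map_mem := fun h => isWeightedHomogeneous_map _ h

variable {σ : stdGrading 2} {d : ℕ} {p : wtGrading d}

/-- Treats the special and the general fibres uniformly: `ℬ` plays the coordinate ring of the fibre
threefold, presented as `ℂ[x, w] / (c w - σ)`, and `𝒟` its quotient by `p`. The first square is base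
change along `t = c`, the second an intersection of closed subschemes. -/
theorem isFibrePair_of_graded {B D : Type} [CommRing B] [Algebra ℂ B] [CommRing D] [Algebra ℂ D]
    {ℬ : ℕ → Submodule ℂ B} [GradedAlgebra ℬ] {𝒟 : ℕ → Submodule ℂ D} [GradedAlgebra 𝒟]
    (c : ℂ) (β : wtGrading →+*ᵍ ℬ) (hβ : Function.Surjective β)
    (hβC : ∀ r, β (C r) = algebraMap ℂ B r)
    (hker : ∀ f, β f = 0 ↔ (C c * X 4 - (coneEq σ : MvPolynomial (Fin 5) ℂ)) ∣ f)
    (δ : ℬ →+*ᵍ 𝒟) (hδ : Function.Surjective δ) (hδker : ∀ b, δ b = 0 ↔ β p ∣ b) :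
    IsFibrePair (projV.incl famGrading (span₁_le_span₂ famGrading (famEq σ) (famP p)))
      (projStr _) c (Proj.map δ (irrelevant_le_map_of_surjective δ hδ)) (projStr ℬ) := by
  have hΦ : ∀ a, (β.comp (specializeHom c)) a = β (specialize c a) := fun a => rfl
  have h1 : ∀ a ∈ (span₁ famGrading (famEq σ)).toIdeal, (β.comp (specializeHom c)) a = 0 := by
    intro a ha
    rw [mem_span₁_iff] at ha
    rw [hΦ, hker, ← specialize_famEq]
    exact map_dvd _ ha
  have h2 : ∀ a ∈ (span₂ famGrading (famEq σ) (famP p)).toIdeal,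
      (δ.comp (β.comp (specializeHom c))) a = 0 := by
    intro a ha
    obtain ⟨b, e, rfl⟩ := (mem_span₂_iff _ _ _ _).mp ha
    rw [map_add, map_mul]
    have h3 : (δ.comp (β.comp (specializeHom c))) (famEq σ).1 = 0 := by
      have := h1 (famEq σ) ((mem_span₁_iff _ _ _).mpr dvd_rfl)
      change δ ((β.comp (specializeHom c)) (famEq σ).1) = 0
      rw [this, map_zero]
    rw [h3, zero_mul, zero_add]
    change δ (β (specialize c ((famP p).1 * e))) = 0
    rw [hδker, map_mul, map_mul, specialize_famP]
    exact dvd_mul_right _ _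
  set φ := quotLift _ _ h1
  set φ' := quotLift _ _ h2
  have hφs : Function.Surjective φ := by
    intro b
    obtain ⟨f, rfl⟩ := hβ b
    obtain ⟨g, rfl⟩ := specialize_surjective c f
    exact ⟨Ideal.Quotient.mk _ g, rfl⟩
  have hφs' : Function.Surjective φ' := by
    intro b
    obtain ⟨f, rfl⟩ := hδ b
    obtain ⟨f, rfl⟩ := hβ f
    obtain ⟨g, rfl⟩ := specialize_surjective c f
    exact ⟨Ideal.Quotient.mk _ g, rfl⟩
  refine ⟨Proj.map φ (irrelevant_le_map_of_surjective φ hφs),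
    Proj.map φ' (irrelevant_le_map_of_surjective φ' hφs'), ?_, ?_⟩
  · refine isPullback_projStr φ hφs (Polynomial.evalRingHom c)
      (fun r => ⟨Polynomial.C r, by simp⟩) ?_ ?_
    · intro r
      change β (specialize c (C r)) = _
      rw [← hβC, map_C]
    · intro a ha
      obtain ⟨f, rfl⟩ := Ideal.Quotient.mk_surjective a
      have h3 : β (specialize c f) = 0 := ha
      rw [hker] at h3
      obtain ⟨g, hg⟩ := h3
      obtain ⟨g, rfl⟩ := specialize_surjective c g
      -- A polynomial whose specialization is a multiple of `c w - σ` is a multiple of `t w - σ`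
      -- plus a multiple of `t - c`.
      rw [← specialize_famEq, ← map_mul, ← sub_eq_zero, ← map_sub, specialize_eq_zero_iff] at hg
      obtain ⟨e, he⟩ := hg
      refine ⟨Polynomial.X - Polynomial.C c, Ideal.Quotient.mk _ e, by simp, ?_⟩
      rw [mk_smul_eq, ← he, Ideal.Quotient.eq, mem_span₁_iff]
      exact ⟨g, by ring⟩
  · refine isPullback_map hφs (factorHom_surjective _ _) hφs' hδ ?_ ?_
    · ext a
      obtain ⟨f, rfl⟩ := Ideal.Quotient.mk_surjective a
      rfl
    · intro a ha
      obtain ⟨f, rfl⟩ := Ideal.Quotient.mk_surjective a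
      have h3 : δ (β (specialize c f)) = 0 := ha
      obtain ⟨e, he⟩ := (hδker _).mp h3
      obtain ⟨e, rfl⟩ := hβ e
      obtain ⟨e, rfl⟩ := specialize_surjective c e
      -- Subtracting the multiple of `p` found on the fibre changes nothing modulo `p` and makes the
      -- element vanish on the fibre.
      refine ⟨Ideal.Quotient.mk _ (f - famP p * e), ?_, ?_⟩
      · change β (specialize c (f - famP p * e)) = 0
        rw [map_sub, map_sub, he, map_mul, map_mul, specialize_famP, sub_self]
      · change Ideal.Quotient.mk _ (f - famP p * e) = Ideal.Quotient.mk _ f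
        rw [Ideal.Quotient.eq, mem_span₂_iff]
        exact ⟨0, -e, by ring⟩

theorem factorHom_eq_zero_iff {R A : Type} [CommRing R] [CommRing A] [Algebra R A]
    (𝒜 : ℕ → Submodule R A) [GradedAlgebra 𝒜] {m n : ℕ} (f : 𝒜 m) (g : 𝒜 n)
    (a : A ⧸ (span₁ 𝒜 f).toIdeal) :
    factorHom 𝒜 (span₁_le_span₂ 𝒜 f g) a = 0 ↔ Ideal.Quotient.mk _ (g : A) ∣ a := by
  obtain ⟨a, rfl⟩ := Ideal.Quotient.mk_surjective a
  change Ideal.Quotient.mk (span₂ 𝒜 f g).toIdeal a = 0 ↔ _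
  rw [Ideal.Quotient.eq_zero_iff_mem, mem_span₂_iff]
  constructor
  · rintro ⟨b, c, rfl⟩
    refine ⟨Ideal.Quotient.mk _ c, ?_⟩
    rw [← map_mul, Ideal.Quotient.eq, mem_span₁_iff]
    exact ⟨b, by ring⟩
  · rintro ⟨e, he⟩
    obtain ⟨e, rfl⟩ := Ideal.Quotient.mk_surjective e
    rw [← map_mul, Ideal.Quotient.eq, mem_span₁_iff] at he
    obtain ⟨b, hb⟩ := he
    exact ⟨b, e, by linear_combination hb⟩

theorem isFibrePair_zero :
    IsFibrePair (projV.incl famGrading (span₁_le_span₂ famGrading (famEq σ) (famP p)))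
      (projStr _) 0 (surfB.toY σ p) (coneY.str σ) := by
  refine isFibrePair_of_graded 0 (quotientHom wtGrading (span₁ wtGrading (coneEq σ)))
    (quotientHom_surjective _ _) (fun r => rfl) ?_ (factorHom wtGrading (span₁_le_span₂ _ _ _))
    (factorHom_surjective _ _) ?_
  · intro f
    change Ideal.Quotient.mk (span₁ wtGrading (coneEq σ)).toIdeal f = 0 ↔ _
    rw [Ideal.Quotient.eq_zero_iff_mem, mem_span₁_iff]
    simp [neg_dvd]
  · exact factorHom_eq_zero_iff wtGrading (coneEq σ) p

/-- Substituting homogeneous elements of the right degrees into a weighted homogeneous polynomial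
gives a homogeneous element. -/
theorem aeval_mem_graded {R B ι : Type*} [Fintype ι] [CommRing R] [CommRing B] [Algebra R B]
    (ℬ : ℕ → Submodule R B) [SetLike.GradedMonoid ℬ] {w : ι → ℕ} {g : ι → B}
    (hg : ∀ i, g i ∈ ℬ (w i)) {n : ℕ} {f : MvPolynomial ι R} (hf : f.IsWeightedHomogeneous w n) :
    aeval g f ∈ ℬ n := by
  rw [aeval_def, eval₂_eq']
  refine Submodule.sum_mem _ fun m hm => ?_
  have h1 : ∏ i, g i ^ m i ∈ ℬ n := by
    have h2 := hf (mem_support_iff.mp hm)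
    rw [Finsupp.weight_apply, Finsupp.sum_fintype _ _ (by simp)] at h2
    rw [← h2]
    exact SetLike.prod_pow_mem_graded _ _ _ _ fun i _ => hg i
  rw [← Algebra.smul_def]
  exact Submodule.smul_mem _ _ h1

/-- The substitution `w = σ / c`. -/
noncomputable def elimHom (σ : stdGrading 2) (c : ℂ) :
    MvPolynomial (Fin 5) ℂ →ₐ[ℂ] MvPolynomial (Fin 4) ℂ :=
  aeval (Fin.snoc (fun i : Fin 4 => X i) (C c⁻¹ * (σ : MvPolynomial (Fin 4) ℂ)) :
    Fin 5 → MvPolynomial (Fin 4) ℂ)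

theorem elimHom_X_castSucc (c : ℂ) (i : Fin 4) : elimHom σ c (X i.castSucc) = X i := by
  rw [elimHom, aeval_X, Fin.snoc_castSucc]

theorem elimHom_X_last (c : ℂ) :
    elimHom σ c (X 4) = C c⁻¹ * (σ : MvPolynomial (Fin 4) ℂ) := by
  rw [elimHom, aeval_X]
  exact Fin.snoc_last (α := fun _ => MvPolynomial (Fin 4) ℂ) _ _

theorem elimHom_rename (c : ℂ) (f : MvPolynomial (Fin 4) ℂ) :
    elimHom σ c (rename Fin.castSucc f) = f := by
  have h : (elimHom σ c).comp (rename Fin.castSucc) = AlgHom.id ℂ _ := by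
    ext1 i
    rw [AlgHom.comp_apply, rename_X, elimHom_X_castSucc]
    rfl
  exact congr($h f)

/-- Modulo `c w - σ` one has `w = σ / c`, so eliminating `w` and including back into `ℂ[x, w]` is
the identity on the quotient. -/
theorem elimHom_eq_zero_iff {c : ℂ} (hc : c ≠ 0) (f : MvPolynomial (Fin 5) ℂ) :
    elimHom σ c f = 0 ↔ (C c * X 4 - (coneEq σ : MvPolynomial (Fin 5) ℂ)) ∣ f := by
  have h0 : elimHom σ c (C c * X 4 - (coneEq σ : MvPolynomial (Fin 5) ℂ)) = 0 := by
    rw [map_sub, map_mul, elimHom_X_last, coneEq, elimHom_rename, algHom_C, algebraMap_eq,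
      ← mul_assoc, ← map_mul, mul_inv_cancel₀ hc, map_one, one_mul, sub_self]
  constructor
  · intro h
    set I := Ideal.span {C c * X 4 - (coneEq σ : MvPolynomial (Fin 5) ℂ)}
    have h1 : (Ideal.Quotient.mkₐ ℂ I).comp ((rename Fin.castSucc).comp (elimHom σ c)) =
        Ideal.Quotient.mkₐ ℂ I := by
      ext1 i
      rw [AlgHom.comp_apply, AlgHom.comp_apply]
      induction i using Fin.lastCases with
      | cast i => rw [elimHom_X_castSucc, rename_X]
      | last =>
        have h4 : Fin.last 4 = 4 := rfl
        rw [h4, elimHom_X_last, Ideal.Quotient.mkₐ_eq_mk, Ideal.Quotient.eq,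
          Ideal.mem_span_singleton, map_mul, rename_C]
        refine ⟨- C c⁻¹, ?_⟩
        have h5 : C (σ := Fin 5) c⁻¹ * C c = 1 := by rw [← map_mul, inv_mul_cancel₀ hc, map_one]
        rw [coneEq]
        linear_combination X 4 * h5
    have h2 := congr($h1 f)
    rw [AlgHom.comp_apply, AlgHom.comp_apply, h, map_zero, map_zero, eq_comm,
      Ideal.Quotient.mkₐ_eq_mk, Ideal.Quotient.eq_zero_iff_mem, Ideal.mem_span_singleton] at h2
    exact h2
  · rintro ⟨g, rfl⟩
    rw [map_mul, h0, zero_mul]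

theorem elimHom_mem (c : ℂ) {n : ℕ} {f : MvPolynomial (Fin 5) ℂ} (hf : f ∈ wtGrading n) :
    elimHom σ c f ∈ stdGrading n := by
  refine aeval_mem_graded stdGrading (fun i => ?_) hf
  induction i using Fin.lastCases with
  | cast i =>
    rw [Fin.snoc_castSucc]
    have h : wt i.castSucc = 1 := by fin_cases i <;> rfl
    rw [h]
    exact isHomogeneous_X ℂ i
  | last =>
    rw [Fin.snoc_last]
    have h := (isHomogeneous_C (Fin 4) c⁻¹).mul σ.2
    rw [zero_add] at h
    exact h

/-- The substitution `w = σ / c` as a graded ring homomorphism. -/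
noncomputable def elimGradedHom (σ : stdGrading 2) (c : ℂ) : wtGrading →+*ᵍ stdGrading where
  __ := (elimHom σ c : MvPolynomial (Fin 5) ℂ →+* MvPolynomial (Fin 4) ℂ)
  map_mem := fun h => elimHom_mem c h

/-- The hypersurface is `p(x, σ / c) = 0`; this form is nonzero because `c w - σ` does not divide
`p`. -/
theorem exists_isFibrePair_of_ne_zero (hp : NonvanishingOnQuadric σ p) {c : ℂ} (hc : c ≠ 0) :
    ∃ f : stdGrading d, f ≠ 0 ∧
      IsFibrePair (projV.incl famGrading (span₁_le_span₂ famGrading (famEq σ) (famP p)))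
      (projStr _) c (projV.ι stdGrading (span₁ stdGrading f)) (projStr stdGrading) := by
  refine ⟨⟨elimHom σ c p, elimHom_mem c p.2⟩, fun h => ?_, ?_⟩
  · exact hp.not_dvd c ((elimHom_eq_zero_iff hc _).mp (congrArg Subtype.val h))
  · refine isFibrePair_of_graded c (elimGradedHom σ c) (fun f => ⟨_, elimHom_rename c f⟩)
      (fun r => algHom_C (elimHom σ c) r) (elimHom_eq_zero_iff hc) (quotientHom _ _)
      (quotientHom_surjective _ _) fun b => ?_
    change Ideal.Quotient.mk (span₁ stdGrading _).toIdeal b = 0 ↔ _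
    rw [Ideal.Quotient.eq_zero_iff_mem, mem_span₁_iff]
    rfl

end Fibres

/-! ### Affine charts of `Proj` and their local rings. -/

section Charts

open HomogeneousLocalization

variable {A B σ : Type} [CommRing A] [CommRing B] [SetLike σ A] [AddSubgroupClass σ A]
  {𝒜 : ℕ → σ} [GradedRing 𝒜]

/-- The map from the coordinate ring of `D₊(s)` to the local ring of `Proj 𝒜` at a point. -/
noncomputable def awayGerm (s : A) (x : Proj 𝒜) (hx : x ∈ Proj.basicOpen 𝒜 s) :
    Away 𝒜 s →+* (Proj 𝒜).presheaf.stalk x :=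
  (Proj.awayToSection 𝒜 s ≫ (Proj 𝒜).presheaf.germ (Proj.basicOpen 𝒜 s) x hx).hom

/-- The stalk is the homogeneous localization at the prime of `x`, where a fraction is a unit
exactly when its numerator avoids that prime. -/
theorem isUnit_awayGerm_iff {m : ℕ} {s : A} (hs : s ∈ 𝒜 m) (x : Proj 𝒜)
    (hx : x ∈ Proj.basicOpen 𝒜 s) (n : ℕ) (a : A) (ha : a ∈ 𝒜 (n • m)) :
    IsUnit (awayGerm s x hx (Away.mk 𝒜 hs n a ha)) ↔ x ∈ Proj.basicOpen 𝒜 a := by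
  have h1 : awayGerm s x hx (Away.mk 𝒜 hs n a ha) = (Proj.stalkIso' 𝒜 x).symm
      (mapId 𝒜 (Submonoid.powers_le.mpr hx) (Away.mk 𝒜 hs n a ha)) :=
    congr($(ProjectiveSpectrum.Proj.awayToSection_germ 𝒜 s x hx).hom (Away.mk 𝒜 hs n a ha))
  have : x.asHomogeneousIdeal.toIdeal.IsPrime := ProjectiveSpectrum.isPrime x
  have h2 : (mapId 𝒜 (Submonoid.powers_le.mpr hx) (Away.mk 𝒜 hs n a ha)).val =
      IsLocalization.mk' (Localization.AtPrime x.asHomogeneousIdeal.toIdeal) a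
        ⟨s ^ n, (x.asHomogeneousIdeal.toIdeal.primeCompl).pow_mem hx n⟩ := by
    rw [← Localization.mk_eq_mk']
    rfl
  have h3 := IsLocalization.AtPrime.isUnit_mk'_iff
    (Localization.AtPrime x.asHomogeneousIdeal.toIdeal) x.asHomogeneousIdeal.toIdeal a
    ⟨s ^ n, (x.asHomogeneousIdeal.toIdeal.primeCompl).pow_mem hx n⟩
  rw [← h2, isUnit_iff_isUnit_val] at h3
  rw [h1]
  exact (MulEquiv.isUnit_map _).trans h3

theorem isLocalization_awayGerm {m : ℕ} (hm : 0 < m) {s : A} (hs : s ∈ 𝒜 m) (x : Proj 𝒜)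
    (hx : x ∈ Proj.basicOpen 𝒜 s) :
    letI := (awayGerm s x hx).toAlgebra
    IsLocalization.AtPrime ((Proj 𝒜).presheaf.stalk x)
      ((IsLocalRing.maximalIdeal ((Proj 𝒜).presheaf.stalk x)).comap (awayGerm s x hx)) := by
  have hU := Proj.isAffineOpen_basicOpen 𝒜 s hs hm
  let : Algebra Γ(Proj 𝒜, Proj.basicOpen 𝒜 s) ((Proj 𝒜).presheaf.stalk x) :=
    ((Proj 𝒜).presheaf.germ (Proj.basicOpen 𝒜 s) x hx).hom.toAlgebra
  have h1 : IsLocalization.AtPrime ((Proj 𝒜).presheaf.stalk x) (hU.primeIdealOf ⟨x, hx⟩).asIdeal :=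
    hU.isLocalization_stalk ⟨x, hx⟩
  let e := RingEquiv.ofBijective (Proj.awayToSection 𝒜 s).hom (awayToSection_bijective hm hs)
  have h2 := @IsLocalization.isLocalization_of_base_ringEquiv _ _
    (hU.primeIdealOf ⟨x, hx⟩).asIdeal.primeCompl ((Proj 𝒜).presheaf.stalk x) _ _ _ _ h1 e.symm
  have h3 : ((algebraMap Γ(Proj 𝒜, Proj.basicOpen 𝒜 s) ((Proj 𝒜).presheaf.stalk x)).comp
      e.symm.symm.toRingHom) = awayGerm s x hx := rfl
  have h4 : (hU.primeIdealOf ⟨x, hx⟩).asIdeal.primeCompl.map (e.symm : _ →* _) =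
      ((IsLocalRing.maximalIdeal ((Proj 𝒜).presheaf.stalk x)).comap
        (awayGerm s x hx)).primeCompl := by
    ext a
    have h5 := IsLocalization.AtPrime.under_maximalIdeal ((Proj 𝒜).presheaf.stalk x)
      (hU.primeIdealOf ⟨x, hx⟩).asIdeal
    rw [Submonoid.mem_map]
    constructor
    · rintro ⟨b, hb, rfl⟩ h
      apply hb
      rw [← h5]
      change algebraMap _ _ (e (e.symm b)) ∈ IsLocalRing.maximalIdeal _ at h
      rw [e.apply_symm_apply] at h
      exact h
    · intro ha
      refine ⟨e a, fun hb => ha ?_, e.symm_apply_apply a⟩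
      rw [← h5] at hb
      exact hb
  rw [IsLocalization.AtPrime, ← h4]
  exact h2

/-- Evaluation of fractions `a / sⁿ` under a ring homomorphism sending `s` to `1`. -/
noncomputable def awayEval {s : A} (ψ : A →+* B) (h : ψ s = 1) : Away 𝒜 s →+* B :=
  (Localization.awayLift ψ s (h ▸ isUnit_one)).comp (algebraMap (Away 𝒜 s) (Localization.Away s))

theorem awayEval_mk {m : ℕ} {s : A} (hs : s ∈ 𝒜 m) (ψ : A →+* B) (h : ψ s = 1) (n : ℕ) (a : A)
    (ha : a ∈ 𝒜 (n • m)) : awayEval ψ h (Away.mk 𝒜 hs n a ha) = ψ a := by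
  change Localization.awayLift ψ s (h ▸ isUnit_one) (Away.mk 𝒜 hs n a ha).val = _
  rw [Away.val_mk, Localization.mk_eq_mk', Localization.awayLift, IsLocalization.Away.lift,
    IsLocalization.lift_mk'_spec]
  simp [h]

theorem away_mk_mul_mk {m : ℕ} {s : A} (hs : s ∈ 𝒜 m) (n n' : ℕ) (a a' : A)
    (ha : a ∈ 𝒜 (n • m)) (ha' : a' ∈ 𝒜 (n' • m)) :
    Away.mk 𝒜 hs n a ha * Away.mk 𝒜 hs n' a' ha' = Away.mk 𝒜 hs (n + n') (a * a')
      (by rw [add_smul]; exact SetLike.mul_mem_graded ha ha') := by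
  rw [ext_iff_val, val_mul, Away.val_mk, Away.val_mk, Away.val_mk, Localization.mk_mul]
  congr 1
  exact Subtype.ext (pow_add s n n').symm

end Charts

/-! ### The chart `w ≠ 0`. -/

section WeightedCharts

open MvPolynomial HomogeneousLocalization

theorem monomial_mem_of_weight_eq {R : Type} [CommRing R] {n : ℕ} {m : Fin 5 →₀ ℕ} (h : Finsupp.weight wt m = n) (c : R) :
    monomial m c ∈ weightedHomogeneousSubmodule R wt n :=
  isWeightedHomogeneous_monomial wt m c h

variable {R : Type} [CommRing R] [GradedAlgebra (weightedHomogeneousSubmodule R wt)]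

/-- The class of a variable in a quotient of the weighted polynomial ring. -/
noncomputable abbrev xq (I : HomogeneousIdeal (weightedHomogeneousSubmodule R wt)) (i : Fin 5) :
    MvPolynomial (Fin 5) R ⧸ I.toIdeal :=
  Ideal.Quotient.mk I.toIdeal (X i)

theorem xq_mem (I : HomogeneousIdeal (weightedHomogeneousSubmodule R wt)) (i : Fin 5) :
    xq I i ∈ quotientGrading _ I (wt i) :=
  mk_mem_quotientGrading _ I (isWeightedHomogeneous_X _ wt i)

theorem wt_castSucc (i : Fin 4) : wt i.castSucc = 1 := by fin_cases i <;> rfl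

theorem exists_mem_basicOpen_xq (I : HomogeneousIdeal (weightedHomogeneousSubmodule R wt))
    (y : projV _ I) : ∃ i, y ∈ Proj.basicOpen (quotientGrading _ I) (xq I i) := by
  have h := Proj.iSup_basicOpen_eq_top (quotientGrading _ I) (xq I) ?_
  · have h1 : y ∈ ⨆ i, Proj.basicOpen (quotientGrading _ I) (xq I i) := h ▸ trivial
    exact TopologicalSpace.Opens.mem_iSup.mp h1
  · rw [HomogeneousIdeal.toIdeal_irrelevant_le]
    rintro n hn _ ⟨f, hf, rfl⟩
    have h1 : f ∈ Ideal.span (Set.range (X : Fin 5 → MvPolynomial (Fin 5) R)) := by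
      rw [← Set.image_univ, mem_ideal_span_X_image]
      intro m hm
      by_contra! h0
      have h2 := hf (mem_support_iff.mp hm)
      have h3 : m = 0 := by ext i; exact h0 i (Set.mem_univ i)
      rw [h3, map_zero] at h2
      exact hn.ne h2
    have h2 := Ideal.mem_map_of_mem (Ideal.Quotient.mk I.toIdeal) h1
    rw [Ideal.map_span, ← Set.range_comp] at h2
    exact h2

theorem xq_mul_xq_mem (I : HomogeneousIdeal (weightedHomogeneousSubmodule R wt)) (i j : Fin 4) :
    xq I i.castSucc * xq I j.castSucc ∈ quotientGrading _ I (1 • wt 4) := by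
  have h := SetLike.mul_mem_graded (xq_mem I i.castSucc) (xq_mem I j.castSucc)
  rwa [wt_castSucc, wt_castSucc] at h

/-- The function `xᵢ xⱼ / w` on the chart `w ≠ 0`. -/
noncomputable def vertexCoord (I : HomogeneousIdeal (weightedHomogeneousSubmodule R wt))
    (i j : Fin 4) : Away (quotientGrading _ I) (xq I 4) :=
  Away.mk _ (xq_mem I 4) 1 (xq I i.castSucc * xq I j.castSucc) (xq_mul_xq_mem I i j)

/-- Every function on the chart `w ≠ 0` is a constant modulo the functions `xᵢ xⱼ / w`. -/
theorem exists_sub_mem_span_vertexCoord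
    (I : HomogeneousIdeal (weightedHomogeneousSubmodule R wt))
    (e : Away (quotientGrading _ I) (xq I 4)) :
    ∃ r : R, e - awayAlgebraMap (quotientGrading _ I) (xq I 4) r ∈
      Ideal.span (Set.range fun k : Fin 4 × Fin 4 => vertexCoord I k.1 k.2) := by
  obtain ⟨n, a, ha, rfl⟩ := Away.mk_surjective _ (xq_mem I 4) e
  obtain ⟨f, hf, rfl⟩ : ∃ f ∈ weightedHomogeneousSubmodule R wt (n • wt 4),
    Ideal.Quotient.mk I.toIdeal f = a := id ha
  -- The claim is additive in the numerator, so it is proved monomial by monomial.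
  have key : ∀ m ∈ f.support, ∃ (r : R) (e : Away (quotientGrading _ I) (xq I 4)),
      e.val = Localization.mk (Ideal.Quotient.mk I.toIdeal (monomial m (coeff m f)))
        (⟨xq I 4 ^ n, n, rfl⟩ : Submonoid.powers (xq I 4)) ∧
      e - awayAlgebraMap (quotientGrading _ I) (xq I 4) r ∈
      Ideal.span (Set.range fun k : Fin 4 × Fin 4 => vertexCoord I k.1 k.2) := by
    intro m hm
    have hw : ∑ i, m i * wt i = n * 2 := by
      have := hf (mem_support_iff.mp hm)
      rwa [Finsupp.weight_apply, Finsupp.sum_fintype _ _ (by simp)] at this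
    simp only [Fin.sum_univ_five, wt] at hw
    simp at hw
    by_cases h0 : ∃ i : Fin 4, m i.castSucc ≠ 0
    · obtain ⟨i, hi⟩ := h0
      have h1 : ∃ (j : Fin 4) (m' : Fin 5 →₀ ℕ),
          m = Finsupp.single i.castSucc 1 + Finsupp.single j.castSucc 1 + m' := by
        obtain ⟨m₁, rfl⟩ : ∃ m₁, m = Finsupp.single i.castSucc 1 + m₁ :=
          ⟨m - Finsupp.single i.castSucc 1,
            (add_tsub_cancel_of_le (by simpa [Nat.one_le_iff_ne_zero] using hi)).symm⟩
        -- The total weight `2 n` and the weight of `w` are even, so the number of factors `xᵢ` is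
        -- even: one factor forces a second.
        have h2 : ∃ j : Fin 4, m₁ j.castSucc ≠ 0 := by
          by_contra! h3
          have h30 := h3 0; have h31 := h3 1; have h32 := h3 2; have h33 := h3 3
          simp at h30 h31 h32 h33
          fin_cases i <;> simp [h30, h31, h32, h33] at hw <;> omega
        obtain ⟨j, hj⟩ := h2
        refine ⟨j, m₁ - Finsupp.single j.castSucc 1, ?_⟩
        rw [add_assoc, add_tsub_cancel_of_le (by simpa [Nat.one_le_iff_ne_zero] using hj)]
      obtain ⟨j, m', rfl⟩ := h1
      have hw' := hf (mem_support_iff.mp hm)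
      rw [map_add, map_add, Finsupp.weight_single, Finsupp.weight_single, wt_castSucc,
        wt_castSucc] at hw'
      obtain ⟨k, rfl⟩ : ∃ k, n = 1 + k := ⟨n - 1, by
        change _ = n * 2 at hw'
        simp at hw'
        omega⟩
      have hk : Finsupp.weight wt m' = k • wt 4 := by
        change _ = (1 + k) * 2 at hw'
        change _ = k * 2
        simp at hw'
        omega
      refine ⟨0, vertexCoord I i j * Away.mk _ (xq_mem I 4) k (Ideal.Quotient.mk I.toIdeal
        (monomial m' (coeff (Finsupp.single i.castSucc 1 + Finsupp.single j.castSucc 1 + m') f)))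
        (mk_mem_quotientGrading _ I (monomial_mem_of_weight_eq hk _)), ?_, ?_⟩
      · rw [vertexCoord, away_mk_mul_mk, Away.val_mk]
        congr 1
        rw [← map_mul, ← map_mul]
        congr 1
        rw [X, X, monomial_mul, monomial_mul, one_mul, one_mul]
      · rw [map_zero, sub_zero]
        exact Ideal.mul_mem_right _ _ (Ideal.subset_span ⟨(i, j), rfl⟩)
    · push Not at h0
      have h30 := h0 0; have h31 := h0 1; have h32 := h0 2; have h33 := h0 3
      simp at h30 h31 h32 h33
      have hm' : m = Finsupp.single 4 n := by
        rw [h30, h31, h32, h33] at hw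
        have h4 : m 4 = n := by omega
        ext i
        fin_cases i <;> simp [h30, h31, h32, h33, h4]
      -- Without factors `xᵢ` the monomial is `wⁿ`, and the fraction is its coefficient.
      refine ⟨coeff m f, awayAlgebraMap _ _ (coeff m f), ?_, by rw [sub_self]; exact zero_mem _⟩
      rw [val_awayAlgebraMap, ← Localization.mk_one_eq_algebraMap, Localization.mk_eq_mk_iff,
        Localization.r_iff_exists]
      refine ⟨1, ?_⟩
      simp only [OneMemClass.coe_one, one_mul]
      conv_rhs => rw [hm', ← C_mul_X_pow_eq_monomial, ← hm', map_mul, map_pow]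
      rw [mul_comm]
      rfl
  choose r e h1 h2 using key
  refine ⟨∑ m ∈ f.support.attach, r m.1 m.2, ?_⟩
  have h3 : Away.mk _ (xq_mem I 4) n (Ideal.Quotient.mk I.toIdeal f) ha = ∑ m ∈ f.support.attach, e m.1 m.2 := by
    rw [ext_iff_val, Away.val_mk]
    change _ = algebraMap (Away (quotientGrading _ I) (xq I 4)) (Localization.Away (xq I 4)) _
    rw [map_sum]
    have h4 : ∀ m ∈ f.support.attach, algebraMap (Away (quotientGrading _ I) (xq I 4))
        (Localization.Away (xq I 4)) (e m.1 m.2) =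
        Localization.mk 1 (⟨xq I 4 ^ n, n, rfl⟩ : Submonoid.powers (xq I 4)) *
        algebraMap _ _ (Ideal.Quotient.mk I.toIdeal (monomial m.1 (coeff m.1 f))) := by
      intro m _
      change (e m.1 m.2).val = _
      rw [h1, ← Localization.mk_one_eq_algebraMap, Localization.mk_mul, one_mul, mul_one]
    rw [Finset.sum_congr rfl h4, ← Finset.mul_sum, ← map_sum, ← map_sum,
      Finset.sum_attach f.support fun m => monomial m (coeff m f), support_sum_monomial_coeff,
      ← Localization.mk_one_eq_algebraMap, Localization.mk_mul, one_mul, mul_one]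
  rw [h3, map_sum, ← Finset.sum_sub_distrib]
  exact Ideal.sum_mem _ fun m _ => h2 m.1 m.2

end WeightedCharts

/-! ### The divisor of the family is `ℚ`-Cartier. -/

section QCartier

open MvPolynomial HomogeneousLocalization

variable {A σ : Type} [CommRing A] [SetLike σ A] [AddSubgroupClass σ A] {𝒜 : ℕ → σ} [GradedRing 𝒜]

theorem awayToSection_mk_mem_nonZeroDivisors [IsDomain A] {m : ℕ} (hm : 0 < m) {s : A}
    (hs : s ∈ 𝒜 m) (hs0 : s ≠ 0) (n : ℕ) (a : A) (ha : a ∈ 𝒜 (n • m)) (ha0 : a ≠ 0) :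
    (Proj.awayToSection 𝒜 s).hom (Away.mk 𝒜 hs n a ha) ∈
      nonZeroDivisors Γ(Proj 𝒜, Proj.basicOpen 𝒜 s) := by
  rw [mem_nonZeroDivisors_iff_right]
  intro y hy
  obtain ⟨z, rfl⟩ := (awayToSection_bijective hm hs).2 y
  rw [← map_mul, map_eq_zero_iff _ (awayToSection_bijective hm hs).1] at hy
  obtain ⟨k, b, hb, rfl⟩ := Away.mk_surjective _ hs z
  rw [away_mk_mul_mk, away_mk_eq_zero_iff] at hy
  obtain ⟨l, hl⟩ := hy
  have hb0 : b = 0 := by simpa [hs0, ha0] using hl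
  rw [(away_mk_eq_zero_iff hs k b hb).mpr ⟨0, by rw [hb0, mul_zero]⟩, map_zero]

/-- At a point where a form `z` of degree one is invertible, the ideal of a divisor `q = 0` of
degree `d` is principal, and its square is generated by `q² / sᴺ`. -/
theorem span_awayGerm_eq_pow {B τ : Type} [CommRing B] [SetLike τ B] [AddSubgroupClass τ B]
    {ℬ : ℕ → τ} [GradedRing ℬ] (f : 𝒜 →+*ᵍ ℬ)
    (hf' : HomogeneousIdeal.irrelevant ℬ ≤ (HomogeneousIdeal.irrelevant 𝒜).map f)
    {d : ℕ} {q : A} (hq : q ∈ 𝒜 d) (hker : ∀ a, f a = 0 ↔ q ∣ a)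
    {m : ℕ} (hm : 0 < m) {s : A} (hs : s ∈ 𝒜 m) {N : ℕ} (hN : q * q ∈ 𝒜 (N • m))
    (hNd : N • m = d + d) (x : Proj 𝒜) (hx : x ∈ Proj.basicOpen 𝒜 s) {z : A} (hz : z ∈ 𝒜 1)
    (hxz : x ∈ Proj.basicOpen 𝒜 z) :
    Ideal.span {((Proj 𝒜).presheaf.germ (Proj.basicOpen 𝒜 s) x hx).hom
        ((Proj.awayToSection 𝒜 s).hom (Away.mk 𝒜 hs N (q * q) hN))} =
      ((RingHom.ker ((Proj.map f hf').app (Proj.basicOpen 𝒜 s)).hom).map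
        ((Proj 𝒜).presheaf.germ (Proj.basicOpen 𝒜 s) x hx).hom) ^ 2 := by
  have hzd : ∀ n, z ^ n ∈ 𝒜 n := fun n => by
    have := SetLike.pow_mem_graded n hz
    rwa [smul_eq_mul, mul_one] at this
  -- Since `N m = 2 d`, both `q z^d / sᴺ` and `z^(2 d) / sᴺ` are functions on `D₊(s)`. The second is
  -- a unit at `x`; the first will generate the ideal of `q = 0` there, and its square is `q² / sᴺ`
  -- times that unit.
  have hh : q * z ^ d ∈ 𝒜 (N • m) := hNd ▸ SetLike.mul_mem_graded hq (hzd d)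
  have hzz : z ^ (d + d) ∈ 𝒜 (N • m) := hNd ▸ hzd (d + d)
  have hu : IsUnit (awayGerm s x hx (Away.mk 𝒜 hs N (z ^ (d + d)) hzz)) := by
    rw [isUnit_awayGerm_iff]
    have : x.asHomogeneousIdeal.toIdeal.IsPrime := ProjectiveSpectrum.isPrime x
    exact (x.asHomogeneousIdeal.toIdeal.primeCompl).pow_mem hxz _
  have h1 : (RingHom.ker ((Proj.map f hf').app (Proj.basicOpen 𝒜 s)).hom).map
        ((Proj 𝒜).presheaf.germ (Proj.basicOpen 𝒜 s) x hx).hom =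
      Ideal.span {awayGerm s x hx (Away.mk 𝒜 hs N (q * z ^ d) hh)} := by
    apply le_antisymm
    · rw [Ideal.map_le_iff_le_comap]
      intro y hy
      obtain ⟨n, a, ha, h0, rfl⟩ := ker_map_app_basicOpen f hf' hm hs hy
      rw [hker] at h0
      obtain ⟨b, rfl⟩ := h0
      change awayGerm s x hx (Away.mk 𝒜 hs n (q * b) ha) ∈ Ideal.span _
      by_cases hle : d ≤ n • m
      · have h2 : q * b = q * (DirectSum.decompose 𝒜 b (n • m - d) : A) := by
          rw [← DirectSum.coe_decompose_mul_of_left_mem_of_le 𝒜 hq hle,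
            DirectSum.decompose_of_mem_same _ ha]
        have h3 : (DirectSum.decompose 𝒜 b (n • m - d) : A) * z ^ d ∈ 𝒜 (n • m) := by
          have := SetLike.mul_mem_graded (SetLike.coe_mem (DirectSum.decompose 𝒜 b (n • m - d)))
            (hzd d)
          rwa [Nat.sub_add_cancel hle] at this
        have h4 : Away.mk 𝒜 hs n (q * b) ha * Away.mk 𝒜 hs N (z ^ (d + d)) hzz =
            Away.mk 𝒜 hs N (q * z ^ d) hh * Away.mk 𝒜 hs n _ h3 := by
          rw [away_mk_mul_mk, away_mk_mul_mk, ext_iff_val, Away.val_mk, Away.val_mk,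
            Localization.mk_eq_mk_iff, Localization.r_iff_exists]
          refine ⟨1, ?_⟩
          simp only [h2]
          ring
        have h5 := congr(awayGerm s x hx $h4)
        rw [map_mul, map_mul] at h5
        rw [← Ideal.mul_unit_mem_iff_mem _ hu, h5]
        exact Ideal.mul_mem_right _ _ (Ideal.mem_span_singleton_self _)
      · have h2 : q * b = 0 := by
          rw [← DirectSum.coe_decompose_mul_of_left_mem_of_not_le 𝒜 (b := b) hq hle,
            DirectSum.decompose_of_mem_same _ ha]
        rw [(away_mk_eq_zero_iff hs n _ ha).mpr ⟨0, by rw [h2, mul_zero]⟩, map_zero]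
        exact zero_mem _
    · rw [Ideal.span_singleton_le_iff_mem]
      exact Ideal.mem_map_of_mem _ (mk_mem_ker_map_app_basicOpen f hf' hs hh
        ((hker _).mpr (dvd_mul_right _ _)))
  rw [h1, Ideal.span_singleton_pow]
  change Ideal.span {awayGerm s x hx _} = _
  have h2 : awayGerm s x hx (Away.mk 𝒜 hs N (q * z ^ d) hh) ^ 2 =
      awayGerm s x hx (Away.mk 𝒜 hs N (q * q) hN) *
        awayGerm s x hx (Away.mk 𝒜 hs N (z ^ (d + d)) hzz) := by
    rw [← map_pow, ← map_mul, sq, away_mk_mul_mk, away_mk_mul_mk]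
    congr 2
    ring
  rw [h2, Ideal.span_singleton_mul_right_unit hu]

end QCartier

section AwayAlgebraMap

open HomogeneousLocalization

variable {R A B : Type} [CommRing R] [CommRing A] [Algebra R A] [CommRing B]
  {𝒜 : ℕ → Submodule R A} [GradedAlgebra 𝒜]

theorem awayAlgebraMap_eq_mk {m : ℕ} {s : A} (hs : s ∈ 𝒜 m) (r : R)
    (hr : algebraMap R A r ∈ 𝒜 (0 • m)) :
    awayAlgebraMap 𝒜 s r = Away.mk 𝒜 hs 0 (algebraMap R A r) hr := by
  rw [ext_iff_val, val_awayAlgebraMap, Away.val_mk, ← Localization.mk_one_eq_algebraMap]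
  congr 1
  exact Subtype.ext (pow_zero s).symm

theorem algebraMap_mem_zero_smul (m : ℕ) (r : R) : algebraMap R A r ∈ 𝒜 (0 • m) := by
  rw [zero_smul]
  exact (algebraMap R (𝒜 0) r).2

theorem awayEval_awayAlgebraMap {m : ℕ} {s : A} (hs : s ∈ 𝒜 m) (ψ : A →+* B) (h : ψ s = 1)
    (r : R) : awayEval ψ h (awayAlgebraMap 𝒜 s r) = ψ (algebraMap R A r) := by
  rw [awayAlgebraMap_eq_mk hs r (algebraMap_mem_zero_smul m r), awayEval_mk]

theorem isUnit_awayGerm_awayAlgebraMap_iff {m : ℕ} {s : A} (hs : s ∈ 𝒜 m) (x : Proj 𝒜)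
    (hx : x ∈ Proj.basicOpen 𝒜 s) (r : R) :
    IsUnit (awayGerm s x hx (awayAlgebraMap 𝒜 s r)) ↔ x ∈ Proj.basicOpen 𝒜 (algebraMap R A r) := by
  rw [awayAlgebraMap_eq_mk hs r (algebraMap_mem_zero_smul m r), isUnit_awayGerm_iff]

end AwayAlgebraMap

/-! ### The local ring of the family at the vertex. -/

section VertexDimension

open MvPolynomial HomogeneousLocalization

variable {σ : stdGrading 2}

/-- The map `(x, w, t) ↦ (x, 1, σ)` on polynomials. -/
noncomputable def vertexSubst (σ : stdGrading 2) :
    MvPolynomial (Fin 5) (Polynomial ℂ) →+* MvPolynomial (Fin 4) ℂ :=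
  eval₂Hom (Polynomial.eval₂RingHom C (σ : MvPolynomial (Fin 4) ℂ))
    (Fin.snoc (fun i : Fin 4 => X i) 1 : Fin 5 → MvPolynomial (Fin 4) ℂ)

theorem vertexSubst_X_castSucc (i : Fin 4) : vertexSubst σ (X i.castSucc) = X i := by
  rw [vertexSubst, eval₂Hom_X', Fin.snoc_castSucc]

theorem vertexSubst_X_last : vertexSubst σ (X 4) = 1 := by
  rw [vertexSubst, eval₂Hom_X']
  exact Fin.snoc_last (α := fun _ => MvPolynomial (Fin 4) ℂ) _ _

theorem vertexSubst_C (r : Polynomial ℂ) :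
    vertexSubst σ (C r) = Polynomial.eval₂ C (σ : MvPolynomial (Fin 4) ℂ) r :=
  eval₂Hom_C _ _ _

theorem vertexSubst_famEq : vertexSubst σ (famEq σ) = 0 := by
  have h1 : (vertexSubst σ).comp ((MvPolynomial.map Polynomial.C).comp
      (rename (Fin.castSucc : Fin 4 → Fin 5)).toRingHom) = RingHom.id _ := by
    refine MvPolynomial.ringHom_ext (fun r => ?_) (fun i => ?_)
    · simp [vertexSubst_C]
    · simp [vertexSubst_X_castSucc]
  have h2 : vertexSubst σ (MvPolynomial.map Polynomial.C (coneEq σ : MvPolynomial (Fin 5) ℂ)) =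
      (σ : MvPolynomial (Fin 4) ℂ) := congr($h1 (σ : MvPolynomial (Fin 4) ℂ))
  simp only [famEq, map_sub, map_mul]
  rw [h2, vertexSubst_X_last, vertexSubst_C, Polynomial.eval₂_X, mul_one, sub_self]

/-- The map `(x, w, t) ↦ (x, 1, σ)` on the coordinate ring of the family. -/
noncomputable def vertexEval (σ : stdGrading 2) :
    MvPolynomial (Fin 5) (Polynomial ℂ) ⧸ (span₁ famGrading (famEq σ)).toIdeal →+*
      MvPolynomial (Fin 4) ℂ :=
  Ideal.Quotient.lift _ (vertexSubst σ) fun a ha => by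
    obtain ⟨b, rfl⟩ := (mem_span₁_iff _ _ _).mp ha
    rw [map_mul, vertexSubst_famEq, zero_mul]

theorem vertexEval_xq_castSucc (i : Fin 4) : vertexEval σ (xq _ i.castSucc) = X i :=
  vertexSubst_X_castSucc i

theorem vertexEval_xq_last : vertexEval σ (xq _ 4) = 1 := vertexSubst_X_last

/-- On `w = 1` the family equation reads `t = σ`, so the chart is modelled on `𝔸⁴ / ±1`. The
contractions of `0` and `(x₀)` from `ℂ[x₀,…,x₃]` form with the ideal of the vertex a chain of three
primes; it is strict because of the functions `x₀² / w` and `x₁² / w`. -/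
theorem two_le_ringKrullDim_stalk_vertex
    (x : projV famGrading (span₁ famGrading (famEq σ)))
    (h4 : x ∈ Proj.basicOpen _ (xq (span₁ famGrading (famEq σ)) 4))
    (hx : ∀ i : Fin 4, x ∉ Proj.basicOpen _ (xq (span₁ famGrading (famEq σ)) i.castSucc)) :
    2 ≤ ringKrullDim ((projV famGrading (span₁ famGrading (famEq σ))).presheaf.stalk x) := by
  let E := Away (quotientGrading famGrading (span₁ famGrading (famEq σ)))
    (xq (span₁ famGrading (famEq σ)) 4)
  let γ := awayGerm _ x h4
  let : Algebra E ((projV famGrading (span₁ famGrading (famEq σ))).presheaf.stalk x) := γ.toAlgebra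
  let q : Ideal E := (IsLocalRing.maximalIdeal _).comap γ
  have hloc : IsLocalization.AtPrime
      ((projV famGrading (span₁ famGrading (famEq σ))).presheaf.stalk x) q :=
    isLocalization_awayGerm (by decide) (xq_mem _ 4) x h4
  rw [IsLocalization.AtPrime.ringKrullDim_eq_height q]
  let χ : E →+* MvPolynomial (Fin 4) ℂ := awayEval (vertexEval σ) vertexEval_xq_last
  have hχ : ∀ i j, χ (vertexCoord _ i j) = X i * X j := by
    intro i j
    simp only [χ, vertexCoord]
    rw [awayEval_mk, map_mul, vertexEval_xq_castSucc, vertexEval_xq_castSucc]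
  have hgq : ∀ i j, vertexCoord (span₁ famGrading (famEq σ)) i j ∈ q := by
    intro i j
    change γ _ ∈ IsLocalRing.maximalIdeal _
    rw [IsLocalRing.mem_maximalIdeal, mem_nonunits_iff]
    simp only [γ, vertexCoord]
    rw [isUnit_awayGerm_iff, Proj.basicOpen_mul]
    exact fun h => hx i h.1
  let P₀ : Ideal E := RingHom.ker χ
  let P₁ : Ideal E := (Ideal.span {(X 0 : MvPolynomial (Fin 4) ℂ)}).comap χ
  have hp0 : P₀.IsPrime := RingHom.ker_isPrime χ
  have hX : (Ideal.span {(X 0 : MvPolynomial (Fin 4) ℂ)}).IsPrime :=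
    (Ideal.span_singleton_prime (X_ne_zero 0)).mpr X_prime
  have hp1 : P₁.IsPrime := hX.comap χ
  have h01 : P₀ < P₁ := by
    refine lt_of_le_of_ne (fun a ha => ?_) fun h => ?_
    · change χ a ∈ Ideal.span _
      rw [RingHom.mem_ker.mp ha]
      exact zero_mem _
    · have h1 : vertexCoord (span₁ famGrading (famEq σ)) 0 0 ∈ P₁ := by
        change χ (vertexCoord _ 0 0) ∈ Ideal.span {X 0}
        rw [hχ]
        exact Ideal.mul_mem_right _ _ (Ideal.mem_span_singleton_self _)
      rw [← h, RingHom.mem_ker, hχ] at h1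
      simp at h1
  have h1q : P₁ < q := by
    refine lt_of_le_of_ne (fun a ha => ?_) fun h => ?_
    -- Write `a` as `r(t)` modulo the functions `xᵢ xⱼ / w`. If the image of `a` is divisible by
    -- `x₀`, then `r(σ)` has no constant term, so `t` divides `r`; it remains to see that `t`
    -- vanishes at the vertex.
    · obtain ⟨r, hr⟩ := exists_sub_mem_span_vertexCoord _ a
      have hsp : Ideal.span (Set.range fun k : Fin 4 × Fin 4 =>
          vertexCoord (span₁ famGrading (famEq σ)) k.1 k.2) ≤ q := by
        rw [Ideal.span_le]
        rintro _ ⟨k, rfl⟩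
        exact hgq k.1 k.2
      have hcc : constantCoeff (χ (awayAlgebraMap _ _ r)) = 0 := by
        have h2 : ∀ e ∈ Ideal.span (Set.range fun k : Fin 4 × Fin 4 =>
            vertexCoord (span₁ famGrading (famEq σ)) k.1 k.2), constantCoeff (χ e) = 0 := by
          intro e he
          have h3 : Ideal.span (Set.range fun k : Fin 4 × Fin 4 =>
              vertexCoord (span₁ famGrading (famEq σ)) k.1 k.2) ≤
              RingHom.ker (constantCoeff.comp χ) := by
            rw [Ideal.span_le]
            rintro _ ⟨k, rfl⟩
            change constantCoeff (χ (vertexCoord _ k.1 k.2)) = 0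
            rw [hχ]
            simp
          exact h3 he
        have h4 := h2 _ hr
        have h5 : constantCoeff (χ a) = 0 := by
          obtain ⟨b, hb⟩ := Ideal.mem_span_singleton.mp (show χ a ∈ Ideal.span {X 0} from ha)
          rw [hb]
          simp
        rw [map_sub, map_sub, h5, zero_sub, neg_eq_zero] at h4
        exact h4
      have hχr : χ (awayAlgebraMap _ _ r) = Polynomial.eval₂ C (σ : MvPolynomial (Fin 4) ℂ) r := by
        simp only [χ]
        rw [awayEval_awayAlgebraMap (xq_mem _ 4)]
        exact vertexSubst_C r
      have hσ0 : constantCoeff (σ : MvPolynomial (Fin 4) ℂ) = 0 := by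
        by_contra h2
        have h3 := σ.2 h2
        simp at h3
      have hr0 : Polynomial.X ∣ r := by
        rw [hχr, Polynomial.hom_eval₂, hσ0] at hcc
        rw [Polynomial.X_dvd_iff, Polynomial.coeff_zero_eq_eval_zero]
        convert hcc
        rw [← Polynomial.eval₂_id]
        congr 1
        ext; simp
      have hrq : awayAlgebraMap _ _ r ∈ q := by
        change γ _ ∈ IsLocalRing.maximalIdeal _
        rw [IsLocalRing.mem_maximalIdeal, mem_nonunits_iff]
        simp only [γ]
        rw [isUnit_awayGerm_awayAlgebraMap_iff (xq_mem _ 4)]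
        obtain ⟨r', rfl⟩ := hr0
        rw [map_mul, Proj.basicOpen_mul]
        intro h
        set J := HomogeneousIdeal.toIdeal (ProjectiveSpectrum.asHomogeneousIdeal x)
        have hJ : ∀ i : Fin 4, xq (span₁ famGrading (famEq σ)) i.castSucc ∈ J :=
          fun i => not_not.mp (hx i)
        -- All `xᵢ` vanish in the quotient by `J`, so a polynomial in `x` reduces to its constant
        -- term. Thus `t w = σ` lies in `J`, and `w` does not, which forces `t ∈ J`.
        let φ : MvPolynomial (Fin 4) ℂ →+* _ := (Ideal.Quotient.mk J).comp
          ((Ideal.Quotient.mk (span₁ famGrading (famEq σ)).toIdeal).comp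
            ((MvPolynomial.map Polynomial.C).comp
              (rename (Fin.castSucc : Fin 4 → Fin 5)).toRingHom))
        have hφ : φ = (φ.comp C).comp constantCoeff := by
          refine MvPolynomial.ringHom_ext (fun r => by simp) (fun i => ?_)
          simp only [RingHom.comp_apply, constantCoeff_X, map_zero]
          simp only [φ, RingHom.comp_apply]
          rw [Ideal.Quotient.eq_zero_iff_mem]
          simpa using hJ i
        have hφσ : φ (σ : MvPolynomial (Fin 4) ℂ) = 0 := by
          rw [hφ, RingHom.comp_apply, hσ0, map_zero]
        have hσJ : algebraMap (Polynomial ℂ) _ Polynomial.X *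
            xq (span₁ famGrading (famEq σ)) 4 ∈ J := by
          have h7 : Ideal.Quotient.mk (span₁ famGrading (famEq σ)).toIdeal
              (MvPolynomial.map Polynomial.C (coneEq σ : MvPolynomial (Fin 5) ℂ)) ∈ J :=
            Ideal.Quotient.eq_zero_iff_mem.mp hφσ
          have h8 : algebraMap (Polynomial ℂ) (MvPolynomial (Fin 5) (Polynomial ℂ) ⧸
              (span₁ famGrading (famEq σ)).toIdeal) Polynomial.X *
              xq (span₁ famGrading (famEq σ)) 4 = Ideal.Quotient.mk _
              (MvPolynomial.map Polynomial.C (coneEq σ : MvPolynomial (Fin 5) ℂ)) := by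
            change Ideal.Quotient.mk _ (C Polynomial.X) * Ideal.Quotient.mk _ (X 4) = _
            rw [← map_mul, Ideal.Quotient.eq, mem_span₁_iff]
            exact dvd_rfl
          rwa [h8]
        have hJp : J.IsPrime := ProjectiveSpectrum.isPrime x
        rcases hJp.mem_or_mem hσJ with h9 | h9
        · exact h.1 h9
        · exact h4 h9
      have h6 := add_mem (hsp hr) hrq
      rwa [sub_add_cancel] at h6
    · have h1 := hgq 1 1
      rw [← h] at h1
      change χ (vertexCoord _ 1 1) ∈ Ideal.span {X 0} at h1
      rw [hχ, Ideal.mem_span_singleton] at h1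
      rcases X_prime.dvd_or_dvd h1 with h | h <;> rw [X_dvd_X] at h <;> simp at h
  have h2 : (2 : ℕ∞) ≤ q.height := by
    have h3 := Ideal.height_add_one_le_of_lt_of_isPrime h01
    have h4 := Ideal.height_add_one_le_of_lt_of_isPrime h1q
    calc (2 : ℕ∞) = 0 + 1 + 1 := by norm_num
      _ ≤ P₀.height + 1 + 1 := by gcongr; exact zero_le
      _ ≤ P₁.height + 1 := by gcongr
      _ ≤ q.height := h4
  exact WithBot.coe_le_coe.mpr h2

theorem wt_pos (i : Fin 5) : 0 < wt i := by fin_cases i <;> decide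

/-- This is where the multiplicity two enters: for odd `d` the weight of `w` divides `2 d` but not
`d`. -/
theorem exists_smul_wt_eq (d : ℕ) (i : Fin 5) : ∃ N : ℕ, N • wt i = d + d := by
  induction i using Fin.lastCases with
  | cast i => exact ⟨d + d, by rw [wt_castSucc, smul_eq_mul, mul_one]⟩
  | last => exact ⟨d, by change d * 2 = _; ring⟩

variable {d : ℕ} {p : wtGrading d}

/-- Twice the divisor is defined by `p² / sᴺ` with `s` a variable nonzero at the given point. At
points of codimension at most one some `xⱼ` is invertible, since otherwise the point is the vertex
and its local ring is too large; there the ideal is principal and its square has the required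
generator. -/
theorem isQCartier_family (hσ : IsSmoothQuadric σ) (hp : NonvanishingOnQuadric σ p) :
    IsQCartier (projV.incl famGrading (span₁_le_span₂ famGrading (famEq σ) (famP p))) := by
  set I := span₁ famGrading (famEq σ)
  have hprime : I.toIdeal.IsPrime :=
    (Ideal.span_singleton_prime (prime_famEq σ hσ).ne_zero).mpr (prime_famEq σ hσ)
  have : IsClosedImmersion
      (projV.incl famGrading (span₁_le_span₂ famGrading (famEq σ) (famP p))) :=
    isClosedImmersion_map _ (factorHom_surjective _ _) _
  set q := Ideal.Quotient.mk I.toIdeal (famP p : MvPolynomial (Fin 5) (Polynomial ℂ))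
  have hq : q ∈ quotientGrading famGrading I d := mk_mem_quotientGrading _ I (famP p).2
  have hq0 : q ≠ 0 := by
    rw [Ne, Ideal.Quotient.eq_zero_iff_mem, mem_span₁_iff]
    exact hp.not_famEq_dvd
  refine ⟨2, two_pos, fun y => ?_⟩
  obtain ⟨i, hi⟩ := exists_mem_basicOpen_xq I y
  obtain ⟨N, hN⟩ := exists_smul_wt_eq d i
  have hqq : q * q ∈ quotientGrading famGrading I (N • wt i) :=
    hN ▸ SetLike.mul_mem_graded hq hq
  have hx0 : xq I i ≠ 0 := by
    intro h0
    rw [h0, Proj.basicOpen_zero] at hi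
    exact hi
  refine ⟨affineBasicOpen _ (wt_pos i) ⟨xq I i, xq_mem I i⟩, hi,
    (Proj.awayToSection _ (xq I i)).hom (Away.mk _ (xq_mem I i) N (q * q) hqq),
    awayToSection_mk_mem_nonZeroDivisors (wt_pos i) (xq_mem I i) hx0 N _ hqq
      (mul_ne_zero hq0 hq0), fun x hx hdim => ?_⟩
  have key : ∃ j : Fin 4, x ∈ Proj.basicOpen (quotientGrading famGrading I) (xq I j.castSucc) := by
    by_contra! hj
    have hi4 : i = 4 := by
      induction i using Fin.lastCases with
      | cast i => exact absurd hx (hj i)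
      | last => rfl
    subst hi4
    have h2 := two_le_ringKrullDim_stalk_vertex x hx hj
    have h3 := h2.trans hdim
    norm_num at h3
  obtain ⟨j, hj⟩ := key
  rw [Scheme.Hom.ker_apply]
  have hj1 : xq I j.castSucc ∈ quotientGrading famGrading I 1 := by
    have := xq_mem I j.castSucc
    rwa [wt_castSucc] at this
  exact span_awayGerm_eq_pow _ _ hq (factorHom_eq_zero_iff famGrading (famEq σ) (famP p)) (wt_pos i)
    (xq_mem I i) hqq hN x hx hj1 hj

theorem isDegenerationOfPairs (hσ : IsSmoothQuadric σ) (hp : NonvanishingOnQuadric σ p) :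
    IsDegenerationOfPairs d (surfB.toY σ p) (coneY.str σ) := by
  refine ⟨_, _, projV.incl famGrading (span₁_le_span₂ famGrading (famEq σ) (famP p)), projStr _,
    isClosedImmersion_map _ (factorHom_surjective _ _) _, isProjectiveOverA1_projStr _,
    flat_projStr (torsionFree_family hσ), ?_, isQCartier_family hσ hp, isFibrePair_zero,
    fun c hc => exists_isFibrePair_of_ne_zero hp hc⟩
  have h : projV.incl famGrading (span₁_le_span₂ famGrading (famEq σ) (famP p)) ≫ projStr _ =
      projStr _ ≫ Spec.map (CommRingCat.ofHom (RingHom.id _)) :=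
    map_projStr (factorHom famGrading (span₁_le_span₂ famGrading (famEq σ) (famP p))) _
      (RingHom.id _) fun r => rfl
  rw [h]
  have h2 : Spec.map (CommRingCat.ofHom (RingHom.id (Polynomial ℂ))) = 𝟙 _ :=
    Spec.map_id (CommRingCat.of (Polynomial ℂ))
  rw [h2, Category.comp_id]
  exact flat_projStr (torsionFree_divisor hσ hp)

end VertexDimension

/-! ### Complete intersection. -/

section CompleteIntersection

open MvPolynomial

variable {σ : stdGrading 2} {d : ℕ} {p : wtGrading d}

/-- The prime `σ` does not divide `p`, which makes `σ, p` weakly regular; positive degrees keep `1`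
out of the ideal. -/
theorem isCompleteIntersection (hσ : IsSmoothQuadric σ) (hd : 0 < d)
    (hp : NonvanishingOnQuadric σ p) :
    IsCompleteIntersection 2 d (surfB.toY σ p ≫ coneY.ι σ) := by
  refine ⟨coneEq σ, p, ⟨?_, ?_⟩, Iso.refl _, ?_⟩
  · have hprime := prime_coneEq σ hσ
    rw [RingTheory.Sequence.isWeaklyRegular_cons_iff]
    refine ⟨fun a b h => mul_left_cancel₀ hprime.ne_zero h, ?_⟩
    rw [RingTheory.Sequence.isWeaklyRegular_singleton_iff]
    rw [isSMulRegular_iff_right_eq_zero_of_smul]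
    intro x hx
    obtain ⟨f, rfl⟩ := Submodule.mkQ_surjective _ x
    rw [← map_smul] at hx
    rw [Submodule.mkQ_apply, Submodule.Quotient.mk_eq_zero,
      Submodule.mem_smul_pointwise_iff_exists] at hx ⊢
    obtain ⟨g, -, hg⟩ := hx
    obtain ⟨e, he⟩ := (hprime.dvd_or_dvd (a := (p : MvPolynomial (Fin 5) ℂ)) (b := f)
      ⟨g, hg.symm⟩).resolve_left (by simpa [neg_dvd] using hp.not_dvd 0)
    exact ⟨e, trivial, he.symm⟩
  · intro h
    have h1 : (1 : MvPolynomial (Fin 5) ℂ) ∈ Ideal.span {(coneEq σ : MvPolynomial (Fin 5) ℂ),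
        (p : MvPolynomial (Fin 5) ℂ)} := by
      have h2 : (1 : MvPolynomial (Fin 5) ℂ) ∈ (⊤ : Submodule (MvPolynomial (Fin 5) ℂ)
        (MvPolynomial (Fin 5) ℂ)) := trivial
      rw [h] at h2
      have h3 : Ideal.ofList [(coneEq σ : MvPolynomial (Fin 5) ℂ), (p : MvPolynomial (Fin 5) ℂ)] =
          Ideal.span {(coneEq σ : MvPolynomial (Fin 5) ℂ), (p : MvPolynomial (Fin 5) ℂ)} := by
        rw [Ideal.ofList]
        congr 1
        ext f
        simp
      rw [h3, smul_eq_mul, Ideal.mul_top] at h2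
      exact h2
    have h2 : ∀ {n : ℕ} (_ : 0 < n) (f : wtGrading n),
        constantCoeff (f : MvPolynomial (Fin 5) ℂ) = 0 := by
      intro n hn f
      by_contra h3
      have h4 := f.2 h3
      simp at h4
      omega
    obtain ⟨a, b, hab⟩ := Ideal.mem_span_pair.mp h1
    have h3 := congr(constantCoeff $hab)
    simp [h2 two_pos, h2 hd] at h3
  · rw [Iso.refl_hom, Category.id_comp]
    exact Proj.map_comp (quotientHom wtGrading (span₁ wtGrading (coneEq σ)))
      (factorHom wtGrading (span₁_le_span₂ wtGrading (coneEq σ) p))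
      (irrelevant_le_map_quotientHom _ _) (irrelevant_le_map_factorHom _ _)

end CompleteIntersection

/-! ### The Jacobian criterion on the charts `xᵢ ≠ 0`. -/

section Jacobian

open MvPolynomial

/-- The Jacobian criterion: a quotient of a polynomial ring by `k` equations is smooth of relative
dimension `n` when the maximal minors of the Jacobian matrix generate the unit ideal. -/
theorem locally_isStandardSmooth_of_jacobian {R : Type} [CommRing R] {k m n : ℕ} (hkm : k + n = m)
    (v : Fin k → MvPolynomial (Fin m) R)
    (h : Ideal.span {x : MvPolynomial (Fin m) R ⧸ Ideal.span (Set.range v) |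
      ∃ a : Fin k → Fin m, Function.Injective a ∧
        x = Ideal.Quotient.mk _ (Matrix.of fun i j => pderiv (a i) (v j)).det} = ⊤) :
    RingHom.Locally (RingHom.IsStandardSmoothOfRelativeDimension n)
      (algebraMap R (MvPolynomial (Fin m) R ⧸ Ideal.span (Set.range v))) := by
  refine ⟨_, h, ?_⟩
  rintro t ⟨a, ha, rfl⟩
  set t := Ideal.Quotient.mk (Ideal.span (Set.range v))
    (Matrix.of fun i j => pderiv (a i) (v j)).det
  -- Where the minor `t` is invertible the given presentation becomes submersive. Localizing at `t`
  -- adds one variable and one equation, so the dimension is unchanged.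
  let P := Algebra.PreSubmersivePresentation.naive (v := v) a ha
  let Q := Algebra.SubmersivePresentation.localizationAway (Localization.Away t) t
  have hP : P.jacobian = t := by
    rw [Algebra.PreSubmersivePresentation.jacobian_eq_jacobiMatrix_det]
    have h1 : P.jacobiMatrix = Matrix.of fun i j => pderiv (a i) (v j) := by
      ext1 i j
      exact Algebra.PreSubmersivePresentation.jacobiMatrix_naive ..
    rw [h1]
    rfl
  let W : Algebra.SubmersivePresentation R (Localization.Away t) (Unit ⊕ Fin m) (Unit ⊕ Fin k) :=
    { toPreSubmersivePresentation := Q.toPreSubmersivePresentation.comp P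
      jacobian_isUnit := by
        rw [Algebra.PreSubmersivePresentation.comp_jacobian_eq_jacobian_smul_jacobian,
          Algebra.smul_def, IsUnit.mul_iff, hP]
        exact ⟨IsLocalization.Away.algebraMap_isUnit t, Q.jacobian_isUnit⟩ }
  have hW : W.dimension = n := by
    rw [Algebra.Presentation.dimension, Nat.card_sum, Nat.card_sum, Nat.card_fin, Nat.card_fin]
    omega
  rw [← IsScalarTower.algebraMap_eq R _ (Localization.Away t),
    RingHom.isStandardSmoothOfRelativeDimension_algebraMap]
  exact W.isStandardSmoothOfRelativeDimension hW

end Jacobian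

section SmoothCharts

open MvPolynomial HomogeneousLocalization

/-- If two homomorphisms differ on the variables by powers of `τ` according to the weights, they
differ by `τⁿ` on weighted homogeneous polynomials of degree `n`. -/
theorem map_mul_pow_of_isWeightedHomogeneous {R L ι : Type*} [CommRing R] [CommRing L] [Fintype ι]
    {w : ι → ℕ} (g h : MvPolynomial ι R →+* L) (τ : L) (hC : ∀ r, g (C r) = h (C r))
    (hX : ∀ i, g (X i) * τ ^ w i = h (X i)) {n : ℕ} {f : MvPolynomial ι R}
    (hf : f.IsWeightedHomogeneous w n) : g f * τ ^ n = h f := by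
  rw [f.as_sum, map_sum, map_sum, Finset.sum_mul]
  refine Finset.sum_congr rfl fun m hm => ?_
  have hw := hf (mem_support_iff.mp hm)
  rw [Finsupp.weight_apply, Finsupp.sum_fintype _ _ (by simp)] at hw
  rw [monomial_eq, Finsupp.prod_fintype _ _ (by simp), map_mul, map_mul, hC, map_prod, map_prod,
    mul_assoc, ← hw, ← Finset.prod_pow_eq_pow_sum, ← Finset.prod_mul_distrib]
  congr 1
  refine Finset.prod_congr rfl fun i _ => ?_
  rw [map_pow, map_pow, ← hX, mul_pow, ← pow_mul, smul_eq_mul, mul_comm (m i)]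

theorem localization_mk_mul_pow {A : Type*} [CommRing A] (s a : A) (k : ℕ)
    (hk : s ^ k ∈ Submonoid.powers s) :
    Localization.mk a ⟨s ^ k, hk⟩ * algebraMap A (Localization.Away s) s ^ k =
      algebraMap A (Localization.Away s) a := by
  rw [← map_pow, Localization.mk_eq_mk']
  exact IsLocalization.mk'_spec _ a ⟨s ^ k, hk⟩

/-- The Jacobian minors of two polynomials. -/
noncomputable def minor (f g : MvPolynomial (Fin 5) ℂ) (a b : Fin 5) : MvPolynomial (Fin 5) ℂ :=
  pderiv a f * pderiv b g - pderiv b f * pderiv a g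

/-- The ideal of the singular locus of the affine cone `f = g = 0`. -/
noncomputable def singIdeal (f g : MvPolynomial (Fin 5) ℂ) : Ideal (MvPolynomial (Fin 5) ℂ) :=
  Ideal.span ({f, g} ∪ Set.range fun k : Fin 5 × Fin 5 => minor f g k.1 k.2)

variable {d e : ℕ} (f : wtGrading e) (g : wtGrading d)

/-- The equations of the chart `xᵢ = 1` of `V₊(f, g)`. -/
noncomputable def chartEqs (i : Fin 4) : Fin 3 → MvPolynomial (Fin 5) ℂ :=
  ![(f : MvPolynomial (Fin 5) ℂ), g, X i.castSucc - 1]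

/-- The equation `xᵢ = 1` has derivative only in the direction `i`, so the `3 × 3` minors using that
column are, up to sign, the minors of `f, g` in two other columns. Euler's relation recovers the
minors involving column `i`, hence the whole singular ideal, and `xᵢᴺ` becomes `1` on the chart. -/
theorem span_jacobian_chartEqs_eq_top (i : Fin 4) {N : ℕ}
    (hN : X i.castSucc ^ N ∈ singIdeal (f : MvPolynomial (Fin 5) ℂ) g) :
    Ideal.span {x : MvPolynomial (Fin 5) ℂ ⧸ Ideal.span (Set.range (chartEqs f g i)) |
      ∃ a : Fin 3 → Fin 5, Function.Injective a ∧
        x = Ideal.Quotient.mk _ (Matrix.of fun k j => pderiv (a k) (chartEqs f g i j)).det} = ⊤ := by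
  set J := Ideal.span {x : MvPolynomial (Fin 5) ℂ ⧸ Ideal.span (Set.range (chartEqs f g i)) |
      ∃ a : Fin 3 → Fin 5, Function.Injective a ∧
        x = Ideal.Quotient.mk _ (Matrix.of fun k j => pderiv (a k) (chartEqs f g i j)).det}
  set π := Ideal.Quotient.mk (Ideal.span (Set.range (chartEqs f g i)))
  have hπ : ∀ k, π (chartEqs f g i k) = 0 := fun k =>
    Ideal.Quotient.eq_zero_iff_mem.mpr (Ideal.subset_span ⟨k, rfl⟩)
  have hf : π f = 0 := hπ 0
  have hg : π g = 0 := hπ 1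
  have hx : π (X i.castSucc) = 1 := by
    have := hπ 2
    rw [show chartEqs f g i 2 = X i.castSucc - 1 from rfl, map_sub, map_one, sub_eq_zero] at this
    exact this
  have h1 : ∀ a b : Fin 5, a ≠ i.castSucc → b ≠ i.castSucc → π (minor f g a b) ∈ J := by
    intro a b ha hb
    by_cases hab : a = b
    · subst hab
      simp [minor]
    · refine Ideal.subset_span ⟨![a, b, i.castSucc], ?_, ?_⟩
      · intro s t
        fin_cases s <;> fin_cases t <;> simp [ha, hb, hab, Ne.symm ha, Ne.symm hb, Ne.symm hab]
      · congr 1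
        rw [Matrix.det_fin_three]
        simp [chartEqs, minor, pderiv_X, Ne.symm ha, Ne.symm hb]
        ring
  -- Contracting the minors with the weighted Euler vector field yields a combination of `f` and
  -- `g`, which is zero on the chart.
  have h2 : ∀ b : Fin 5, ∑ a, (wt a : MvPolynomial (Fin 5) ℂ) * X a * minor f g a b =
      e * f.1 * pderiv b g.1 - d * g.1 * pderiv b f.1 := by
    intro b
    have hf := IsWeightedHomogeneous.sum_weight_X_mul_pderiv f.2
    have hg := IsWeightedHomogeneous.sum_weight_X_mul_pderiv g.2
    simp only [nsmul_eq_mul] at hf hg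
    rw [← hf, ← hg, Finset.sum_mul, Finset.sum_mul, ← Finset.sum_sub_distrib]
    refine Finset.sum_congr rfl fun a _ => ?_
    rw [minor]
    ring
  have h3 : ∀ b : Fin 5, b ≠ i.castSucc → π (minor f g i.castSucc b) ∈ J := by
    intro b hb
    have h4 := congr(π $(h2 b))
    rw [map_sub, map_mul, map_mul, map_mul, map_mul, hf, hg, map_sum,
      ← Finset.add_sum_erase _ _ (Finset.mem_univ i.castSucc), map_mul, map_mul, hx,
      wt_castSucc] at h4
    have h5 : π (minor f g i.castSucc b) = - ∑ a ∈ Finset.univ.erase i.castSucc,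
        π ((wt a : MvPolynomial (Fin 5) ℂ) * X a * minor f g a b) := by
      simp only [Nat.cast_one, map_one] at h4
      linear_combination h4
    rw [h5]
    refine neg_mem (Ideal.sum_mem _ fun a ha => ?_)
    rw [map_mul]
    exact Ideal.mul_mem_left _ _ (h1 a b (Finset.ne_of_mem_erase ha) hb)
  have h4 : ∀ a b : Fin 5, π (minor f g a b) ∈ J := by
    intro a b
    have hanti : ∀ a b, minor (f : MvPolynomial (Fin 5) ℂ) g a b = - minor f g b a := by
      intro a b
      simp only [minor]
      ring
    by_cases ha : a = i.castSucc
    · by_cases hb : b = i.castSucc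
      · rw [ha, hb]
        simp [minor]
      · rw [ha]
        exact h3 b hb
    · by_cases hb : b = i.castSucc
      · rw [hb, hanti, map_neg]
        exact neg_mem (h3 a ha)
      · exact h1 a b ha hb
  have h5 : singIdeal (f : MvPolynomial (Fin 5) ℂ) g ≤ J.comap π := by
    rw [singIdeal, Ideal.span_le]
    rintro _ ((rfl | rfl) | ⟨k, rfl⟩)
    · change π _ ∈ J
      rw [hf]; exact zero_mem _
    · change π _ ∈ J
      rw [hg]; exact zero_mem _
    · exact h4 k.1 k.2
  have h6 := h5 hN
  rw [Ideal.mem_comap, map_pow, hx, one_pow] at h6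
  exact (Ideal.eq_top_iff_one _).mpr h6

theorem xq_castSucc_mem (I : HomogeneousIdeal wtGrading) (i : Fin 4) :
    xq I i.castSucc ∈ quotientGrading wtGrading I 1 := by
  have := xq_mem I i.castSucc
  rwa [wt_castSucc] at this

theorem xq_mem_smul_one (I : HomogeneousIdeal wtGrading) (a : Fin 5) :
    xq I a ∈ quotientGrading wtGrading I (wt a • 1) := by
  rw [smul_eq_mul, mul_one]
  exact xq_mem I a

/-- The coordinate ring of the chart `xᵢ ≠ 0` is obtained by setting `xᵢ = 1`. -/
theorem exists_chart_ringEquiv (i : Fin 4) :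
    ∃ φ : (MvPolynomial (Fin 5) ℂ ⧸ Ideal.span (Set.range (chartEqs f g i))) ≃+*
      Away (quotientGrading wtGrading (span₂ wtGrading f g)) (xq (span₂ wtGrading f g) i.castSucc),
      φ.toRingHom.comp (algebraMap ℂ _) = awayAlgebraMap _ _ := by
  set I := span₂ wtGrading f g
  set E := Away (quotientGrading wtGrading I) (xq I i.castSucc)
  let ρ : MvPolynomial (Fin 5) ℂ →+* E := eval₂Hom (awayAlgebraMap _ _)
    fun a => Away.mk _ (xq_castSucc_mem I i) (wt a) (xq I a) (xq_mem_smul_one I a)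
  have hρX : ∀ a, ρ (X a) =
      Away.mk _ (xq_castSucc_mem I i) (wt a) (xq I a) (xq_mem_smul_one I a) :=
    fun a => eval₂Hom_X' _ _ _
  have hρC : ∀ r, ρ (C r) = awayAlgebraMap _ _ r := fun r => eval₂Hom_C _ _ _
  let L := Localization.Away (xq I i.castSucc)
  -- On a form of degree `n` the substitution `xₐ ↦ xₐ / xᵢ^(wt a)` is division by `xᵢⁿ`.
  have hρ : ∀ (n : ℕ) (q : MvPolynomial (Fin 5) ℂ) (_ : q ∈ wtGrading n)
      (hq' : Ideal.Quotient.mk I.toIdeal q ∈ quotientGrading wtGrading I (n • 1)),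
      ρ q = Away.mk _ (xq_castSucc_mem I i) n (Ideal.Quotient.mk I.toIdeal q) hq' := by
    intro n q hq hq'
    have h1 := map_mul_pow_of_isWeightedHomogeneous ((algebraMap E L).comp ρ)
      ((algebraMap _ L).comp (Ideal.Quotient.mk I.toIdeal)) (algebraMap _ L (xq I i.castSucc))
      (fun r => by rw [RingHom.comp_apply, hρC]; exact val_awayAlgebraMap _ _)
      (fun a => by
        rw [RingHom.comp_apply, hρX]
        exact localization_mk_mul_pow _ _ (wt a) _) hq
    have hu : IsUnit (algebraMap _ L (xq I i.castSucc) ^ n) :=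
      (IsLocalization.Away.algebraMap_isUnit (xq I i.castSucc)).pow n
    rw [ext_iff_val, Away.val_mk]
    apply hu.mul_right_cancel
    rw [localization_mk_mul_pow]
    exact h1
  have hρ0 : ∀ a ∈ Ideal.span (Set.range (chartEqs f g i)), ρ a = 0 := by
    intro a ha
    have hle : Ideal.span (Set.range (chartEqs f g i)) ≤ RingHom.ker ρ := by
      rw [Ideal.span_le]
      have hzero : ∀ (n : ℕ) (q : wtGrading n), (q : MvPolynomial (Fin 5) ℂ) ∈ I.toIdeal →
          ρ q = 0 := by
        intro n q hq
        have hq' : Ideal.Quotient.mk I.toIdeal (q : MvPolynomial (Fin 5) ℂ) ∈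
            quotientGrading wtGrading I (n • 1) := by
          rw [smul_eq_mul, mul_one]
          exact mk_mem_quotientGrading _ I q.2
        rw [hρ n q q.2 hq', away_mk_eq_zero_iff]
        exact ⟨0, by rw [Ideal.Quotient.eq_zero_iff_mem.mpr hq, mul_zero]⟩
      rintro _ ⟨k, rfl⟩
      fin_cases k
      · exact hzero _ f ((mem_span₂_iff _ _ _ _).mpr ⟨1, 0, by ring⟩)
      · exact hzero _ g ((mem_span₂_iff _ _ _ _).mpr ⟨0, 1, by ring⟩)
      · change ρ (X i.castSucc - 1) = 0
        rw [map_sub, map_one, hρX, sub_eq_zero, ext_iff_val, Away.val_mk, val_one, wt_castSucc,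
          ← Localization.mk_one, Localization.mk_eq_mk_iff, Localization.r_iff_exists]
        exact ⟨1, by simp⟩
    exact hle ha
  let ψ : (MvPolynomial (Fin 5) ℂ ⧸ I.toIdeal) →+*
      MvPolynomial (Fin 5) ℂ ⧸ Ideal.span (Set.range (chartEqs f g i)) :=
    Ideal.Quotient.lift _ (Ideal.Quotient.mk _) (by
      intro a ha
      obtain ⟨b, c, rfl⟩ := (mem_span₂_iff _ _ _ _).mp ha
      rw [Ideal.Quotient.eq_zero_iff_mem]
      exact add_mem (Ideal.mul_mem_right _ _ (Ideal.subset_span ⟨0, rfl⟩))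
        (Ideal.mul_mem_right _ _ (Ideal.subset_span ⟨1, rfl⟩)))
  have hψ : ψ (xq I i.castSucc) = 1 := by
    change Ideal.Quotient.mk _ (X i.castSucc) = 1
    rw [← map_one (Ideal.Quotient.mk _), Ideal.Quotient.eq]
    exact Ideal.subset_span ⟨2, rfl⟩
  let F := Ideal.Quotient.lift _ ρ hρ0
  let G : E →+* _ := awayEval ψ hψ
  have h1 : F.comp G = RingHom.id _ := by
    refine RingHom.ext fun z => ?_
    obtain ⟨n, a, ha, rfl⟩ := Away.mk_surjective _ (xq_castSucc_mem I i) z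
    obtain ⟨q, hq, rfl⟩ : ∃ q ∈ wtGrading (n • 1), Ideal.Quotient.mk I.toIdeal q = a := id ha
    rw [RingHom.comp_apply]
    simp only [G]
    rw [awayEval_mk]
    change ρ q = _
    rw [smul_eq_mul, mul_one] at hq
    exact hρ n q hq ha
  have h2 : G.comp F = RingHom.id _ := by
    refine Ideal.Quotient.ringHom_ext (MvPolynomial.ringHom_ext (fun r => ?_) fun a => ?_)
    · change G (ρ (C r)) = _
      rw [hρC]
      simp only [G]
      rw [awayEval_awayAlgebraMap (xq_castSucc_mem I i)]
      rfl
    · change G (ρ (X a)) = _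
      rw [hρX]
      simp only [G]
      rw [awayEval_mk]
      rfl
  exact ⟨RingEquiv.ofRingHom F G h1 h2, RingHom.ext fun r => hρC r⟩

end SmoothCharts

section SmoothSurface

open MvPolynomial HomogeneousLocalization

variable {d e : ℕ} (f : wtGrading e) (g : wtGrading d)

theorem smooth_awayι_projStr (i : Fin 4) {N : ℕ}
    (hN : X i.castSucc ^ N ∈ singIdeal (f : MvPolynomial (Fin 5) ℂ) g) :
    SmoothOfRelativeDimension 2 (Proj.awayι _ (xq (span₂ wtGrading f g) i.castSucc)
      (xq_castSucc_mem _ i) one_pos ≫ projStr _) := by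
  rw [awayι_projStr, HasRingHomProperty.Spec_iff (P := @SmoothOfRelativeDimension 2)]
  obtain ⟨φ, hφ⟩ := exists_chart_ringEquiv f g i
  have h1 := locally_isStandardSmooth_of_jacobian (n := 2) (by norm_num) _
    (span_jacobian_chartEqs_eq_top f g i hN)
  rw [CommRingCat.hom_ofHom, ← hφ]
  exact (RingHom.locally_respectsIso RingHom.isStandardSmoothOfRelativeDimension_respectsIso).1
    _ φ h1

/-- `V₊(f, g)` is smooth of dimension two where the `xᵢ` do not all vanish. -/
theorem smooth_of_forall_exists_pow_mem
    (hJ : ∀ i : Fin 4, ∃ N, X i.castSucc ^ N ∈ singIdeal (f : MvPolynomial (Fin 5) ℂ) g)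
    {W : Scheme.{0}} (j : W ⟶ projV wtGrading (span₂ wtGrading f g)) [IsOpenImmersion j]
    (hW : ∀ w : W, ∃ i : Fin 4,
      j w ∈ Proj.basicOpen _ (xq (span₂ wtGrading f g) i.castSucc)) :
    SmoothOfRelativeDimension 2 (j ≫ projStr _) := by
  have hloc : IsZariskiLocalAtSource (@SmoothOfRelativeDimension.{0} 2) :=
    HasRingHomProperty.instIsZariskiLocalAtSource
  have htop : ⨆ i : Fin 4, j ⁻¹ᵁ Proj.basicOpen _ (xq (span₂ wtGrading f g) i.castSucc) = ⊤ := by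
    refine top_le_iff.mp fun w _ => ?_
    obtain ⟨i, hi⟩ := hW w
    exact TopologicalSpace.Opens.mem_iSup.mpr ⟨i, hi⟩
  refine (IsZariskiLocalAtSource.iff_of_iSup_eq_top (P := @SmoothOfRelativeDimension 2) _ htop).mpr
    fun i => ?_
  obtain ⟨N, hN⟩ := hJ i
  set V := j ⁻¹ᵁ Proj.basicOpen _ (xq (span₂ wtGrading f g) i.castSucc)
  set α := Proj.awayι _ (xq (span₂ wtGrading f g) i.castSucc) (xq_castSucc_mem _ i) one_pos
  -- The piece of `W` over `D₊(xᵢ)` factors through the smooth chart by an open immersion.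
  have hrange : Set.range (V.ι ≫ j) ⊆ Set.range α := by
    rintro _ ⟨w, rfl⟩
    have h1 : α.opensRange = Proj.basicOpen _ (xq (span₂ wtGrading f g) i.castSucc) :=
      Proj.opensRange_awayι ..
    change _ ∈ α.opensRange
    rw [h1]
    exact w.2
  have hfac : IsOpenImmersion.lift α (V.ι ≫ j) hrange ≫ α = V.ι ≫ j :=
    IsOpenImmersion.lift_fac _ _ _
  have : IsOpenImmersion (IsOpenImmersion.lift α (V.ι ≫ j) hrange ≫ α) := by
    rw [hfac]; infer_instance
  have : IsOpenImmersion (IsOpenImmersion.lift α (V.ι ≫ j) hrange) :=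
    IsOpenImmersion.of_comp _ α
  rw [← Category.assoc, ← hfac, Category.assoc]
  exact IsZariskiLocalAtSource.comp (P := @SmoothOfRelativeDimension 2)
    (smooth_awayι_projStr f g i hN) _

end SmoothSurface

/-! ### Openness of the nonsingularity condition. -/

section Openness

open MvPolynomial

theorem finite_weight_eq (n : ℕ) : {m : Fin 5 →₀ ℕ | Finsupp.weight wt m = n}.Finite :=
  (Finsupp.finite_of_nat_weight_le wt (fun i => (wt_pos i).ne') n).subset fun _ h => le_of_eq h

/-- The monomials of weighted degree `n`. -/
noncomputable def weightMonomials (n : ℕ) : Finset (Fin 5 →₀ ℕ) := (finite_weight_eq n).toFinset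

theorem mem_weightMonomials {n : ℕ} {m : Fin 5 →₀ ℕ} :
    m ∈ weightMonomials n ↔ Finsupp.weight wt m = n := by
  simp [weightMonomials]

theorem sum_weightMonomials {n : ℕ} {q : MvPolynomial (Fin 5) ℂ} (hq : q ∈ wtGrading n) :
    ∑ m ∈ weightMonomials n, monomial m (coeff m q) = q := by
  conv_rhs => rw [q.as_sum]
  symm
  refine Finset.sum_subset (fun m hm => ?_) fun m _ hm => ?_
  · exact mem_weightMonomials.mpr (hq (mem_support_iff.mp hm))
  · rw [notMem_support_iff.mp hm, map_zero]

/-- An affine function on the space of weighted homogeneous polynomials is polynomial in the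
coefficients. -/
theorem exists_eval_coeff_eq (d : ℕ) (a : ℂ) (ℓ : MvPolynomial (Fin 5) ℂ →ₗ[ℂ] ℂ) :
    ∃ F : MvPolynomial (Fin 5 →₀ ℕ) ℂ, ∀ p : wtGrading d,
      eval (fun m => coeff m (p : MvPolynomial (Fin 5) ℂ)) F = a + ℓ p := by
  refine ⟨C a + ∑ m ∈ weightMonomials d, C (ℓ (monomial m 1)) * X m, fun p => ?_⟩
  simp only [map_add, map_sum, map_mul, eval_C, eval_X]
  congr 1
  conv_rhs => rw [← sum_weightMonomials p.2]
  rw [map_sum]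
  refine Finset.sum_congr rfl fun m _ => ?_
  rw [mul_comm, ← smul_eq_mul, ← map_smul, smul_monomial, smul_eq_mul, mul_one]

/-- The generators of `singIdeal`. -/
noncomputable def singGen (f g : MvPolynomial (Fin 5) ℂ) :
    Fin 2 ⊕ (Fin 5 × Fin 5) → MvPolynomial (Fin 5) ℂ :=
  Sum.elim ![f, g] fun k => minor f g k.1 k.2

theorem singIdeal_eq_span_range (f g : MvPolynomial (Fin 5) ℂ) :
    singIdeal f g = Ideal.span (Set.range (singGen f g)) := by
  rw [singIdeal, singGen, Set.Sum.elim_range]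
  congr 2
  ext q
  simp only [Set.mem_insert_iff, Set.mem_singleton_iff, Matrix.range_cons, Matrix.range_empty,
    Set.union_empty, Set.singleton_union]

/-- For fixed `f` the generators are affine-linear in `g`, hence any fixed combination of them has
coefficients that are polynomial in those of `g`. -/
theorem exists_singGen_eq (f : MvPolynomial (Fin 5) ℂ) (k : Fin 2 ⊕ (Fin 5 × Fin 5)) :
    ∃ (c : MvPolynomial (Fin 5) ℂ) (l : MvPolynomial (Fin 5) ℂ →ₗ[ℂ] MvPolynomial (Fin 5) ℂ),
      ∀ g, singGen f g k = c + l g := by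
  rcases k with k | ⟨a, b⟩
  · fin_cases k
    · exact ⟨f, 0, fun g => by simp [singGen]⟩
    · exact ⟨0, LinearMap.id, fun g => by simp [singGen]⟩
  · refine ⟨0, (LinearMap.mulLeft ℂ (pderiv a f)).comp (pderiv b).toLinearMap -
      (LinearMap.mulLeft ℂ (pderiv b f)).comp (pderiv a).toLinearMap, fun g => ?_⟩
    simp [singGen, minor]

/-- If `n < wt a`, no monomial of degree `n` contains the variable. This case is separated because
the degree `n - wt a` would be truncated. -/
theorem pderiv_mem_or_eq_zero {n : ℕ} {q : MvPolynomial (Fin 5) ℂ} (hq : q ∈ wtGrading n)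
    (a : Fin 5) : pderiv a q = 0 ∨ ∃ k, k + wt a = n ∧ pderiv a q ∈ wtGrading k := by
  by_cases h : wt a ≤ n
  · exact Or.inr ⟨n - wt a, Nat.sub_add_cancel h,
      IsWeightedHomogeneous.pderiv hq (Nat.sub_add_cancel h)⟩
  · left
    apply pderiv_eq_zero_of_notMem_vars
    intro hmem
    obtain ⟨m, hm, ha⟩ := (mem_vars_iff_mem_support a).mp hmem
    have h1 := hq (mem_support_iff.mp hm)
    rw [Finsupp.weight_apply, Finsupp.sum_fintype _ _ (by simp)] at h1
    have h2 := Finset.single_le_sum (f := fun i => m i • wt i) (fun i _ => Nat.zero_le _)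
      (Finset.mem_univ a)
    have h3 : 1 ≤ m a := Nat.one_le_iff_ne_zero.mpr (Finsupp.mem_support_iff.mp ha)
    have h4 : wt a ≤ m a • wt a := by
      rw [smul_eq_mul]
      exact Nat.le_mul_of_pos_left _ h3
    omega

theorem isHomogeneous_singIdeal {d e : ℕ} (f : wtGrading e) (g : wtGrading d) :
    (singIdeal (f : MvPolynomial (Fin 5) ℂ) g).IsHomogeneous wtGrading := by
  refine Ideal.homogeneous_span _ _ ?_
  rintro _ ((rfl | rfl) | ⟨⟨a, b⟩, rfl⟩)
  · exact ⟨e, f.2⟩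
  · exact ⟨d, g.2⟩
  · have key : ∀ a b, pderiv a f.1 * pderiv b g.1 = 0 ∨
        ∃ k, k + wt a + wt b = e + d ∧ pderiv a f.1 * pderiv b g.1 ∈ wtGrading k := by
      intro a b
      rcases pderiv_mem_or_eq_zero f.2 a with h1 | ⟨k, hk, h1⟩
      · exact Or.inl (by rw [h1, zero_mul])
      rcases pderiv_mem_or_eq_zero g.2 b with h2 | ⟨l, hl, h2⟩
      · exact Or.inl (by rw [h2, mul_zero])
      exact Or.inr ⟨k + l, by omega, SetLike.mul_mem_graded h1 h2⟩
    change SetLike.IsHomogeneousElem wtGrading (pderiv a f.1 * pderiv b g.1 -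
      pderiv b f.1 * pderiv a g.1)
    rcases key a b with h1 | ⟨k, hk, h1⟩ <;> rcases key b a with h2 | ⟨l, hl, h2⟩
    · rw [h1, h2, sub_zero]
      exact ⟨0, zero_mem _⟩
    · rw [h1, zero_sub]
      exact ⟨l, neg_mem h2⟩
    · rw [h2, sub_zero]
      exact ⟨k, h1⟩
    -- Both products have degree `e + d - wt a - wt b`, so their difference is homogeneous.
    · obtain rfl : k = l := by omega
      exact ⟨k, sub_mem h1 h2⟩

/-- If the singular ideal of `(f, p₀)` contains all forms of degree `n`, then so does that of
`(f, p)` for general `p`. -/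
theorem exists_eval_ne_zero_of_forall_mem_singIdeal {d e n : ℕ} (f : wtGrading e)
    (p₀ : wtGrading d)
    (h₀ : ∀ q ∈ wtGrading n, q ∈ singIdeal (f : MvPolynomial (Fin 5) ℂ) p₀) :
    ∃ F : MvPolynomial (Fin 5 →₀ ℕ) ℂ,
      eval (fun m => coeff m (p₀ : MvPolynomial (Fin 5) ℂ)) F ≠ 0 ∧
      ∀ p : wtGrading d, eval (fun m => coeff m (p : MvPolynomial (Fin 5) ℂ)) F ≠ 0 →
        ∀ q ∈ wtGrading n, q ∈ singIdeal (f : MvPolynomial (Fin 5) ℂ) p := by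
  classical
  -- The multipliers `h` expressing each monomial of degree `n` are chosen for `p₀` and then kept
  -- fixed while `p` varies.
  have h1 : ∀ m : weightMonomials n, ∃ h : Fin 2 ⊕ (Fin 5 × Fin 5) → MvPolynomial (Fin 5) ℂ,
      ∑ k, h k * singGen f.1 p₀.1 k = monomial m.1 1 := by
    intro m
    have h2 := h₀ (monomial m.1 1) (monomial_mem_of_weight_eq (mem_weightMonomials.mp m.2) _)
    rw [singIdeal_eq_span_range] at h2
    exact Ideal.mem_span_range_iff_exists_fun.mp h2
  choose h hh using h1
  choose c l hcl using exists_singGen_eq f.1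
  have hF : ∀ μ ν : weightMonomials n, ∃ F : MvPolynomial (Fin 5 →₀ ℕ) ℂ, ∀ p : wtGrading d,
      eval (fun m => coeff m (p : MvPolynomial (Fin 5) ℂ)) F =
        coeff ν.1 (∑ k, h μ k * singGen f.1 p.1 k) := by
    intro μ ν
    obtain ⟨F, hF⟩ := exists_eval_coeff_eq d (coeff ν.1 (∑ k, h μ k * c k))
      ((lcoeff ℂ ν.1).comp (∑ k, (LinearMap.mulLeft ℂ (h μ k)).comp (l k)))
    refine ⟨F, fun p => ?_⟩
    rw [hF]
    simp only [hcl, mul_add, Finset.sum_add_distrib, coeff_add]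
    congr 1
  choose F hF using hF
  -- The matrix collects the degree `n` coefficients of these combinations. At `p₀` it is the
  -- identity; wherever it is invertible, the combinations still span all forms of degree `n`.
  refine ⟨(Matrix.of F).det, ?_, ?_⟩
  · rw [RingHom.map_det]
    have h2 : (eval fun m => coeff m (p₀ : MvPolynomial (Fin 5) ℂ)).mapMatrix (Matrix.of F) = 1 := by
      ext μ ν
      rw [RingHom.mapMatrix_apply, Matrix.map_apply, Matrix.of_apply, hF, hh, coeff_monomial,
        Matrix.one_apply]
      exact if_congr Subtype.ext_iff.symm rfl rfl
    rw [h2, Matrix.det_one]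
    exact one_ne_zero
  · intro p hp q hq
    rw [RingHom.map_det] at hp
    set D := (eval fun m => coeff m (p : MvPolynomial (Fin 5) ℂ)).mapMatrix (Matrix.of F)
    have hD : ∀ μ ν, D μ ν = coeff ν.1 (∑ k, h μ k * singGen f.1 p.1 k) := by
      intro μ ν
      simp only [D, RingHom.mapMatrix_apply, Matrix.map_apply, Matrix.of_apply, hF]
    -- The multipliers need not be homogeneous, so the combinations may have other components; these
    -- are dropped using homogeneity of the ideal.
    have hQ : ∀ μ : weightMonomials n, ∑ ν : weightMonomials n, monomial ν.1 (D μ ν) ∈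
        singIdeal (f : MvPolynomial (Fin 5) ℂ) p := by
      intro μ
      have h2 : ∑ k, h μ k * singGen f.1 p.1 k ∈ singIdeal (f : MvPolynomial (Fin 5) ℂ) p := by
        rw [singIdeal_eq_span_range]
        exact Ideal.sum_mem _ fun k _ => Ideal.mul_mem_left _ _ (Ideal.subset_span ⟨k, rfl⟩)
      have h3 := isHomogeneous_singIdeal f p n h2
      convert h3 using 1
      have h4 : ((DirectSum.decompose wtGrading (∑ k, h μ k * singGen f.1 p.1 k) n : wtGrading n) :
          MvPolynomial (Fin 5) ℂ) =
          weightedHomogeneousComponent wt n (∑ k, h μ k * singGen f.1 p.1 k) :=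
        weightedDecomposition.decompose'_apply ..
      rw [h4, ← sum_weightMonomials (weightedHomogeneousComponent_mem _ _ _)]
      refine Eq.trans ?_ (Finset.sum_coe_sort (weightMonomials n) _)
      refine Finset.sum_congr rfl fun ν _ => ?_
      rw [hD, coeff_weightedHomogeneousComponent, if_pos (mem_weightMonomials.mp ν.2)]
    have hmon : ∀ ν : weightMonomials n, monomial ν.1 1 ∈
        singIdeal (f : MvPolynomial (Fin 5) ℂ) p := by
      intro ν
      have hinv : D⁻¹ * D = 1 := Matrix.nonsing_inv_mul _ (isUnit_iff_ne_zero.mpr hp)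
      have h2 : monomial ν.1 1 = ∑ μ, C (D⁻¹ ν μ) * ∑ ν', monomial ν'.1 (D μ ν') := by
        simp only [Finset.mul_sum, C_mul_monomial]
        rw [Finset.sum_comm]
        have h3 : ∀ ν', ∑ μ, D⁻¹ ν μ * D μ ν' = if ν = ν' then 1 else 0 := by
          intro ν'
          rw [← Matrix.mul_apply, hinv, Matrix.one_apply]
        have h4 : ∀ ν' : weightMonomials n, ∑ μ, monomial ν'.1 (D⁻¹ ν μ * D μ ν') =
            if ν = ν' then monomial ν'.1 1 else 0 := by
          intro ν'
          rw [← map_sum, h3]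
          split_ifs <;> simp
        rw [Finset.sum_congr rfl fun ν' _ => h4 ν', Finset.sum_ite_eq, if_pos (Finset.mem_univ _)]
      rw [h2]
      exact Ideal.sum_mem _ fun μ _ => Ideal.mul_mem_left _ _ (hQ μ)
    rw [← sum_weightMonomials hq]
    refine Ideal.sum_mem _ fun m hm => ?_
    rw [← mul_one (coeff m q), ← C_mul_monomial]
    exact Ideal.mul_mem_left _ _ (hmon ⟨m, hm⟩)

end Openness

/-! ### Singularities of Fermat-type examples. -/

section Fermat

open MvPolynomial

/-- For nonzero `yᵢ, yⱼ` the relations give `(2ʲ yⱼ)^e = (2ⁱ yᵢ)^e`, so the numbers `4ⁱ |yᵢ|²`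
agree. The first nonzero `yᵢ²` then exceeds in absolute value the sum of the following ones, as `1/4
+ 1/16 + 1/64 < 1`, and cannot cancel against them. -/
theorem eq_zero_of_sum_sq_of_fermat {e : ℕ} (he : e ≠ 0) (y : Fin 4 → ℂ) (hs : ∑ i, y i ^ 2 = 0)
    (h : ∀ i j : Fin 4, y i * ((2 ^ (j : ℕ)) ^ e * y j ^ (e + 1)) =
      y j * ((2 ^ (i : ℕ)) ^ e * y i ^ (e + 1))) : y = 0 := by
  have h1 : ∀ i j : Fin 4, y i ≠ 0 → (4 : ℝ) ^ (j : ℕ) * ‖y j‖ ^ 2 ≤ 4 ^ (i : ℕ) * ‖y i‖ ^ 2 := by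
    intro i j hi
    by_cases hj : y j = 0
    · rw [hj, norm_zero]
      simp only [ne_eq, OfNat.ofNat_ne_zero, not_false_eq_true, zero_pow, mul_zero]
      positivity
    · have h2 : (2 ^ (j : ℕ) * y j) ^ e = (2 ^ (i : ℕ) * y i) ^ e := by
        have := h i j
        apply mul_left_cancel₀ (mul_ne_zero hi hj)
        rw [mul_pow, mul_pow]
        linear_combination this
      have h3 : ‖2 ^ (j : ℕ) * y j‖ = ‖2 ^ (i : ℕ) * y i‖ := by
        have := congr(‖$h2‖)
        rw [norm_pow, norm_pow] at this
        exact (pow_left_inj₀ (norm_nonneg _) (norm_nonneg _) he).mp this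
      have h4 : ∀ k : Fin 4, (4 : ℝ) ^ (k : ℕ) * ‖y k‖ ^ 2 = ‖2 ^ (k : ℕ) * y k‖ ^ 2 := by
        intro k
        rw [norm_mul, norm_pow, Complex.norm_ofNat, mul_pow, ← pow_mul, mul_comm (k : ℕ), pow_mul]
        norm_num
      rw [h4, h4, h3]
  have hn : ∀ i, ‖y i ^ 2‖ = ‖y i‖ ^ 2 := fun i => norm_pow _ _
  have hp : ∀ i, y i ≠ 0 → 0 < ‖y i‖ ^ 2 := fun i hi => by positivity
  rw [Fin.sum_univ_four] at hs
  have y0 : y 0 = 0 := by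
    by_contra hy
    have e1 := h1 0 1 hy
    have e2 := h1 0 2 hy
    have e3 := h1 0 3 hy
    have e4 := norm_add₃_le (a := y 1 ^ 2) (b := y 2 ^ 2) (c := y 3 ^ 2)
    rw [show y 1 ^ 2 + y 2 ^ 2 + y 3 ^ 2 = - y 0 ^ 2 by linear_combination hs, norm_neg, hn, hn, hn,
      hn] at e4
    have := hp 0 hy
    norm_num at e1 e2 e3
    linarith
  rw [y0] at hs
  have y1 : y 1 = 0 := by
    by_contra hy
    have e2 := h1 1 2 hy
    have e3 := h1 1 3 hy
    have e4 := norm_add_le (y 2 ^ 2) (y 3 ^ 2)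
    rw [show y 2 ^ 2 + y 3 ^ 2 = - y 1 ^ 2 by linear_combination hs, norm_neg, hn, hn, hn] at e4
    have := hp 1 hy
    norm_num at e2 e3
    linarith
  rw [y1] at hs
  have y2 : y 2 = 0 := by
    by_contra hy
    have e3 := h1 2 3 hy
    have e4 := hn 3
    rw [show y 3 ^ 2 = - y 2 ^ 2 by linear_combination hs, norm_neg, hn] at e4
    have := hp 2 hy
    norm_num at e3
    linarith
  rw [y2] at hs
  have y3 : y 3 = 0 := by
    have : y 3 ^ 2 = 0 := by linear_combination hs
    exact pow_eq_zero_iff (two_ne_zero) |>.mp this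
  funext i
  fin_cases i <;> assumption

/-- A linear form in `x₀,…,x₃`, regarded as an element of `ℂ[x₀,…,x₃,w]`. -/
noncomputable def coneForm (c : Fin 4 → ℂ) : MvPolynomial (Fin 5) ℂ :=
  rename Fin.castSucc (linForm c)

theorem coneForm_eq_sum (c : Fin 4 → ℂ) : coneForm c = ∑ j, C (c j) * X j.castSucc := by
  simp [coneForm, linForm, map_sum]

theorem coneForm_mem (c : Fin 4 → ℂ) : coneForm c ∈ wtGrading 1 := by
  rw [coneForm_eq_sum]
  refine Submodule.sum_mem _ fun j _ => ?_
  rw [← smul_eq_C_mul]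
  have h := isWeightedHomogeneous_X ℂ wt j.castSucc
  rw [wt_castSucc] at h
  exact Submodule.smul_mem _ _ h

theorem pderiv_castSucc_coneForm (c : Fin 4 → ℂ) (a : Fin 4) :
    pderiv a.castSucc (coneForm c) = C (c a) := by
  simp only [coneForm_eq_sum, map_sum, Derivation.leibniz, pderiv_C, pderiv_X, smul_eq_mul,
    mul_zero, add_zero]
  rw [Finset.sum_eq_single a]
  · simp
  · intro b _ hb
    rw [Pi.single_eq_of_ne (by simpa using hb), mul_zero]
  · simp

theorem pderiv_last_coneForm (c : Fin 4 → ℂ) : pderiv 4 (coneForm c) = 0 := by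
  simp only [coneForm_eq_sum, map_sum, Derivation.leibniz, pderiv_C, pderiv_X, smul_eq_mul,
    mul_zero, add_zero]
  refine Finset.sum_eq_zero fun b _ => ?_
  rw [Pi.single_eq_of_ne (by exact (Fin.castSucc_lt_last b).ne), mul_zero]

/-- The ideal `(x₀,…,x₃)` of `ℂ[x₀,…,x₃,w]`. -/
noncomputable def linIdeal : Ideal (MvPolynomial (Fin 5) ℂ) :=
  Ideal.span (Set.range fun a : Fin 4 => X a.castSucc)

theorem coneForm_mem_linIdeal (c : Fin 4 → ℂ) : coneForm c ∈ linIdeal := by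
  rw [coneForm_eq_sum]
  exact Ideal.sum_mem _ fun j _ => Ideal.mul_mem_left _ _ (Ideal.subset_span ⟨j, rfl⟩)

variable {N N' : Matrix (Fin 4) (Fin 4) ℂ}

theorem sum_coneForm (h' : N' * N = 1) (a : Fin 4) :
    ∑ i, C (N' a i) * coneForm (N i) = X a.castSucc := by
  have h1 := congr(rename Fin.castSucc $(linForm_mul N' N a))
  rw [h', map_sum] at h1
  simp only [map_mul, rename_C] at h1
  refine h1.symm.trans ?_
  simp [linForm, Matrix.one_apply]

theorem linIdeal_le_of_forall_coneForm_mem (h' : N' * N = 1) {J : Ideal (MvPolynomial (Fin 5) ℂ)}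
    (hJ : ∀ i, coneForm (N i) ∈ J) : linIdeal ≤ J := by
  rw [linIdeal, Ideal.span_le]
  rintro _ ⟨a, rfl⟩
  change X a.castSucc ∈ J
  rw [← sum_coneForm h' a]
  exact Ideal.sum_mem _ fun j _ => Ideal.mul_mem_left _ _ (hJ j)

theorem coneEq_eq_sum {σ : stdGrading 2}
    (hσ : (σ : MvPolynomial (Fin 4) ℂ) = ∑ i, linForm (N i) ^ 2) :
    (coneEq σ : MvPolynomial (Fin 5) ℂ) = ∑ i, coneForm (N i) ^ 2 := by
  change rename Fin.castSucc (σ : MvPolynomial (Fin 4) ℂ) = _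
  rw [hσ, map_sum]
  simp [coneForm]

/-- These are the minors computed in the linear coordinates `ℓᵢ` and `w`: there `∂f/∂ℓᵢ = 2 ℓᵢ`,
`∂f/∂w = 0`, and `bᵢ = ∂g/∂ℓᵢ`. -/
theorem coneForm_mul_sub_mem_singIdeal (h : N * N' = 1) {f g : MvPolynomial (Fin 5) ℂ}
    (hf : f = ∑ i, coneForm (N i) ^ 2) {b : Fin 4 → MvPolynomial (Fin 5) ℂ}
    (hb : ∀ a : Fin 4, pderiv a.castSucc g = ∑ i, C (N i a) * b i) (i j : Fin 4) :
    coneForm (N i) * b j - coneForm (N j) * b i ∈ singIdeal f g ∧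
      coneForm (N i) * pderiv 4 g ∈ singIdeal f g := by
  -- Contracting a gradient in the `xₐ` with `N'` yields the derivatives along the `ℓᵢ`.
  have hcontr : ∀ (c : Fin 4 → MvPolynomial (Fin 5) ℂ) (i : Fin 4),
      ∑ a, C (N' a i) * ∑ k, C (N k a) * c k = c i := by
    intro c i
    simp only [Finset.mul_sum, ← mul_assoc, ← map_mul]
    rw [Finset.sum_comm]
    simp only [← Finset.sum_mul, ← map_sum]
    have : ∀ k, ∑ a, N' a i * N k a = if k = i then 1 else 0 := by
      intro k
      rw [← Matrix.one_apply, ← h, Matrix.mul_apply]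
      exact Finset.sum_congr rfl fun _ _ => mul_comm _ _
    simp [this]
  have hf4 : pderiv 4 f = 0 := by
    rw [hf, map_sum]
    refine Finset.sum_eq_zero fun i _ => ?_
    rw [pderiv_pow, pderiv_last_coneForm, mul_zero]
  have hfa : ∀ a : Fin 4, pderiv a.castSucc f = ∑ k, C (N k a) * (2 * coneForm (N k)) := by
    intro a
    rw [hf, map_sum]
    refine Finset.sum_congr rfl fun k _ => ?_
    rw [pderiv_pow, pderiv_castSucc_coneForm]
    ring
  have hmin : ∀ a b, minor f g a b ∈ singIdeal f g := fun a b =>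
    Ideal.subset_span (Or.inr ⟨(a, b), rfl⟩)
  have h2 : ∀ q ∈ singIdeal f g, C (2⁻¹ : ℂ) * q ∈ singIdeal f g := fun q hq =>
    Ideal.mul_mem_left _ _ hq
  have h3 : C (2⁻¹ : ℂ) * 2 = (1 : MvPolynomial (Fin 5) ℂ) := by
    rw [show (2 : MvPolynomial (Fin 5) ℂ) = C 2 from (map_ofNat C 2).symm, ← map_mul]
    norm_num
  have e1 : ∀ i, ∑ a, C (N' a i) * pderiv a.castSucc f = 2 * coneForm (N i) := by
    intro i
    simp only [hfa]
    exact hcontr _ i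
  have e2 : ∀ i, ∑ a, C (N' a i) * pderiv a.castSucc g = b i := by
    intro i
    simp only [hb]
    exact hcontr _ i
  constructor
  · have e3 : ∑ a : Fin 4, ∑ c : Fin 4, C (N' a i) * C (N' c j) *
        minor f g a.castSucc c.castSucc =
        2 * coneForm (N i) * b j - 2 * coneForm (N j) * b i := by
      rw [← e1, ← e1, ← e2, ← e2, Finset.sum_mul_sum, Finset.sum_mul_sum,
        Finset.sum_comm (f := fun a c => C (N' a j) * pderiv a.castSucc f *
          (C (N' c i) * pderiv c.castSucc g)), ← Finset.sum_sub_distrib]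
      refine Finset.sum_congr rfl fun a _ => ?_
      rw [← Finset.sum_sub_distrib]
      refine Finset.sum_congr rfl fun c _ => ?_
      rw [minor]
      ring
    have e4 : coneForm (N i) * b j - coneForm (N j) * b i = C (2⁻¹ : ℂ) *
        ∑ a : Fin 4, ∑ c : Fin 4, C (N' a i) * C (N' c j) *
        minor f g a.castSucc c.castSucc := by
      rw [e3]
      linear_combination -(coneForm (N i) * b j - coneForm (N j) * b i) * h3
    rw [e4]
    exact h2 _ (Ideal.sum_mem _ fun a _ => Ideal.sum_mem _ fun c _ =>
      Ideal.mul_mem_left _ _ (hmin _ _))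
  · have e4 : coneForm (N i) * pderiv 4 g = C (2⁻¹ : ℂ) *
        ∑ a : Fin 4, C (N' a i) * minor f g a.castSucc 4 := by
      have : ∑ a : Fin 4, C (N' a i) * minor f g a.castSucc 4 =
          2 * coneForm (N i) * pderiv 4 g := by
        rw [← e1, Finset.sum_mul]
        refine Finset.sum_congr rfl fun a _ => ?_
        rw [minor, hf4]
        ring
      rw [this]
      linear_combination -(coneForm (N i) * pderiv 4 g) * h3
    rw [e4]
    exact h2 _ (Ideal.sum_mem _ fun a _ => Ideal.mul_mem_left _ _ (hmin _ _))

/-- A Nakayama-type iteration: modulo `J`, each factor `W` is traded for one more factor `L`. When a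
power of `L` lies in `J`, a power of `W` therefore carries `L` into `J`. -/
theorem pow_mul_le_sup_pow {A : Type*} [CommRing A] {J W L : Ideal A} (hW : W * L ≤ J ⊔ L ^ 2)
    (k : ℕ) : W ^ k * L ≤ J ⊔ L ^ (k + 1) := by
  induction k with
  | zero => simp
  | succ k ih =>
    have h1 : W ^ (k + 1) * L = W * (W ^ k * L) := by rw [pow_succ', mul_assoc]
    have h2 : W * (J ⊔ L ^ (k + 1)) = W * J ⊔ W * L * L ^ k := by
      rw [Ideal.mul_sup, pow_succ', mul_assoc]
    have h3 : L ^ 2 * L ^ k = L ^ (k + 1 + 1) := by rw [← pow_add, add_comm 2 k]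
    rw [h1]
    refine (Ideal.mul_mono_right ih).trans ?_
    rw [h2]
    refine sup_le (Ideal.mul_le_right.trans le_sup_left) ((Ideal.mul_mono_left hW).trans ?_)
    rw [Ideal.sup_mul, h3]
    exact sup_le (Ideal.mul_le_left.trans le_sup_left) le_sup_right

/-- If `J` contains a power of `(x₀,…,x₃)` and a power of `w` multiplies `(x₀,…,x₃)` into
`J + (x₀,…,x₃)²`, then `J` contains all forms of some degree. -/
theorem exists_forall_mem_of_le_radical {J : Ideal (MvPolynomial (Fin 5) ℂ)} {M : ℕ}
    (hW : ∀ a : Fin 4, X 4 ^ M * X a.castSucc ∈ J ⊔ linIdeal ^ 2)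
    (hJ : linIdeal ≤ J.radical) : ∃ n, 0 < n ∧ ∀ q ∈ wtGrading n, q ∈ J := by
  obtain ⟨K, hK⟩ := Ideal.exists_pow_le_of_le_radical_of_fg_radical hJ
    (IsNoetherian.noetherian _)
  have hW' : Ideal.span {X 4 ^ M} * linIdeal ≤ J ⊔ linIdeal ^ 2 := by
    rw [linIdeal, Ideal.span_mul_span', Ideal.span_le]
    rintro _ ⟨_, rfl, _, ⟨a, rfl⟩, rfl⟩
    exact hW a
  have h1 : ∀ a : Fin 4, X 4 ^ (M * K) * X a.castSucc ∈ J := by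
    intro a
    have h2 : J ⊔ linIdeal ^ (K + 1) ≤ J :=
      sup_le le_rfl ((Ideal.pow_le_pow_right (Nat.le_succ K)).trans hK)
    refine h2 (pow_mul_le_sup_pow hW' K (Ideal.mul_mem_mul ?_ (Ideal.subset_span ⟨a, rfl⟩)))
    rw [pow_mul]
    exact Ideal.pow_mem_pow (Ideal.mem_span_singleton_self _) _
  -- The degree is odd, so every monomial contains some `xₐ`: a pure power of `w` need not lie in
  -- `J`. It is large enough that a monomial with fewer than `K` factors `xᵢ` is divisible by `w^(M
  -- K)`.
  refine ⟨2 * (M * K) + 2 * K + 1, by omega, fun q hq => ?_⟩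
  rw [← sum_weightMonomials hq]
  refine Ideal.sum_mem _ fun m hm => ?_
  have hw := mem_weightMonomials.mp hm
  rw [Finsupp.weight_apply, Finsupp.sum_fintype _ _ (by simp), Fin.sum_univ_castSucc] at hw
  simp only [wt_castSucc, smul_eq_mul, mul_one] at hw
  rw [show wt (Fin.last 4) = 2 from rfl] at hw
  rw [monomial_eq, Finsupp.prod_fintype _ _ (by simp), Fin.prod_univ_castSucc]
  refine Ideal.mul_mem_left _ _ ?_
  by_cases hc : K ≤ ∑ i : Fin 4, m i.castSucc
  · refine Ideal.mul_mem_right _ _ (hK (Ideal.pow_le_pow_right hc ?_))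
    rw [← Finset.prod_pow_eq_pow_sum]
    refine Ideal.prod_mem_prod fun i _ => Ideal.pow_mem_pow ?_ _
    exact Ideal.subset_span ⟨i, rfl⟩
  · obtain ⟨a, -, ha⟩ : ∃ a ∈ Finset.univ, m (Fin.castSucc (n := 4) a) ≠ 0 := by
      apply Finset.exists_ne_zero_of_sum_ne_zero (s := (Finset.univ : Finset (Fin 4)))
      omega
    have h2 : M * K ≤ m (Fin.last 4) := by omega
    have h3 : X 4 ^ (M * K) * X a.castSucc ∣
        (∏ i : Fin 4, X (R := ℂ) (σ := Fin 5) i.castSucc ^ m i.castSucc) *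
          X (Fin.last 4) ^ m (Fin.last 4) := by
      rw [mul_comm (X 4 ^ _)]
      refine mul_dvd_mul ?_ (pow_dvd_pow _ h2)
      exact (dvd_pow_self _ ha).trans (Finset.dvd_prod_of_mem _ (Finset.mem_univ a))
    exact Ideal.mem_of_dvd _ h3 (h1 a)

end Fermat

/-! ### The examples in even and odd degree. -/

section General

open MvPolynomial

variable {N N' : Matrix (Fin 4) (Fin 4) ℂ}

/-- A Fermat form of degree `e + 2` in the linear forms given by the rows of `N`. -/
noncomputable def fermatForm (N : Matrix (Fin 4) (Fin 4) ℂ) (e : ℕ) : MvPolynomial (Fin 5) ℂ :=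
  ∑ i : Fin 4, C ((2 ^ (i : ℕ)) ^ e) * coneForm (N i) ^ (e + 2)

/-- The partial derivatives of `fermatForm` with respect to the linear forms. -/
noncomputable def fermatDeriv (N : Matrix (Fin 4) (Fin 4) ℂ) (e : ℕ) (i : Fin 4) :
    MvPolynomial (Fin 5) ℂ :=
  C (((e : ℂ) + 2) * (2 ^ (i : ℕ)) ^ e) * coneForm (N i) ^ (e + 1)

theorem fermatForm_mem (N : Matrix (Fin 4) (Fin 4) ℂ) (e : ℕ) :
    fermatForm N e ∈ wtGrading (e + 2) := by
  refine Submodule.sum_mem _ fun i _ => ?_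
  rw [← smul_eq_C_mul]
  refine Submodule.smul_mem _ _ ?_
  have := SetLike.pow_mem_graded (e + 2) (coneForm_mem (N i))
  rwa [smul_eq_mul, mul_one] at this

theorem X_last_pow_mem (m : ℕ) : (X 4 : MvPolynomial (Fin 5) ℂ) ^ m ∈ wtGrading (2 * m) := by
  have h : X 4 ∈ wtGrading (wt 4) := isWeightedHomogeneous_X ℂ wt 4
  have := SetLike.pow_mem_graded m h
  rwa [smul_eq_mul, mul_comm] at this

theorem pderiv_castSucc_fermatForm (e : ℕ) (a : Fin 4) :
    pderiv a.castSucc (fermatForm N e) = ∑ i, C (N i a) * fermatDeriv N e i := by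
  rw [fermatForm, map_sum]
  refine Finset.sum_congr rfl fun i _ => ?_
  rw [pderiv_C_mul, pderiv_pow, pderiv_castSucc_coneForm, fermatDeriv, map_mul,
    show e + 2 - 1 = e + 1 from rfl]
  simp only [map_add, map_natCast, map_ofNat, Nat.cast_add, Nat.cast_ofNat]
  ring

theorem pderiv_last_fermatForm (e : ℕ) : pderiv 4 (fermatForm N e) = 0 := by
  rw [fermatForm, map_sum]
  refine Finset.sum_eq_zero fun i _ => ?_
  rw [pderiv_C_mul, pderiv_pow, pderiv_last_coneForm, mul_zero, mul_zero]

theorem fermatForm_mem_linIdeal_sq (e : ℕ) : fermatForm N e ∈ linIdeal ^ 2 :=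
  Ideal.sum_mem _ fun i _ => Ideal.mul_mem_left _ _ (Ideal.pow_le_pow_right (by omega)
    (Ideal.pow_mem_pow (coneForm_mem_linIdeal _) _))

theorem fermatDeriv_mem_linIdeal (e : ℕ) (i : Fin 4) : fermatDeriv N e i ∈ linIdeal :=
  Ideal.mul_mem_left _ _ (Ideal.pow_mem_of_mem _ (coneForm_mem_linIdeal _) _ e.succ_pos)

/-- By the Nullstellensatz the inclusion can be checked at the points of the zero locus of `J`. -/
theorem linIdeal_le_radical {J : Ideal (MvPolynomial (Fin 5) ℂ)} (h' : N' * N = 1)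
    (hJ : ∀ z : Fin 5 → ℂ, (∀ q ∈ J, eval z q = 0) → ∀ i, eval z (coneForm (N i)) = 0) :
    linIdeal ≤ J.radical := by
  refine linIdeal_le_of_forall_coneForm_mem h' fun i => ?_
  rw [← vanishingIdeal_zeroLocus_eq_radical (K := ℂ), mem_vanishingIdeal_iff]
  intro z hz
  have h1 : ∀ q : MvPolynomial (Fin 5) ℂ, aeval z q = eval z q := fun q => by
    rw [← coe_aeval_eq_eval]; rfl
  rw [h1]
  exact hJ z (fun q hq => (h1 q).symm.trans (hz q hq)) i

theorem eval_coneForm_eq_zero {e : ℕ} (he : e ≠ 0) {z : Fin 5 → ℂ}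
    (hs : eval z (∑ i, coneForm (N i) ^ 2) = 0)
    (h : ∀ i j, eval z (coneForm (N i) * fermatDeriv N e j - coneForm (N j) * fermatDeriv N e i) = 0)
    (i : Fin 4) : eval z (coneForm (N i)) = 0 := by
  refine congrFun (eq_zero_of_sum_sq_of_fermat he (fun i => eval z (coneForm (N i))) ?_ ?_) i
  · simpa using hs
  · intro i j
    have h1 := h i j
    simp only [fermatDeriv, map_sub, map_mul, map_pow, eval_C] at h1
    have h2 : (e + 2 : ℂ) ≠ 0 := by exact_mod_cast (by omega : e + 2 ≠ 0)
    apply mul_left_cancel₀ h2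
    linear_combination h1

/-- The even degree example. -/
theorem exists_forall_mem_singIdeal_even {f : MvPolynomial (Fin 5) ℂ} (h : N * N' = 1)
    (h' : N' * N = 1) (hf : f = ∑ i, coneForm (N i) ^ 2) {e : ℕ} (he : e ≠ 0) (m : ℕ) :
    ∃ n, 0 < n ∧ ∀ q ∈ wtGrading n, q ∈ singIdeal f (X 4 ^ (m + 1) + fermatForm N e) := by
  set g := X 4 ^ (m + 1) + fermatForm N e
  have hb : ∀ a : Fin 4, pderiv a.castSucc g = ∑ i, C (N i a) * fermatDeriv N e i := by
    intro a
    rw [map_add, pderiv_castSucc_fermatForm, pderiv_pow, pderiv_X,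
      Pi.single_eq_of_ne (by exact (Fin.castSucc_lt_last a).ne'), mul_zero, zero_add]
  -- Since `f` does not involve `w`, the minors in the columns `ℓᵢ, w` put `wᵐ ℓᵢ` itself into the
  -- singular ideal.
  have h4 : pderiv 4 g = C (m + 1 : ℂ) * X 4 ^ m := by
    rw [map_add, pderiv_last_fermatForm, pderiv_pow, pderiv_X_self]
    simp
  have key := coneForm_mul_sub_mem_singIdeal h hf hb
  refine exists_forall_mem_of_le_radical (M := m) (fun a => Ideal.mem_sup_left ?_)
    (linIdeal_le_radical h' fun z hz => eval_coneForm_eq_zero he (hf ▸ hz _ ?_) fun i j =>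
      hz _ (key i j).1)
  · have h5 : ∀ i, coneForm (N i) * X 4 ^ m ∈ singIdeal f g := by
      intro i
      have h6 := Ideal.mul_mem_left _ (C (m + 1 : ℂ)⁻¹) (key i i).2
      rw [h4] at h6
      convert h6 using 1
      have h7 : C (m + 1 : ℂ)⁻¹ * C (m + 1 : ℂ) = (1 : MvPolynomial (Fin 5) ℂ) := by
        rw [← map_mul, inv_mul_cancel₀ (by exact_mod_cast m.succ_ne_zero), map_one]
      linear_combination -(coneForm (N i) * X 4 ^ m) * h7
    rw [← sum_coneForm h' a, Finset.mul_sum]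
    refine Ideal.sum_mem _ fun i _ => ?_
    rw [mul_left_comm, mul_comm (X 4 ^ m)]
    exact Ideal.mul_mem_left _ _ (h5 i)
  · exact Ideal.subset_span (Or.inl (Or.inl rfl))

/-- The odd degree example. -/
theorem exists_forall_mem_singIdeal_odd {f : MvPolynomial (Fin 5) ℂ} (h : N * N' = 1)
    (h' : N' * N = 1) (hf : f = ∑ i, coneForm (N i) ^ 2) {e : ℕ} (he : e ≠ 0) (m : ℕ) :
    ∃ n, 0 < n ∧ ∀ q ∈ wtGrading n,
      q ∈ singIdeal f (X 4 ^ (m + 2) * coneForm (N 0) + fermatForm N e) := by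
  set g := X 4 ^ (m + 2) * coneForm (N 0) + fermatForm N e
  set b : Fin 4 → MvPolynomial (Fin 5) ℂ := fun i =>
    (if i = 0 then X 4 ^ (m + 2) else 0) + fermatDeriv N e i
  have hb : ∀ a : Fin 4, pderiv a.castSucc g = ∑ i, C (N i a) * b i := by
    intro a
    simp only [b, mul_add, Finset.sum_add_distrib, mul_ite, mul_zero, Finset.sum_ite_eq',
      Finset.mem_univ, if_true]
    rw [map_add, pderiv_castSucc_fermatForm, pderiv_mul, pderiv_pow, pderiv_X,
      Pi.single_eq_of_ne (by exact (Fin.castSucc_lt_last a).ne'), pderiv_castSucc_coneForm]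
    ring
  have h4 : pderiv 4 g = C (m + 2 : ℂ) * X 4 ^ (m + 1) * coneForm (N 0) := by
    rw [map_add, pderiv_last_fermatForm, pderiv_mul, pderiv_pow, pderiv_X_self,
      pderiv_last_coneForm]
    simp [map_ofNat C 2]
  have key := coneForm_mul_sub_mem_singIdeal h hf hb
  have hg : g ∈ singIdeal f g := Ideal.subset_span (Or.inl (Or.inr rfl))
  have hff : f ∈ singIdeal f g := Ideal.subset_span (Or.inl (Or.inl rfl))
  refine exists_forall_mem_of_le_radical (M := m + 2) (fun a => ?_)
    (linIdeal_le_radical h' fun z hz => ?_)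
  -- To first order at the vertex, `g` supplies `w^(m + 2) ℓ₀` and the minor in the columns `ℓᵢ, ℓ₀`
  -- supplies `w^(m + 2) ℓᵢ`; the Fermat contributions are quadratic in the `xₐ`.
  · have h5 : ∀ i, X 4 ^ (m + 2) * coneForm (N i) ∈ singIdeal f g ⊔ linIdeal ^ 2 := by
      intro i
      by_cases hi : i = 0
      · subst hi
        have : X 4 ^ (m + 2) * coneForm (N 0) = g - fermatForm N e := by simp [g]
        rw [this]
        exact sub_mem (Ideal.mem_sup_left hg) (Ideal.mem_sup_right (fermatForm_mem_linIdeal_sq e))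
      · have : X 4 ^ (m + 2) * coneForm (N i) =
            (coneForm (N i) * b 0 - coneForm (N 0) * b i) -
            (coneForm (N i) * fermatDeriv N e 0 - coneForm (N 0) * fermatDeriv N e i) := by
          simp only [b, hi, if_true, if_false]
          ring
        rw [this]
        refine sub_mem (Ideal.mem_sup_left (key i 0).1) (Ideal.mem_sup_right ?_)
        rw [pow_two]
        exact sub_mem (Ideal.mul_mem_mul (coneForm_mem_linIdeal _) (fermatDeriv_mem_linIdeal _ _))
          (Ideal.mul_mem_mul (coneForm_mem_linIdeal _) (fermatDeriv_mem_linIdeal _ _))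
    rw [← sum_coneForm h' a, Finset.mul_sum]
    refine Ideal.sum_mem _ fun i _ => ?_
    rw [mul_left_comm]
    exact Ideal.mul_mem_left _ _ (h5 i)
  -- Where `w = 0` the relations reduce to those of the Fermat form. Where `w ≠ 0`, the derivative
  -- in `w` gives `ℓ₀² = 0`, and then the minor with `ℓ₀` gives `ℓᵢ = 0`.
  · by_cases hw : z 4 = 0
    · refine eval_coneForm_eq_zero he (hf ▸ hz _ hff) fun i j => ?_
      have h5 := hz _ (key i j).1
      have h6 : ∀ i, eval z (b i) = eval z (fermatDeriv N e i) := by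
        intro i
        simp only [b]
        split_ifs <;> simp [hw]
      rw [map_sub, map_mul, map_mul] at h5 ⊢
      rwa [h6, h6] at h5
    · have h0 : eval z (coneForm (N 0)) = 0 := by
        have h5 := hz _ (key 0 0).2
        rw [h4] at h5
        simp only [map_mul, map_pow, eval_C, eval_X] at h5
        have h2 : (m + 2 : ℂ) ≠ 0 := by exact_mod_cast (by omega : m + 2 ≠ 0)
        simpa [hw, h2] using h5
      intro i
      by_cases hi : i = 0
      · rw [hi, h0]
      · have h5 := hz _ (key i 0).1
        simpa [b, h0, fermatDeriv, hw] using h5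

theorem coeff_fermatForm_eq_zero (e : ℕ) {s : Fin 5 →₀ ℕ} (hs : s 4 ≠ 0) :
    coeff s (fermatForm N e) = 0 := by
  have h1 : fermatForm N e = rename Fin.castSucc
      (∑ i : Fin 4, C ((2 ^ (i : ℕ)) ^ e) * linForm (N i) ^ (e + 2)) := by
    simp [fermatForm, coneForm, map_sum]
  rw [h1]
  apply coeff_rename_eq_zero
  intro u hu
  exfalso
  apply hs
  rw [← hu]
  apply Finsupp.mapDomain_of_notMem_range
  rintro ⟨i, hi⟩
  exact (Fin.castSucc_lt_last i).ne hi

/-- A point of the quadric where the Fermat form does not vanish. -/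
theorem exists_eval_fermatForm_ne_zero (h : N * N' = 1) {e : ℕ} (he : e ≠ 0) :
    ∃ x : Fin 5 → ℂ, x 4 = 0 ∧ eval x (∑ i, coneForm (N i) ^ 2) = 0 ∧
      eval x (fermatForm N e) ≠ 0 := by
  -- In the coordinates `ℓᵢ` the point is `(1, i, 0, 0)`: it is isotropic, and the Fermat form takes
  -- the value `1 + 2^e i^(e + 2)`, nonzero because `2^e > 1`.
  set y : Fin 4 → ℂ := ![1, Complex.I, 0, 0]
  set x : Fin 5 → ℂ := Fin.snoc (α := fun _ => ℂ) (N'.mulVec y) 0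
  have hx : ∀ i, eval x (coneForm (N i)) = y i := by
    intro i
    rw [coneForm, eval_rename]
    have : x ∘ Fin.castSucc = N'.mulVec y := by
      funext j
      simp [x]
    rw [this, eval_linForm]
    change (N.mulVec (N'.mulVec y)) i = y i
    rw [Matrix.mulVec_mulVec, h, Matrix.one_mulVec]
  refine ⟨x, Fin.snoc_last (α := fun _ => ℂ) _ _, ?_, ?_⟩
  · simp [hx, Fin.sum_univ_four, y]
  · simp only [fermatForm, map_sum, map_mul, map_pow, hx, eval_C]
    intro h0
    have h1 : (2 : ℂ) ^ e * Complex.I ^ (e + 2) = -1 := by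
      simp [Fin.sum_univ_four, y] at h0
      linear_combination h0
    have h2 := congr(‖$h1‖)
    rw [norm_mul, norm_pow, norm_pow, Complex.norm_I, one_pow, mul_one, norm_neg, norm_one,
      Complex.norm_ofNat] at h2
    have h3 : (1 : ℝ) < 2 ^ e := one_lt_pow₀ (by norm_num) he
    linarith

end General

/-! ### Conditions satisfied by a general member. -/

section GeneralMember

open MvPolynomial

/-- The exponents of a monomial of weighted degree `n + 1` are those of a power of `w`, or some
`xᵢ` divides the monomial. -/
theorem exists_sum_X_mul {n : ℕ} {q : MvPolynomial (Fin 5) ℂ} (hq : q ∈ wtGrading (n + 1)) :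
    ∃ P : Fin 4 → MvPolynomial (Fin 5) ℂ, (∀ i, P i ∈ wtGrading n) ∧
      q = C (coeff (Finsupp.single 4 ((n + 1) / 2)) q) * X 4 ^ ((n + 1) / 2) +
        ∑ i, X i.castSucc * P i := by
  classical
  -- When `n + 1` is odd the rounded exponent does not have weight `n + 1`, and the corresponding
  -- coefficient of `q` is zero.
  set s₀ : Fin 5 →₀ ℕ := Finsupp.single 4 ((n + 1) / 2)
  have h1 : ∀ s : weightMonomials (n + 1), ∃ P : Fin 4 → MvPolynomial (Fin 5) ℂ,
      (∀ i, P i ∈ wtGrading n) ∧ monomial s.1 (coeff s.1 q) =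
        (if s.1 = s₀ then monomial s₀ (coeff s₀ q) else 0) + ∑ i, X i.castSucc * P i := by
    rintro ⟨s, hs⟩
    by_cases h : s = s₀
    · refine ⟨0, fun _ => zero_mem _, ?_⟩
      simp [h]
    have hw := mem_weightMonomials.mp hs
    have hw2 := hw
    rw [Finsupp.weight_apply, Finsupp.sum_fintype _ _ (by simp), Fin.sum_univ_castSucc] at hw2
    simp only [wt_castSucc, smul_eq_mul, mul_one] at hw2
    rw [show wt (Fin.last 4) = 2 from rfl] at hw2
    obtain ⟨a, ha⟩ : ∃ a : Fin 4, s a.castSucc ≠ 0 := by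
      by_contra! h0
      apply h
      rw [Finset.sum_eq_zero fun a _ => h0 a] at hw2
      ext i
      refine Fin.lastCases ?_ (fun i => ?_) i
      · rw [show (Fin.last 4 : Fin 5) = 4 from rfl] at hw2 ⊢
        simp only [s₀, Finsupp.single_eq_same]
        omega
      · rw [h0, Finsupp.single_eq_of_ne (by exact (Fin.castSucc_lt_last i).ne)]
    have hle : Finsupp.single a.castSucc 1 ≤ s := by
      rw [Finsupp.single_le_iff]
      omega
    refine ⟨Pi.single a (monomial (s - Finsupp.single a.castSucc 1) (coeff s q)), fun i => ?_, ?_⟩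
    · by_cases hi : i = a
      · subst hi
        rw [Pi.single_eq_same]
        refine monomial_mem_of_weight_eq ?_ _
        have h2 := congr(Finsupp.weight wt $(add_tsub_cancel_of_le hle))
        rw [map_add, hw, Finsupp.weight_single, wt_castSucc, one_smul] at h2
        omega
      · rw [Pi.single_eq_of_ne hi]
        exact zero_mem _
    · rw [if_neg h, zero_add, Finset.sum_eq_single a]
      · rw [Pi.single_eq_same, X, monomial_mul, one_mul, add_tsub_cancel_of_le hle]
      · intro b _ hb
        rw [Pi.single_eq_of_ne hb, mul_zero]
      · simp
  choose P hP hPs using h1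
  refine ⟨fun i => ∑ s, P s i, fun i => Submodule.sum_mem _ fun s _ => hP s i, ?_⟩
  conv_lhs => rw [← sum_weightMonomials hq, ← Finset.sum_coe_sort]
  rw [Finset.sum_congr rfl fun s _ => hPs s, Finset.sum_add_distrib]
  congr 1
  · rw [Finset.sum_coe_sort (weightMonomials (n + 1))
      (fun s => if s = s₀ then monomial s₀ (coeff s₀ q) else 0), Finset.sum_ite_eq',
      X_pow_eq_monomial, C_mul_monomial, mul_one]
    split_ifs with h
    · rfl
    · rw [mem_weightMonomials] at h
      have : coeff s₀ q = 0 := by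
        by_contra h3
        exact h (hq h3)
      rw [this, map_zero]
  · rw [Finset.sum_comm]
    exact Finset.sum_congr rfl fun i _ => (Finset.mul_sum ..).symm

/-- The conditions on the singular locus and on flatness satisfied by a general member. -/
def IsAdmissible (σ : stdGrading 2) {d : ℕ} (p : wtGrading d) : Prop :=
  NonvanishingOnQuadric σ p ∧ ∀ i : Fin 4, ∃ n, X i.castSucc ^ n ∈
    singIdeal (coneEq σ : MvPolynomial (Fin 5) ℂ) p

theorem X_castSucc_pow_mem (i : Fin 4) (n : ℕ) :
    (X i.castSucc : MvPolynomial (Fin 5) ℂ) ^ n ∈ wtGrading n := by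
  have := (isWeightedHomogeneous_X ℂ wt i.castSucc).pow n
  rwa [smul_eq_mul, wt_castSucc, mul_one] at this

/-- Admissibility is an open condition, which holds at a suitable `p₀`. -/
theorem forGeneral_isAdmissible (σ : stdGrading 2) {d n : ℕ} (p₀ : wtGrading d)
    (h₀ : ∀ q ∈ wtGrading n, q ∈ singIdeal (coneEq σ : MvPolynomial (Fin 5) ℂ) p₀)
    (hp₀ : NonvanishingOnQuadric σ p₀) (P : wtGrading d → Prop)
    (hP : ∃ F : MvPolynomial (Fin 5 →₀ ℕ) ℂ,
      eval (fun m => coeff m (p₀ : MvPolynomial (Fin 5) ℂ)) F ≠ 0 ∧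
      ∀ p : wtGrading d, eval (fun m => coeff m (p : MvPolynomial (Fin 5) ℂ)) F ≠ 0 → P p) :
    ForGeneral d fun p => IsAdmissible σ p ∧ P p := by
  obtain ⟨F₁, hF₁, h₁⟩ := exists_eval_ne_zero_of_forall_mem_singIdeal (coneEq σ) p₀ h₀
  obtain ⟨x, hx4, hx0, hx⟩ := hp₀
  obtain ⟨F₂, h₂⟩ := exists_eval_coeff_eq d 0 (aeval x : MvPolynomial (Fin 5) ℂ →ₐ[ℂ] ℂ).toLinearMap
  have h₂' : ∀ p : wtGrading d, eval (fun m => coeff m (p : MvPolynomial (Fin 5) ℂ)) F₂ =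
      eval x (p : MvPolynomial (Fin 5) ℂ) := by
    intro p
    rw [h₂, zero_add, ← coe_aeval_eq_eval]
    rfl
  obtain ⟨F₃, hF₃, h₃⟩ := hP
  -- The product defines the intersection of the three open conditions, which is nonempty because
  -- all of them hold at `p₀`.
  refine ⟨F₁ * F₂ * F₃, ⟨p₀, ?_⟩, fun p hp => ?_⟩
  · rw [map_mul, map_mul, h₂']
    exact mul_ne_zero (mul_ne_zero hF₁ hx) hF₃
  · rw [map_mul, map_mul, h₂'] at hp
    have hp3 := right_ne_zero_of_mul hp
    have hp12 := left_ne_zero_of_mul hp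
    exact ⟨⟨⟨x, hx4, hx0, right_ne_zero_of_mul hp12⟩, fun i =>
      ⟨n, h₁ p (left_ne_zero_of_mul hp12) _ (X_castSucc_pow_mem i n)⟩⟩, h₃ p hp3⟩

/-- The extra condition, a nonzero coefficient at the pure power of `w`, is what keeps `B` away from
the vertex. -/
theorem forGeneral_even (σ : stdGrading 2) (hσ : IsSmoothQuadric σ) (m : ℕ) :
    ForGeneral (2 * m + 2 + 2) fun p => IsAdmissible σ p ∧
      coeff (Finsupp.single 4 (m + 2)) (p : MvPolynomial (Fin 5) ℂ) ≠ 0 := by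
  obtain ⟨N, N', h, h', hN⟩ := exists_sum_sq σ hσ
  obtain ⟨n, -, hn⟩ := exists_forall_mem_singIdeal_even h h' (coneEq_eq_sum hN)
    (e := 2 * m + 2) (by omega) (m + 1)
  obtain ⟨x, hx4, hx0, hx⟩ := exists_eval_fermatForm_ne_zero h (e := 2 * m + 2) (by omega)
  refine forGeneral_isAdmissible σ
    ⟨X 4 ^ (m + 2) + fermatForm N (2 * m + 2), add_mem (X_last_pow_mem (m + 2)) (fermatForm_mem _ _)⟩
    hn ⟨x, hx4, by rw [coneEq_eq_sum hN]; exact hx0, by simpa [hx4] using hx⟩ _ ?_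
  refine ⟨X (Finsupp.single 4 (m + 2)), ?_, fun p hp => by simpa using hp⟩
  rw [eval_X, coeff_add, coeff_fermatForm_eq_zero _ (by simp), coeff_X_pow, if_pos rfl]
  simp

/-- The extra condition concerns the linear form multiplying `w^(m + 2)` in `p`, written in the
coordinates `ℓᵢ`: it is anisotropic, that is, its plane is not tangent to the quadric. For the
example the form is `ℓ₀`. -/
theorem forGeneral_odd (σ : stdGrading 2) {N N' : Matrix (Fin 4) (Fin 4) ℂ} (h : N * N' = 1)
    (h' : N' * N = 1) (hN : (σ : MvPolynomial (Fin 4) ℂ) = ∑ i, linForm (N i) ^ 2) (m : ℕ) :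
    ForGeneral (2 * m + 3 + 2) fun p => IsAdmissible σ p ∧
      ∑ i, (∑ j : Fin 4, coeff (Finsupp.single 4 (m + 2) + Finsupp.single j.castSucc 1)
        (p : MvPolynomial (Fin 5) ℂ) * N' j i) ^ 2 ≠ 0 := by
  obtain ⟨n, -, hn⟩ := exists_forall_mem_singIdeal_odd h h' (coneEq_eq_sum hN)
    (e := 2 * m + 3) (by omega) m
  obtain ⟨x, hx4, hx0, hx⟩ := exists_eval_fermatForm_ne_zero h (e := 2 * m + 3) (by omega)
  refine forGeneral_isAdmissible σ
    ⟨X 4 ^ (m + 2) * coneForm (N 0) + fermatForm N (2 * m + 3),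
      add_mem (SetLike.mul_mem_graded (X_last_pow_mem (m + 2)) (coneForm_mem _))
      (fermatForm_mem _ _)⟩
    hn ⟨x, hx4, by rw [coneEq_eq_sum hN]; exact hx0, by simpa [hx4] using hx⟩ _ ?_
  refine ⟨∑ i, (∑ j : Fin 4, X (Finsupp.single 4 (m + 2) + Finsupp.single j.castSucc 1) *
    C (N' j i)) ^ 2, ?_, fun p hp => by simpa using hp⟩
  have h1 : ∀ j : Fin 4, coeff (Finsupp.single 4 (m + 2) + Finsupp.single j.castSucc 1)
      (X 4 ^ (m + 2) * coneForm (N 0) + fermatForm N (2 * m + 3)) = N 0 j := by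
    intro j
    rw [coeff_add, coeff_fermatForm_eq_zero _ (by simp), add_zero, X_pow_eq_monomial,
      coeff_monomial_mul, one_mul, coneForm_eq_sum, coeff_sum]
    simp only [coeff_C_mul, coeff_X, Finsupp.single_left_inj one_ne_zero, Fin.castSucc_inj]
    simp
  simp only [map_sum, map_pow, map_mul, eval_X, eval_C, h1]
  have h2 : ∀ i, ∑ j, N 0 j * N' j i = if 0 = i then 1 else 0 := by
    intro i
    rw [← Matrix.mul_apply, h, Matrix.one_apply]
  simp [h2]

/-- For even `d` a general member is smooth. -/
theorem smooth_even {σ : stdGrading 2} {m d : ℕ} (hd : d = 2 * m + 2) {p : wtGrading d}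
    (hp : IsAdmissible σ p) (hc : coeff (Finsupp.single 4 (m + 1)) (p : MvPolynomial (Fin 5) ℂ) ≠ 0) :
    SmoothOfRelativeDimension 2 (surfB.str σ p) := by
  subst hd
  have h1 := smooth_of_forall_exists_pow_mem (coneEq σ) p hp.2 (𝟙 _) ?_
  · rwa [Category.id_comp] at h1
  intro y
  by_contra! hy
  obtain ⟨i, hi⟩ := exists_mem_basicOpen_xq (span₂ wtGrading (coneEq σ) p) y
  have hy' : ∀ i : Fin 4, xq (span₂ wtGrading (coneEq σ) p) i.castSucc ∈
      (y : ProjectiveSpectrum _).asHomogeneousIdeal := fun i => not_not.mp (hy i)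
  have hprime : (y : ProjectiveSpectrum (quotientGrading wtGrading
    (span₂ wtGrading (coneEq σ) p))).asHomogeneousIdeal.toIdeal.IsPrime := ProjectiveSpectrum.isPrime y
  refine hi ?_
  refine Fin.lastCases ?_ (fun i => hy' i) i
  -- At a point where all `xᵢ` vanish, `p = 0` reduces to a nonzero multiple of a power of `w`, so
  -- `w` would vanish too.
  obtain ⟨P, -, hP⟩ := exists_sum_X_mul p.2
  rw [show (2 * m + 1 + 1) / 2 = m + 1 by omega] at hP
  set π := Ideal.Quotient.mk (span₂ wtGrading (coneEq σ) p).toIdeal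
  set 𝔭 := (y : ProjectiveSpectrum (quotientGrading wtGrading
    (span₂ wtGrading (coneEq σ) p))).asHomogeneousIdeal.toIdeal
  have h2 : π (p : MvPolynomial (Fin 5) ℂ) = 0 :=
    Ideal.Quotient.eq_zero_iff_mem.mpr (Ideal.subset_span (Or.inr rfl))
  rw [hP, map_add, map_sum, map_mul, map_pow] at h2
  have h3 : π (C (coeff (Finsupp.single 4 (m + 1)) (p : MvPolynomial (Fin 5) ℂ))) *
      π (X 4) ^ (m + 1) ∈ 𝔭 := by
    rw [eq_neg_of_add_eq_zero_left h2]
    refine neg_mem (Ideal.sum_mem _ fun i _ => ?_)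
    rw [map_mul]
    exact Ideal.mul_mem_right _ _ (hy' i)
  refine hprime.mem_of_pow_mem (m + 1) ((hprime.mem_or_mem h3).resolve_left fun h4 => ?_)
  refine hprime.ne_top (Ideal.eq_top_of_isUnit_mem _ h4 ?_)
  exact ((isUnit_iff_ne_zero.mpr hc).map C).map π

end GeneralMember

/-! ### Completions and power series. -/

section Completion

/-- If the filtration of `D` by the ideals `n k` is separated and complete, and `Φ : R → D` has dense
image and pulls `n k` back to `I ^ k`, then `D` is the `I`-adic completion of `R`. -/
theorem nonempty_adicCompletion_algEquiv {k R D : Type*} [CommRing k] [CommRing R] [CommRing D]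
    [Algebra k R] [Algebra k D] (I : Ideal R) (Φ : R →ₐ[k] D) (n : ℕ → Ideal D) (hn : Antitone n)
    (hcomap : ∀ k r, Φ r ∈ n k ↔ r ∈ I ^ k) (hdense : ∀ k f, ∃ r, f - Φ r ∈ n k)
    (hsep : ∀ f, (∀ k, f ∈ n k) → f = 0)
    (hcomplete : ∀ s : ℕ → D, (∀ k, s (k + 1) - s k ∈ n k) → ∃ f, ∀ k, f - s k ∈ n k) :
    Nonempty (AdicCompletion I R ≃ₐ[k] D) := by
  have hle : ∀ m, I ^ m ≤ (n m).comap Φ := fun m r hr => (hcomap m r).mpr hr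
  -- The hypotheses on `Φ` amount to isomorphisms `R ⧸ I^m ≃ D ⧸ n m`; the completion is the limit
  -- of the left sides, and separatedness and completeness identify `D` with the limit of the right
  -- sides.
  have hbij : ∀ m, Function.Bijective (Ideal.quotientMapₐ (n m) Φ (hle m)) := by
    intro m
    constructor
    · rw [injective_iff_map_eq_zero]
      intro x hx
      obtain ⟨r, rfl⟩ := Ideal.Quotient.mk_surjective x
      rw [Ideal.Quotient.eq_zero_iff_mem]
      exact (hcomap m r).mp (Ideal.Quotient.eq_zero_iff_mem.mp hx)
    · intro y
      obtain ⟨f, rfl⟩ := Ideal.Quotient.mk_surjective y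
      obtain ⟨r, hr⟩ := hdense m f
      exact ⟨Ideal.Quotient.mk _ r, ((Ideal.Quotient.mk_eq_mk_iff_sub_mem _ _).mpr hr).symm⟩
  let e : ∀ m, (R ⧸ I ^ m) ≃ₐ[k] D ⧸ n m := fun m => AlgEquiv.ofBijective _ (hbij m)
  let g : ∀ m, D →ₐ[k] R ⧸ I ^ m := fun m =>
    ((e m).symm : (D ⧸ n m) →ₐ[k] R ⧸ I ^ m).comp (Ideal.Quotient.mkₐ k (n m))
  have hg : ∀ m f r, f - Φ r ∈ n m → g m f = Ideal.Quotient.mk _ r := by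
    intro m f r h
    change (e m).symm (Ideal.Quotient.mk _ f) = _
    rw [AlgEquiv.symm_apply_eq]
    exact (Ideal.Quotient.mk_eq_mk_iff_sub_mem _ _).mpr h
  have hcompat : ∀ {m l : ℕ} (hle : m ≤ l),
      (Ideal.Quotient.factorₐ k (Ideal.pow_le_pow_right hle)).comp (g l) = g m := by
    intro m l hml
    ext f
    obtain ⟨r, hr⟩ := hdense l f
    rw [AlgHom.comp_apply, hg l f r hr, hg m f r (hn hml hr)]
    rfl
  let G := AdicCompletion.liftAlgHom I g hcompat
  have hG : ∀ m f, AdicCompletion.evalₐ I m (G f) = g m f :=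
    fun m f => AdicCompletion.evalₐ_liftAlgHom I g hcompat m f
  refine ⟨(AlgEquiv.ofBijective G ⟨?_, fun x => ?_⟩).symm⟩
  · rw [injective_iff_map_eq_zero]
    intro f hf
    refine hsep f fun m => ?_
    obtain ⟨r, hr⟩ := hdense m f
    have h1 := hG m f
    rw [hf, map_zero, hg m f r hr, eq_comm, Ideal.Quotient.eq_zero_iff_mem, ← hcomap] at h1
    simpa using add_mem hr h1
  · obtain ⟨r, rfl⟩ := AdicCompletion.mk_surjective I R x
    have h1 : ∀ m, r (m + 1) - r m ∈ I ^ m := by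
      intro m
      have h2 := (SModEq.sub_mem.mp (r.2 (Nat.le_succ m)).symm)
      rwa [smul_eq_mul, Ideal.mul_top] at h2
    obtain ⟨f, hf⟩ := hcomplete (fun m => Φ (r m)) fun m => by
      rw [← map_sub]
      exact (hcomap _ _).mpr (h1 m)
    refine ⟨f, AdicCompletion.ext_evalₐ fun m => ?_⟩
    rw [hG, hg m f (r m) (hf m), AdicCompletion.evalₐ_mk]

end Completion

section PowerSeries

open MvPowerSeries

variable {ι : Type*}

/-- The power series of order at least `n`. -/
noncomputable def orderIdeal (ι : Type*) (n : ℕ) : Ideal (MvPowerSeries ι ℂ) where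
  carrier := {f | (n : ℕ∞) ≤ f.order}
  add_mem' := fun ha hb => (le_min ha hb).trans min_order_le_add
  zero_mem' := by simp
  smul_mem' := fun c f hf => by
    rw [smul_eq_mul]
    exact (le_add_of_nonneg_of_le zero_le hf).trans le_order_mul

theorem mem_orderIdeal {n : ℕ} {f : MvPowerSeries ι ℂ} :
    f ∈ orderIdeal ι n ↔ ∀ s : ι →₀ ℕ, s.degree < n → coeff s f = 0 :=
  ⟨fun h _ hs => coeff_of_lt_order (lt_of_lt_of_le (by exact_mod_cast hs) h), nat_le_order⟩

theorem orderIdeal_antitone : Antitone (orderIdeal ι) := fun _ _ h _ hf =>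
  mem_orderIdeal.mpr fun s hs => mem_orderIdeal.mp hf s (hs.trans_le h)

theorem mul_mem_orderIdeal {m n : ℕ} {f g : MvPowerSeries ι ℂ} (hf : f ∈ orderIdeal ι m)
    (hg : g ∈ orderIdeal ι n) : f * g ∈ orderIdeal ι (m + n) := by
  have h : (m : ℕ∞) + n ≤ f.order + g.order := add_le_add hf hg
  have h2 := h.trans le_order_mul
  exact_mod_cast h2

theorem mem_orderIdeal_zero (f : MvPowerSeries ι ℂ) : f ∈ orderIdeal ι 0 :=
  mem_orderIdeal.mpr fun _ h => absurd h (Nat.not_lt_zero _)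

theorem X_mem_orderIdeal (i : ι) : (X i : MvPowerSeries ι ℂ) ∈ orderIdeal ι 1 := by
  classical
  rw [mem_orderIdeal]
  intro s hs
  rw [coeff_X, if_neg]
  rintro rfl
  simp at hs

theorem eq_zero_of_forall_mem_orderIdeal {f : MvPowerSeries ι ℂ} (h : ∀ n, f ∈ orderIdeal ι n) :
    f = 0 := by
  ext s
  exact mem_orderIdeal.mp (h (s.degree + 1)) s (Nat.lt_succ_self _)

theorem exists_sub_mem_orderIdeal (s : ℕ → MvPowerSeries ι ℂ) {c : ℕ → ℕ} (hc : Monotone c)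
    (hc' : ∀ k, k ≤ c k) (hs : ∀ k, s (k + 1) - s k ∈ orderIdeal ι (c k)) :
    ∃ f, ∀ k, f - s k ∈ orderIdeal ι (c k) := by
  have h1 : ∀ k l, k ≤ l → s l - s k ∈ orderIdeal ι (c k) := by
    intro k l hkl
    induction l, hkl using Nat.le_induction with
    | base => simp
    | succ l hkl ih =>
      have := add_mem (orderIdeal_antitone (hc hkl) (hs l)) ih
      simpa using this
  -- The coefficient at `t` no longer changes from the index `|t| + 1` on, because `c k ≥ k`.
  let f : MvPowerSeries ι ℂ := fun t => coeff t (s (t.degree + 1))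
  have hf : ∀ t, coeff t f = coeff t (s (t.degree + 1)) := fun t => rfl
  refine ⟨f, fun k => mem_orderIdeal.mpr fun t ht => ?_⟩
  rw [map_sub, sub_eq_zero, hf]
  rcases le_total (t.degree + 1) k with h | h
  · have h2 := mem_orderIdeal.mp (h1 _ k h) t (hc' _)
    rw [map_sub, sub_eq_zero] at h2
    exact h2.symm
  · have h2 := mem_orderIdeal.mp (h1 k _ h) t ht
    rwa [map_sub, sub_eq_zero] at h2

/-- A contraction of a finite power of the power series ring has a unique fixed point. -/
theorem existsUnique_fixedPoint {κ : Type*} (T : (κ → MvPowerSeries ι ℂ) → κ → MvPowerSeries ι ℂ)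
    (hT : ∀ n a b, (∀ i, a i - b i ∈ orderIdeal ι n) → ∀ i, T a i - T b i ∈ orderIdeal ι (n + 1)) :
    ∃! a, T a = a := by
  let s : ℕ → κ → MvPowerSeries ι ℂ := fun n => T^[n] 0
  have hs : ∀ n, s (n + 1) = T (s n) := fun n => Function.iterate_succ_apply' T n 0
  have h1 : ∀ n i, s (n + 1) i - s n i ∈ orderIdeal ι n := by
    intro n
    induction n with
    | zero => exact fun i => mem_orderIdeal_zero _
    | succ n ih =>
      intro i
      rw [hs (n + 1), hs n]
      exact hT n _ _ (by rw [← hs n]; exact ih) i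
  choose a ha using fun i => exists_sub_mem_orderIdeal (fun n => s n i) monotone_id
    (fun _ => le_rfl) fun n => h1 n i
  have haT : T a = a := by
    funext i
    rw [← sub_eq_zero]
    refine eq_zero_of_forall_mem_orderIdeal fun n => ?_
    have h2 := hT n a (s n) (fun j => ha j n) i
    have h3 := ha i (n + 1)
    simp only [hs n] at h3
    have := sub_mem h2 h3
    exact orderIdeal_antitone (Nat.le_succ n) (by simpa using this)
  refine ⟨a, haT, fun b hb => ?_⟩
  · have h2 : ∀ n i, b i - a i ∈ orderIdeal ι n := by
      intro n
      induction n with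
      | zero => exact fun i => mem_orderIdeal_zero _
      | succ n ih =>
        intro i
        have h3 := hT n b a ih i
        rwa [hb, haT] at h3
    funext i
    exact sub_eq_zero.mp (eq_zero_of_forall_mem_orderIdeal fun n => h2 n i)

end PowerSeries

/-! ### Power series parametrization at the vertex. -/

section Parametrization

open MvPowerSeries

theorem rescale_smul {ι : Type*} (a : ι → ℂ) (c : ℂ) (f : MvPowerSeries ι ℂ) :
    rescale a (c • f) = c • rescale a f := by
  ext s
  simp only [coeff_rescale, map_smul, smul_eq_mul]
  ring

theorem rescale_const_X {ι : Type*} (ζ : ℂ) (i : ι) :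
    rescale (fun _ => ζ) (X i : MvPowerSeries ι ℂ) = ζ • X i := by
  classical
  ext s
  rw [coeff_rescale, map_smul, coeff_X, smul_eq_mul]
  split_ifs with h
  · subst h
    simp
  · simp

/-- The coordinates `(X, Z, Y, W) = (u c, v d, u d, v c)` of a point of the cone `X Z = Y W`. -/
noncomputable def segrePoint (a : Fin 2 → MvPowerSeries (Fin 2) ℂ) :
    Fin 4 → MvPowerSeries (Fin 2) ℂ :=
  ![X 0 * a 0, X 1 * a 1, X 0 * a 1, X 1 * a 0]

/-- The evaluation at the point with `w = 1` and with coordinates `segrePoint a` in the linear forms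
given by a matrix with inverse `M'`. -/
noncomputable def segreEval (M' : Matrix (Fin 4) (Fin 4) ℂ) (a : Fin 2 → MvPowerSeries (Fin 2) ℂ) :
    MvPolynomial (Fin 5) ℂ →ₐ[ℂ] MvPowerSeries (Fin 2) ℂ :=
  MvPolynomial.aeval (Fin.snoc (α := fun _ => MvPowerSeries (Fin 2) ℂ)
    (fun i => ∑ k, M' i k • segrePoint a k) 1)

variable {M M' : Matrix (Fin 4) (Fin 4) ℂ} (a b : Fin 2 → MvPowerSeries (Fin 2) ℂ)

theorem segreEval_X_castSucc (i : Fin 4) :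
    segreEval M' a (MvPolynomial.X i.castSucc) = ∑ k, M' i k • segrePoint a k := by
  rw [segreEval, MvPolynomial.aeval_X, Fin.snoc_castSucc]

theorem segreEval_X_last : segreEval M' a (MvPolynomial.X 4) = 1 := by
  rw [segreEval, MvPolynomial.aeval_X]
  exact Fin.snoc_last (α := fun _ => MvPowerSeries (Fin 2) ℂ) _ _

theorem segreEval_coneForm (h : M * M' = 1) (k : Fin 4) :
    segreEval M' a (coneForm (M k)) = segrePoint a k := by
  have h1 : ∀ j, segreEval M' a (MvPolynomial.C (M k j) * MvPolynomial.X j.castSucc) =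
      ∑ l, (M k j * M' j l) • segrePoint a l := by
    intro j
    rw [← MvPolynomial.smul_eq_C_mul, map_smul, segreEval_X_castSucc, Finset.smul_sum]
    exact Finset.sum_congr rfl fun l _ => smul_smul _ _ _
  rw [coneForm_eq_sum, map_sum, Finset.sum_congr rfl fun j _ => h1 j, Finset.sum_comm]
  simp only [← Finset.sum_smul, ← Matrix.mul_apply, h, Matrix.one_apply, ite_smul, one_smul,
    zero_smul, Finset.sum_ite_eq, Finset.mem_univ, if_true]

theorem smul_mem_orderIdeal {n : ℕ} (c : ℂ) {f : MvPowerSeries (Fin 2) ℂ}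
    (hf : f ∈ orderIdeal (Fin 2) n) : c • f ∈ orderIdeal (Fin 2) n :=
  Submodule.smul_of_tower_mem _ c hf

theorem segrePoint_mem {n : ℕ} (ha : ∀ i, a i ∈ orderIdeal (Fin 2) n) (k : Fin 4) :
    segrePoint a k ∈ orderIdeal (Fin 2) (n + 1) := by
  rw [add_comm n 1]
  fin_cases k
  · exact mul_mem_orderIdeal (X_mem_orderIdeal 0) (ha 0)
  · exact mul_mem_orderIdeal (X_mem_orderIdeal 1) (ha 1)
  · exact mul_mem_orderIdeal (X_mem_orderIdeal 0) (ha 1)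
  · exact mul_mem_orderIdeal (X_mem_orderIdeal 1) (ha 0)

theorem segrePoint_sub (k : Fin 4) : segrePoint a k - segrePoint b k = segrePoint (a - b) k := by
  fin_cases k <;> simp [segrePoint, mul_sub]

theorem segreEval_X_castSucc_mem {n : ℕ} (ha : ∀ i, a i ∈ orderIdeal (Fin 2) n) (i : Fin 4) :
    segreEval M' a (MvPolynomial.X i.castSucc) ∈ orderIdeal (Fin 2) (n + 1) := by
  rw [segreEval_X_castSucc]
  exact Submodule.sum_mem _ fun k _ => smul_mem_orderIdeal _ (segrePoint_mem a ha k)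

theorem segreEval_mem_of_mem_linIdeal {n : ℕ} (ha : ∀ i, a i ∈ orderIdeal (Fin 2) n)
    {q : MvPolynomial (Fin 5) ℂ} (hq : q ∈ linIdeal) :
    segreEval M' a q ∈ orderIdeal (Fin 2) (n + 1) := by
  have h : linIdeal ≤ (orderIdeal (Fin 2) (n + 1)).comap (segreEval M' a) := by
    rw [linIdeal, Ideal.span_le]
    rintro _ ⟨i, rfl⟩
    exact segreEval_X_castSucc_mem a ha i
  exact h hq

/-- The coordinates of `segrePoint` are linear in `a` with coefficients `u`, `v`, which gains one
order on each variable and hence on every polynomial. -/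
theorem segreEval_sub_mem {n : ℕ} (hab : ∀ i, a i - b i ∈ orderIdeal (Fin 2) n)
    (q : MvPolynomial (Fin 5) ℂ) :
    segreEval M' a q - segreEval M' b q ∈ orderIdeal (Fin 2) (n + 1) := by
  rw [← Ideal.Quotient.mk_eq_mk_iff_sub_mem]
  have h : (Ideal.Quotient.mkₐ ℂ (orderIdeal (Fin 2) (n + 1))).comp (segreEval M' a) =
      (Ideal.Quotient.mkₐ ℂ (orderIdeal (Fin 2) (n + 1))).comp (segreEval M' b) := by
    refine MvPolynomial.algHom_ext fun i => ?_
    refine (Ideal.Quotient.mk_eq_mk_iff_sub_mem _ _).mpr ?_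
    refine Fin.lastCases ?_ (fun i => ?_) i
    · change segreEval M' a (MvPolynomial.X 4) - segreEval M' b (MvPolynomial.X 4) ∈ _
      rw [segreEval_X_last, segreEval_X_last, sub_self]
      exact zero_mem _
    · change segreEval M' a (MvPolynomial.X i.castSucc) -
        segreEval M' b (MvPolynomial.X i.castSucc) ∈ _
      rw [segreEval_X_castSucc, segreEval_X_castSucc, ← Finset.sum_sub_distrib]
      refine Submodule.sum_mem _ fun k _ => ?_
      rw [← smul_sub, segrePoint_sub]
      exact smul_mem_orderIdeal _ (segrePoint_mem _ hab k)
  exact congr($h q)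

/-- The series `c, d` for which `segrePoint` solves `W - Y + ∑ ℓₖ Qₖ = 0` are the fixed points of
this map. -/
noncomputable def segreStep (M' : Matrix (Fin 4) (Fin 4) ℂ) (Q : Fin 4 → MvPolynomial (Fin 5) ℂ)
    (a : Fin 2 → MvPowerSeries (Fin 2) ℂ) : Fin 2 → MvPowerSeries (Fin 2) ℂ :=
  ![X 0 - (a 1 * segreEval M' a (Q 1) + a 0 * segreEval M' a (Q 3)),
    X 1 + (a 0 * segreEval M' a (Q 0) + a 1 * segreEval M' a (Q 2))]

/-- The contraction property: each `Qₖ` lies in the ideal of the vertex, so its value has order at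
least one and depends on `a` with a gain of one order. -/
theorem segreStep_sub_mem {Q : Fin 4 → MvPolynomial (Fin 5) ℂ} (hQ : ∀ k, Q k ∈ linIdeal)
    {n : ℕ} (hab : ∀ i, a i - b i ∈ orderIdeal (Fin 2) n) (i : Fin 2) :
    segreStep M' Q a i - segreStep M' Q b i ∈ orderIdeal (Fin 2) (n + 1) := by
  have h1 : ∀ i k, a i * segreEval M' a (Q k) - b i * segreEval M' b (Q k) ∈
      orderIdeal (Fin 2) (n + 1) := by
    intro i k
    have : a i * segreEval M' a (Q k) - b i * segreEval M' b (Q k) =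
        (a i - b i) * segreEval M' a (Q k) +
          b i * (segreEval M' a (Q k) - segreEval M' b (Q k)) := by ring
    rw [this]
    exact add_mem (mul_mem_orderIdeal (hab i) (segreEval_mem_of_mem_linIdeal a
      (fun _ => mem_orderIdeal_zero _) (hQ k))) (Ideal.mul_mem_left _ _ (segreEval_sub_mem a b hab _))
  fin_cases i
  · have := neg_mem (add_mem (h1 1 1) (h1 0 3))
    convert this using 1
    simp only [segreStep, Fin.zero_eta, Matrix.cons_val_zero]
    ring
  · have := add_mem (h1 0 0) (h1 1 2)
    convert this using 1
    simp only [segreStep, Fin.mk_one, Matrix.cons_val_one, Matrix.cons_val_zero]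
    ring

/-- Multiplying `u, v` and the series by `ζ` multiplies the `xᵢ` by `ζ²` and agrees with weight two
on `w = 1` since `ζ⁴ = 1`. A form of weight `2 n` is thus multiplied by `ζ^(4 n) = 1`. -/
theorem rescale_segreEval {ζ : ℂ} (hζ : ζ ^ 4 = 1) {n : ℕ} {q : MvPolynomial (Fin 5) ℂ}
    (hq : q ∈ wtGrading (2 * n)) {a b : Fin 2 → MvPowerSeries (Fin 2) ℂ}
    (hab : ∀ i, rescale (fun _ => ζ) (a i) = ζ • b i) :
    rescale (fun _ => ζ) (segreEval M' a q) = segreEval M' b q := by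
  have hz : ∀ k, rescale (fun _ => ζ) (segrePoint a k) = (ζ ^ 2) • segrePoint b k := by
    intro k
    fin_cases k <;> simp [segrePoint, hab, rescale_const_X, smul_smul, pow_two]
  have h1 : ∀ c : ℂ, rescale (fun _ : Fin 2 => ζ) (algebraMap ℂ _ c) = algebraMap ℂ _ c := by
    intro c
    rw [Algebra.algebraMap_eq_smul_one, rescale_smul, map_one]
  have h2 := map_mul_pow_of_isWeightedHomogeneous (w := wt)
    (segreEval M' b : MvPolynomial (Fin 5) ℂ →+* MvPowerSeries (Fin 2) ℂ)
    ((rescale (fun _ => ζ)).comp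
      (segreEval M' a : MvPolynomial (Fin 5) ℂ →+* MvPowerSeries (Fin 2) ℂ))
    (algebraMap ℂ _ (ζ ^ 2)) ?_ ?_ hq
  · rw [pow_mul, ← map_pow, ← pow_mul, hζ, map_one, one_pow, mul_one] at h2
    exact h2.symm
  · intro r
    change segreEval M' b (algebraMap ℂ _ r) =
      rescale (fun _ => ζ) (segreEval M' a (algebraMap ℂ _ r))
    rw [AlgHom.commutes, AlgHom.commutes, h1]
  · intro i
    refine Fin.lastCases ?_ (fun i => ?_) i
    · change segreEval M' b (MvPolynomial.X 4) * algebraMap ℂ _ (ζ ^ 2) ^ 2 =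
        rescale (fun _ => ζ) (segreEval M' a (MvPolynomial.X 4))
      rw [segreEval_X_last, segreEval_X_last, ← map_pow, ← pow_mul, hζ]
      simp
    · change segreEval M' b (MvPolynomial.X i.castSucc) * algebraMap ℂ _ (ζ ^ 2) ^ wt i.castSucc =
        rescale (fun _ => ζ) (segreEval M' a (MvPolynomial.X i.castSucc))
      rw [segreEval_X_castSucc, segreEval_X_castSucc, wt_castSucc, pow_one, mul_comm,
        ← Algebra.smul_def, Finset.smul_sum, map_sum]
      refine Finset.sum_congr rfl fun k _ => ?_
      rw [rescale_smul, hz, smul_comm]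

/-- A parametrization of the surface `X Z = Y W`, `W - Y + ∑ ℓₖ Qₖ = 0` by power series, which is
equivariant for the action of the fourth roots of unity. -/
theorem exists_segreEval_eq_zero (h : M * M' = 1) {Q : Fin 4 → MvPolynomial (Fin 5) ℂ}
    (hQ : ∀ k, Q k ∈ linIdeal) {n : ℕ} (hQ' : ∀ k, Q k ∈ wtGrading (2 * n)) :
    ∃ a : Fin 2 → MvPowerSeries (Fin 2) ℂ, (∀ i, a i - X i ∈ orderIdeal (Fin 2) 2) ∧
      (∀ ζ : ℂ, ζ ^ 4 = 1 → ∀ i, rescale (fun _ => ζ) (a i) = ζ • a i) ∧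
      segreEval M' a (MvPolynomial.X 4 ^ n * (coneForm (M 3) - coneForm (M 2)) +
        ∑ k, coneForm (M k) * Q k) = 0 := by
  obtain ⟨a, ha, huniq⟩ := existsUnique_fixedPoint (segreStep M' Q) fun n a b hab =>
    segreStep_sub_mem a b hQ hab
  have h0 : a 0 = X 0 - (a 1 * segreEval M' a (Q 1) + a 0 * segreEval M' a (Q 3)) :=
    (congrFun ha 0).symm
  have h1 : a 1 = X 1 + (a 0 * segreEval M' a (Q 0) + a 1 * segreEval M' a (Q 2)) :=
    (congrFun ha 1).symm
  -- Bootstrapping: order `n` of the solution gives agreement with `u, v` to order `2 n + 1`. It is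
  -- used for `n = 0`, then for `n = 1`.
  have hstep : ∀ n, (∀ i, a i ∈ orderIdeal (Fin 2) n) →
      ∀ i, a i - X i ∈ orderIdeal (Fin 2) (n + (n + 1)) := by
    intro n hn i
    have h2 : ∀ i k, a i * segreEval M' a (Q k) ∈ orderIdeal (Fin 2) (n + (n + 1)) := fun i k =>
      mul_mem_orderIdeal (hn i) (segreEval_mem_of_mem_linIdeal a hn (hQ k))
    fin_cases i
    · change a 0 - X 0 ∈ _
      have : a 0 - X 0 = -(a 1 * segreEval M' a (Q 1) + a 0 * segreEval M' a (Q 3)) := by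
        linear_combination h0
      rw [this]
      exact neg_mem (add_mem (h2 _ _) (h2 _ _))
    · change a 1 - X 1 ∈ _
      have : a 1 - X 1 = a 0 * segreEval M' a (Q 0) + a 1 * segreEval M' a (Q 2) := by
        linear_combination h1
      rw [this]
      exact add_mem (h2 _ _) (h2 _ _)
  have ha1 : ∀ i, a i ∈ orderIdeal (Fin 2) 1 := by
    intro i
    have := add_mem (hstep 0 (fun _ => mem_orderIdeal_zero _) i) (X_mem_orderIdeal i)
    simpa using this
  refine ⟨a, fun i => orderIdeal_antitone (by omega) (hstep 1 ha1 i), fun ζ hζ i => ?_, ?_⟩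
  · have hζ0 : ζ ≠ 0 := by
      rintro rfl
      norm_num at hζ
    -- The rescaled solution, divided by `ζ`, solves the same fixed point equation and so equals `a`
    -- by uniqueness.
    let b : Fin 2 → MvPowerSeries (Fin 2) ℂ := fun i => ζ⁻¹ • rescale (fun _ => ζ) (a i)
    have hab : ∀ i, rescale (fun _ => ζ) (a i) = ζ • b i := fun i => by
      simp only [b, smul_smul, mul_inv_cancel₀ hζ0, one_smul]
    have hr : ∀ k, rescale (fun _ => ζ) (segreEval M' a (Q k)) = segreEval M' b (Q k) := fun k =>
      rescale_segreEval hζ (hQ' k) hab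
    have hb : segreStep M' Q b = b := by
      funext i
      fin_cases i
      · change X 0 - (b 1 * segreEval M' b (Q 1) + b 0 * segreEval M' b (Q 3)) =
          ζ⁻¹ • rescale (fun _ => ζ) (a 0)
        rw [h0, map_sub, map_add, map_mul, map_mul, hr, hr, hab, hab, rescale_const_X]
        simp only [smul_sub, smul_add, smul_mul_assoc, smul_smul, inv_mul_cancel₀ hζ0, one_smul]
      · change X 1 + (b 0 * segreEval M' b (Q 0) + b 1 * segreEval M' b (Q 2)) =
          ζ⁻¹ • rescale (fun _ => ζ) (a 1)
        rw [h1, map_add, map_add, map_mul, map_mul, hr, hr, hab, hab, rescale_const_X]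
        simp only [smul_add, smul_mul_assoc, smul_smul, inv_mul_cancel₀ hζ0, one_smul]
    rw [hab, huniq b hb]
  · rw [map_add, map_mul, map_pow, segreEval_X_last, one_pow, one_mul, map_sub,
      segreEval_coneForm a h, segreEval_coneForm a h, map_sum, Fin.sum_univ_four]
    simp only [map_mul, segreEval_coneForm a h]
    change X 1 * a 0 - X 0 * a 1 + (X 0 * a 0 * _ + X 1 * a 1 * _ + X 0 * a 1 * _ + X 1 * a 0 * _)
      = 0
    -- In `v c - u d` the terms `u v` cancel, and the corrections are exactly `-∑ ℓₖ Qₖ`.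
    linear_combination X 1 * h0 - X 0 * h1

end Parametrization

/-! ### Leading terms of forms on the parametrized surface. -/

section LeadingTerms

open MvPolynomial

/-- Euler's relation, divided by the degree. -/
theorem exists_sum_X_mul_of_isHomogeneous {n : ℕ} {f : MvPolynomial (Fin 4) ℂ}
    (hf : f ∈ stdGrading (n + 1)) :
    ∃ g : Fin 4 → MvPolynomial (Fin 4) ℂ, (∀ i, g i ∈ stdGrading n) ∧ f = ∑ i, X i * g i := by
  have h1 : f.IsHomogeneous (n + 1) := hf
  refine ⟨fun i => (n + 1 : ℂ)⁻¹ • pderiv i f, fun i => Submodule.smul_mem _ _ h1.pderiv, ?_⟩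
  have h2 := h1.sum_X_mul_pderiv
  simp only [mul_smul_comm, ← Finset.smul_sum, h2]
  rw [← Nat.cast_smul_eq_nsmul ℂ, smul_smul, Nat.cast_add, Nat.cast_one,
    inv_mul_cancel₀ (by exact_mod_cast n.succ_ne_zero), one_smul]

theorem degree_eq_of_coeff_ne_zero {n : ℕ} {f : MvPolynomial (Fin 4) ℂ} (hf : f ∈ stdGrading n)
    {s : Fin 4 →₀ ℕ} (hs : coeff s f ≠ 0) : s.degree = n := by
  rw [Finsupp.degree_eq_weight_one]
  exact hf hs

variable {M M' : Matrix (Fin 4) (Fin 4) ℂ} (a : Fin 2 → MvPowerSeries (Fin 2) ℂ)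

/-- The order and the leading term of the value of a form on the parametrized surface. -/
theorem segreEval_rename_mem (ha : ∀ i, a i - MvPowerSeries.X i ∈ orderIdeal (Fin 2) 2) {n : ℕ}
    {f : MvPolynomial (Fin 4) ℂ} (hf : f ∈ stdGrading n) :
    segreEval M' a (rename Fin.castSucc f) ∈ orderIdeal (Fin 2) (2 * n) ∧
    segreEval M' a (rename Fin.castSucc f) -
      segreEval M' MvPowerSeries.X (rename Fin.castSucc f) ∈ orderIdeal (Fin 2) (2 * n + 1) := by
  have ha1 : ∀ i, a i ∈ orderIdeal (Fin 2) 1 := fun i => by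
    have := add_mem (orderIdeal_antitone one_le_two (ha i)) (X_mem_orderIdeal i)
    simpa using this
  induction n generalizing f with
  | zero =>
    refine ⟨mem_orderIdeal_zero _, ?_⟩
    have h1 : f.IsHomogeneous 0 := hf
    rw [← totalDegree_zero_iff_isHomogeneous, totalDegree_eq_zero_iff_eq_C] at h1
    rw [h1, rename_C, ← algebraMap_eq, AlgHom.commutes, AlgHom.commutes, sub_self]
    exact zero_mem _
  | succ n ih =>
    obtain ⟨g, hg, rfl⟩ := exists_sum_X_mul_of_isHomogeneous hf
    simp only [map_sum, map_mul, rename_X]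
    rw [← Finset.sum_sub_distrib]
    constructor
    · refine Submodule.sum_mem _ fun i _ => ?_
      rw [show 2 * (n + 1) = 1 + 1 + 2 * n by ring]
      exact mul_mem_orderIdeal (segreEval_X_castSucc_mem a ha1 i) (ih (hg i)).1
    · refine Submodule.sum_mem _ fun i _ => ?_
      have h1 := mul_mem_orderIdeal (segreEval_sub_mem (M' := M') a MvPowerSeries.X ha
        (X i.castSucc)) (ih (hg i)).1
      have h2 := mul_mem_orderIdeal (segreEval_X_castSucc_mem (M' := M') MvPowerSeries.X
        X_mem_orderIdeal i) (ih (hg i)).2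
      have h3 := add_mem (orderIdeal_antitone (by omega : 2 * (n + 1) + 1 ≤ _) h1)
        (orderIdeal_antitone (by omega : 2 * (n + 1) + 1 ≤ _) h2)
      convert h3 using 1
      ring

theorem segreEval_X_rename_linSubst (h : M * M' = 1) (g : MvPolynomial (Fin 4) ℂ) :
    segreEval M' a (rename Fin.castSucc (linSubst M g)) = aeval (segrePoint a) g := by
  have : (segreEval M' a).comp ((rename Fin.castSucc).comp (linSubst M)) =
      aeval (segrePoint a) := by
    refine algHom_ext fun i => ?_
    rw [AlgHom.comp_apply, AlgHom.comp_apply, linSubst_X, aeval_X]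
    exact segreEval_coneForm a h i
  exact congr($this g)

/-- The exponent of the leading term `(u²)^s₀ (v²)^s₁ (uv)^(s₂ + s₃)`. -/
noncomputable def leadingExp (s : Fin 4 →₀ ℕ) : Fin 2 →₀ ℕ :=
  Finsupp.single 0 (2 * s 0 + s 2 + s 3) + Finsupp.single 1 (2 * s 1 + s 2 + s 3)

theorem leadingExp_zero (s : Fin 4 →₀ ℕ) : leadingExp s 0 = 2 * s 0 + s 2 + s 3 := by
  simp [leadingExp]

theorem leadingExp_one (s : Fin 4 →₀ ℕ) : leadingExp s 1 = 2 * s 1 + s 2 + s 3 := by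
  simp [leadingExp]

theorem aeval_segrePoint_monomial (s : Fin 4 →₀ ℕ) (c : ℂ) :
    aeval (segrePoint MvPowerSeries.X) (monomial s c) =
      MvPowerSeries.monomial (leadingExp s) c := by
  rw [aeval_monomial, Finsupp.prod_fintype _ _ (by simp), Fin.prod_univ_four,
    show MvPowerSeries.monomial (leadingExp s) c =
      algebraMap ℂ _ c * MvPowerSeries.monomial (leadingExp s) 1 by
      rw [← Algebra.smul_def, ← map_smul, smul_eq_mul, mul_one]]
  congr 1
  change (MvPowerSeries.X 0 * MvPowerSeries.X 0) ^ s 0 *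
    (MvPowerSeries.X 1 * MvPowerSeries.X 1) ^ s 1 * (MvPowerSeries.X 0 * MvPowerSeries.X 1) ^ s 2 *
    (MvPowerSeries.X 1 * MvPowerSeries.X 0) ^ s 3 = _
  have h1 : MvPowerSeries.monomial (leadingExp s) 1 =
      (MvPowerSeries.X 0 : MvPowerSeries (Fin 2) ℂ) ^ (2 * s 0 + s 2 + s 3) *
        MvPowerSeries.X 1 ^ (2 * s 1 + s 2 + s 3) := by
    rw [MvPowerSeries.X_pow_eq, MvPowerSeries.X_pow_eq, MvPowerSeries.monomial_mul_monomial,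
      one_mul, leadingExp]
  rw [h1]
  ring

/-- A combination of monomials with `s₃ = 0` and `s₂ ≤ 1` is determined by its leading term. -/
theorem eq_zero_of_aeval_segrePoint_mem {n : ℕ} {g : MvPolynomial (Fin 4) ℂ}
    (hg : g ∈ stdGrading n) (hs : ∀ s ∈ g.support, s 3 = 0 ∧ s 2 ≤ 1)
    (h : aeval (segrePoint MvPowerSeries.X) g ∈ orderIdeal (Fin 2) (2 * n + 1)) : g = 0 := by
  classical
  ext s
  rw [coeff_zero]
  by_contra hc
  have hmem : s ∈ g.support := mem_support_iff.mpr hc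
  have hdeg : s.degree = n := degree_eq_of_coeff_ne_zero hg hc
  rw [Finsupp.degree_eq_sum, Fin.sum_univ_four] at hdeg
  have h1 := mem_orderIdeal.mp h (leadingExp s) (by
    rw [Finsupp.degree_eq_sum, Fin.sum_univ_two, leadingExp_zero, leadingExp_one]
    omega)
  rw [g.as_sum, map_sum, map_sum, Finset.sum_eq_single s] at h1
  · rw [aeval_segrePoint_monomial, MvPowerSeries.coeff_monomial_same] at h1
    exact hc h1
  · intro t ht hts
    rw [aeval_segrePoint_monomial, MvPowerSeries.coeff_monomial_ne]
    intro he
    apply hts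
    -- With `s₃ = 0` and `s₂ ≤ 1`, the parity of either exponent recovers `s₂`, after which the two
    -- exponents recover `s₀` and `s₁`.
    have e0 := congr($he 0)
    have e1 := congr($he 1)
    rw [leadingExp_zero, leadingExp_zero] at e0
    rw [leadingExp_one, leadingExp_one] at e1
    have := hs s hmem
    have := hs t ht
    ext i
    fin_cases i <;> simp <;> omega
  · exact fun h2 => absurd hmem h2

/-- Every form is congruent to a combination of monomials with `s₃ = 0` and `s₂ ≤ 1` modulo
`W - Y` and `X Z - Y W`. -/
theorem exists_normalForm_monomial (s : Fin 4 →₀ ℕ) (c : ℂ) :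
    ∃ g g₁ g₂ : MvPolynomial (Fin 4) ℂ, g ∈ stdGrading s.degree ∧
      (∀ t ∈ g.support, t 3 = 0 ∧ t 2 ≤ 1) ∧ (∀ i, X i * g₁ ∈ stdGrading s.degree) ∧
      monomial s c = g + (X 3 - X 2) * g₁ + (X 0 * X 1 - X 2 * X 3) * g₂ := by
  -- The two reductions `W ↦ Y` and `Y² ↦ X Z` both lower `s₂ + 2 s₃`.
  induction hN : s 2 + 2 * s 3 using Nat.strong_induction_on generalizing s with
  | _ N ih =>
    have hmem : ∀ t : Fin 4 →₀ ℕ, monomial t c ∈ stdGrading t.degree := fun t =>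
      isHomogeneous_monomial c rfl
    by_cases h3 : s 3 = 0
    · by_cases h2 : s 2 ≤ 1
      · refine ⟨monomial s c, 0, 0, hmem s, fun t ht => ?_, fun i => ?_, by ring⟩
        · rw [Finset.mem_singleton.mp (support_monomial_subset ht)]
          exact ⟨h3, h2⟩
        · rw [mul_zero]
          exact zero_mem _
      · obtain ⟨t, rfl⟩ : ∃ t, s = t + Finsupp.single 2 2 :=
          ⟨s - Finsupp.single 2 2, (tsub_add_cancel_of_le
            (Finsupp.single_le_iff.mpr (by omega))).symm⟩
        set r : Fin 4 →₀ ℕ := t + Finsupp.single 0 1 + Finsupp.single 1 1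
        have hr : r.degree = (t + Finsupp.single 2 2).degree := by
          simp only [r, map_add, Finsupp.degree_single]
        obtain ⟨g, g₁, g₂, hg, hgs, hg₁, heq⟩ := ih (r 2 + 2 * r 3) (by
          simp [r] at hN ⊢; omega) r rfl
        rw [hr] at hg hg₁
        -- This uses `Y² = X Z - Y (W - Y) - (X Z - Y W)`.
        refine ⟨g, g₁ - X 2 * monomial t c, g₂ - monomial t c, hg, hgs, fun i => ?_, ?_⟩
        · rw [mul_sub]
          refine sub_mem (hg₁ i) ?_
          have : X i * (X 2 * monomial t c) =
              monomial (t + Finsupp.single 2 1 + Finsupp.single i 1) c := by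
            rw [monomial_add_single, monomial_add_single]
            ring
          have hd : (t + Finsupp.single 2 2).degree =
              (t + Finsupp.single 2 1 + Finsupp.single i 1).degree := by
            simp only [map_add, Finsupp.degree_single]
          rw [this, hd]
          exact hmem _
        · have e1 : monomial (t + Finsupp.single 2 2) c = monomial t c * X 2 ^ 2 :=
            monomial_add_single
          have e2 : monomial r c = monomial t c * X 0 * X 1 := by
            rw [monomial_add_single, monomial_add_single, pow_one, pow_one]
          rw [e1]
          rw [e2] at heq
          linear_combination heq
    · obtain ⟨t, rfl⟩ : ∃ t, s = t + Finsupp.single 3 1 :=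
        ⟨s - Finsupp.single 3 1, (tsub_add_cancel_of_le
          (Finsupp.single_le_iff.mpr (by omega))).symm⟩
      set r : Fin 4 →₀ ℕ := t + Finsupp.single 2 1
      have hr : r.degree = (t + Finsupp.single 3 1).degree := by
        simp only [r, map_add, Finsupp.degree_single]
      obtain ⟨g, g₁, g₂, hg, hgs, hg₁, heq⟩ := ih (r 2 + 2 * r 3) (by
        simp [r] at hN ⊢; omega) r rfl
      rw [hr] at hg hg₁
      refine ⟨g, g₁ + monomial t c, g₂, hg, hgs, fun i => ?_, ?_⟩
      · rw [mul_add]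
        refine add_mem (hg₁ i) ?_
        have : X i * monomial t c = monomial (t + Finsupp.single i 1) c := by
          rw [monomial_add_single]
          ring
        have hd : (t + Finsupp.single 3 1).degree = (t + Finsupp.single i 1).degree := by
          simp only [map_add, Finsupp.degree_single]
        rw [this, hd]
        exact hmem _
      · have e1 : monomial (t + Finsupp.single 3 1) c = monomial t c * X 3 ^ 1 :=
          monomial_add_single
        have e2 : monomial r c = monomial t c * X 2 ^ 1 := monomial_add_single
        rw [e1]
        rw [e2] at heq
        linear_combination heq

/-- The monomial case is summed over the support. The degree of `g₁` is recorded through `Xᵢ g₁`,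
which still makes sense for `n = 0`, where it forces `g₁ = 0`. -/
theorem exists_normalForm {n : ℕ} {f : MvPolynomial (Fin 4) ℂ} (hf : f ∈ stdGrading n) :
    ∃ g g₁ g₂ : MvPolynomial (Fin 4) ℂ, g ∈ stdGrading n ∧
      (∀ t ∈ g.support, t 3 = 0 ∧ t 2 ≤ 1) ∧ (∀ i, X i * g₁ ∈ stdGrading n) ∧
      f = g + (X 3 - X 2) * g₁ + (X 0 * X 1 - X 2 * X 3) * g₂ := by
  classical
  choose g g₁ g₂ hg hgs hg₁ heq using fun s => exists_normalForm_monomial s (coeff s f)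
  have hd : ∀ s ∈ f.support, s.degree = n := fun s hs => degree_eq_of_coeff_ne_zero hf (mem_support_iff.mp hs)
  refine ⟨∑ s ∈ f.support, g s, ∑ s ∈ f.support, g₁ s, ∑ s ∈ f.support, g₂ s,
    Submodule.sum_mem _ fun s hs => hd s hs ▸ hg s, fun t ht => ?_, fun i => ?_, ?_⟩
  · obtain ⟨s, -, hs⟩ := Finset.mem_biUnion.mp (support_sum ht)
    exact hgs s t hs
  · rw [Finset.mul_sum]
    exact Submodule.sum_mem _ fun s hs => hd s hs ▸ hg₁ s i
  · conv_lhs => rw [f.as_sum]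
    rw [Finset.mul_sum, Finset.mul_sum, ← Finset.sum_add_distrib, ← Finset.sum_add_distrib]
    exact Finset.sum_congr rfl fun s _ => heq s

theorem linSubst_mem (M : Matrix (Fin 4) (Fin 4) ℂ) {n : ℕ} {f : MvPolynomial (Fin 4) ℂ}
    (hf : f ∈ stdGrading n) : linSubst M f ∈ stdGrading n := by
  have := IsHomogeneous.aeval (hφ := hf) (fun i => linForm (M i)) (n := 1)
    (fun i => isHomogeneous_linForm _)
  rwa [one_mul] at this

/-- A form whose leading term on the parametrized surface vanishes lies in the ideal of the conic
`W - Y = X Z - Y W = 0`. -/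
theorem exists_eq_of_segreEval_mem (h : M * M' = 1) (h' : M' * M = 1)
    (ha : ∀ i, a i - MvPowerSeries.X i ∈ orderIdeal (Fin 2) 2) {n : ℕ}
    {f : MvPolynomial (Fin 4) ℂ} (hf : f ∈ stdGrading n)
    (hfa : segreEval M' a (rename Fin.castSucc f) ∈ orderIdeal (Fin 2) (2 * n + 1)) :
    ∃ g₁ g₂ : MvPolynomial (Fin 4) ℂ, (∀ i, linForm (M i) * g₁ ∈ stdGrading n) ∧
      f = (linForm (M 3) - linForm (M 2)) * g₁ +
        (linForm (M 0) * linForm (M 1) - linForm (M 2) * linForm (M 3)) * g₂ := by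
  obtain ⟨g, g₁, g₂, hg, hgs, hg₁, heq⟩ := exists_normalForm (linSubst_mem M' hf)
  have hf2 : f = linSubst M (linSubst M' f) := congr($((linSubst_comp h').symm) f)
  have h1 : aeval (segrePoint MvPowerSeries.X) (linSubst M' f) ∈ orderIdeal (Fin 2) (2 * n + 1) := by
    rw [← segreEval_X_rename_linSubst MvPowerSeries.X h, ← hf2]
    have := sub_mem hfa (segreEval_rename_mem (M' := M') a ha hf).2
    simpa using this
  -- With `c = u` and `d = v` both `W - Y` and `X Z - Y W` vanish identically, so only the normal
  -- form contributes to the leading term.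
  have h2 : aeval (segrePoint MvPowerSeries.X) (linSubst M' f) =
      aeval (segrePoint MvPowerSeries.X) g := by
    rw [heq]
    simp only [map_add, map_mul, map_sub, aeval_X]
    change aeval (segrePoint MvPowerSeries.X) g +
      (MvPowerSeries.X 1 * MvPowerSeries.X 0 - MvPowerSeries.X 0 * MvPowerSeries.X 1) * _ +
      (MvPowerSeries.X 0 * MvPowerSeries.X 0 * (MvPowerSeries.X 1 * MvPowerSeries.X 1) -
        MvPowerSeries.X 0 * MvPowerSeries.X 1 * (MvPowerSeries.X 1 * MvPowerSeries.X 0)) * _ = _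
    ring
  rw [h2] at h1
  rw [eq_zero_of_aeval_segrePoint_mem hg hgs h1, zero_add] at heq
  refine ⟨linSubst M g₁, linSubst M g₂, fun i => ?_, ?_⟩
  · rw [← linSubst_X, ← map_mul]
    exact linSubst_mem M (hg₁ i)
  · rw [hf2, heq]
    simp only [map_add, map_mul, map_sub, linSubst_X]

/-- Power series with exponents of degree `4 k` are leading terms of forms of degree `2 k`. -/
theorem exists_sub_segreEval_mem (h : M * M' = 1)
    (ha : ∀ i, a i - MvPowerSeries.X i ∈ orderIdeal (Fin 2) 2) {k : ℕ}
    {F : MvPowerSeries (Fin 2) ℂ} (hF : F ∈ orderIdeal (Fin 2) (4 * k)) :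
    ∃ f ∈ stdGrading (2 * k),
      F - segreEval M' a (rename Fin.castSucc f) ∈ orderIdeal (Fin 2) (4 * k + 1) := by
  classical
  let ex : ℕ → Fin 2 →₀ ℕ := fun j => Finsupp.single 0 j + Finsupp.single 1 (4 * k - j)
  -- As `4 k` is even, `j` and `4 k - j` have the same parity, so `u^j v^(4 k - j)` is a product of
  -- powers of `u²` and `v²` and at most one `u v`.
  let s : ℕ → Fin 4 →₀ ℕ := fun j => Finsupp.single 0 (j / 2) + Finsupp.single 1 ((4 * k - j) / 2) +
    Finsupp.single 2 (j % 2)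
  have hs : ∀ j ≤ 4 * k, leadingExp (s j) = ex j := by
    intro j hj
    ext i
    fin_cases i
    · change leadingExp (s j) 0 = ex j 0
      rw [leadingExp_zero]
      simp [s, ex]
      omega
    · change leadingExp (s j) 1 = ex j 1
      rw [leadingExp_one]
      simp [s, ex]
      omega
  have hsd : ∀ j ≤ 4 * k, (s j).degree = 2 * k := by
    intro j hj
    simp only [s, map_add, Finsupp.degree_single]
    omega
  set g : MvPolynomial (Fin 4) ℂ := ∑ j ∈ Finset.range (4 * k + 1),
    monomial (s j) (MvPowerSeries.coeff (ex j) F)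
  have hg : g ∈ stdGrading (2 * k) := Submodule.sum_mem _ fun j hj =>
    isHomogeneous_monomial _ (hsd j (by have := Finset.mem_range.mp hj; omega))
  have hgv : aeval (segrePoint MvPowerSeries.X) g = ∑ j ∈ Finset.range (4 * k + 1),
      MvPowerSeries.monomial (ex j) (MvPowerSeries.coeff (ex j) F) := by
    rw [map_sum]
    refine Finset.sum_congr rfl fun j hj => ?_
    rw [aeval_segrePoint_monomial, hs j (by have := Finset.mem_range.mp hj; omega)]
  have hlead : F - aeval (segrePoint MvPowerSeries.X) g ∈ orderIdeal (Fin 2) (4 * k + 1) := by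
    rw [mem_orderIdeal]
    intro t ht
    rw [map_sub, hgv, map_sum]
    by_cases htd : t.degree = 4 * k
    · rw [Finsupp.degree_eq_sum, Fin.sum_univ_two] at htd
      have ht0 : t = ex (t 0) := by
        ext i
        fin_cases i <;> simp [ex]
        omega
      rw [Finset.sum_eq_single (t 0)]
      · rw [← ht0, MvPowerSeries.coeff_monomial_same, sub_self]
      · intro j _ hj
        rw [MvPowerSeries.coeff_monomial_ne]
        intro he
        apply hj
        have := congr($he 0)
        simpa [ex] using this.symm
      · intro hn
        exact absurd (Finset.mem_range.mpr (by omega)) hn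
    · rw [mem_orderIdeal.mp hF t (by omega), zero_sub, neg_eq_zero]
      refine Finset.sum_eq_zero fun j hj => ?_
      rw [MvPowerSeries.coeff_monomial_ne]
      rintro rfl
      apply htd
      have := Finset.mem_range.mp hj
      simp only [ex, map_add, Finsupp.degree_single]
      omega
  refine ⟨linSubst M g, linSubst_mem M hg, ?_⟩
  have h1 := (segreEval_rename_mem (M' := M') a ha (linSubst_mem M hg)).2
  rw [segreEval_X_rename_linSubst MvPowerSeries.X h] at h1
  have := sub_mem hlead (orderIdeal_antitone (by omega : 4 * k + 1 ≤ _) h1)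
  simpa using this

end LeadingTerms

/-! ### Invariants of the fourth roots of unity. -/

section Invariants

open MvPowerSeries

theorem mem_cyclicInvariants_iff {f : MvPowerSeries (Fin 2) ℂ} :
    f ∈ cyclicInvariants 4 ![1, 1] ↔ ∀ ζ : ℂ, ζ ^ 4 = 1 → rescale (fun _ => ζ) f = f := by
  have h : ∀ ζ : ℂ, (fun i => ζ ^ (![1, 1] : Fin 2 → ℕ) i) = fun _ => ζ := by
    intro ζ
    funext i
    fin_cases i <;> simp
  change (∀ ζ : ℂ, ζ ^ 4 = 1 → rescale (fun i => ζ ^ (![1, 1] : Fin 2 → ℕ) i) f = f) ↔ _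
  simp only [h]

theorem coeff_rescale_const (ζ : ℂ) (f : MvPowerSeries (Fin 2) ℂ) (s : Fin 2 →₀ ℕ) :
    coeff s (rescale (fun _ => ζ) f) = ζ ^ s.degree * coeff s f := by
  rw [coeff_rescale, Finsupp.prod_fintype _ _ (by simp), Finset.prod_pow_eq_pow_sum,
    Finsupp.degree_eq_sum]

theorem rescale_mem_orderIdeal (ζ : ℂ) {n : ℕ} {f : MvPowerSeries (Fin 2) ℂ}
    (hf : f ∈ orderIdeal (Fin 2) n) : rescale (fun _ => ζ) f ∈ orderIdeal (Fin 2) n :=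
  mem_orderIdeal.mpr fun s hs => by
    rw [coeff_rescale_const, mem_orderIdeal.mp hf s hs, mul_zero]

/-- The exponents of an invariant power series have degree divisible by `4`. -/
theorem mem_orderIdeal_of_mem_cyclicInvariants {f : MvPowerSeries (Fin 2) ℂ}
    (hf : f ∈ cyclicInvariants 4 ![1, 1]) {k : ℕ} (h : f ∈ orderIdeal (Fin 2) (4 * k + 1)) :
    f ∈ orderIdeal (Fin 2) (4 * (k + 1)) := by
  rw [mem_orderIdeal]
  intro s hs
  by_cases h1 : s.degree < 4 * k + 1
  · exact mem_orderIdeal.mp h s h1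
  have h2 := congr(coeff s $(mem_cyclicInvariants_iff.mp hf Complex.I Complex.I_pow_four))
  rw [coeff_rescale_const] at h2
  -- Invariance under the single root `i` already excludes degrees not divisible by four.
  have h3 : Complex.I ^ s.degree ≠ 1 := by
    have h4 : s.degree = 4 * k + 1 ∨ s.degree = 4 * k + 2 ∨ s.degree = 4 * k + 3 := by omega
    rcases h4 with h4 | h4 | h4 <;>
      rw [h4, pow_add, pow_mul, Complex.I_pow_four, one_pow, one_mul] <;>
      norm_num [Complex.ext_iff, pow_succ]
  by_contra hc
  exact h3 (mul_right_cancel₀ hc (by rw [h2, one_mul]))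

/-- The filtration of the invariant power series by the order. -/
noncomputable def invFiltration (k : ℕ) : Ideal (cyclicInvariants 4 ![1, 1]) :=
  (orderIdeal (Fin 2) (4 * k)).comap (cyclicInvariants 4 ![1, 1]).val

theorem mem_invFiltration {k : ℕ} {f : cyclicInvariants 4 ![1, 1]} :
    f ∈ invFiltration k ↔ (f : MvPowerSeries (Fin 2) ℂ) ∈ orderIdeal (Fin 2) (4 * k) := Iff.rfl

/-- The limit exists among all power series, and it is invariant because rescaling preserves the
order filtration. -/
theorem exists_sub_mem_invFiltration (s : ℕ → cyclicInvariants 4 ![1, 1])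
    (hs : ∀ k, s (k + 1) - s k ∈ invFiltration k) : ∃ f, ∀ k, f - s k ∈ invFiltration k := by
  obtain ⟨f, hf⟩ := exists_sub_mem_orderIdeal
    (fun k => (s k : MvPowerSeries (Fin 2) ℂ)) (c := fun k => 4 * k) (fun a b h => by
      simpa using h) (fun k => by omega) hs
  have hinv : f ∈ cyclicInvariants 4 ![1, 1] := by
    rw [mem_cyclicInvariants_iff]
    intro ζ hζ
    rw [← sub_eq_zero]
    refine eq_zero_of_forall_mem_orderIdeal fun n => ?_
    have h1 := sub_mem (rescale_mem_orderIdeal ζ (hf n)) (hf n)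
    rw [map_sub, mem_cyclicInvariants_iff.mp (s n).2 ζ hζ] at h1
    refine orderIdeal_antitone (by omega : n ≤ 4 * n) ?_
    simpa using h1
  exact ⟨⟨f, hinv⟩, hf⟩

end Invariants

/-! ### The local ring at the vertex and its filtration. -/

section LocalRing

open MvPolynomial IsLocalRing

theorem rename_castSucc_mem {n : ℕ} {f : MvPolynomial (Fin 4) ℂ} (hf : f ∈ stdGrading n) :
    rename Fin.castSucc f ∈ wtGrading n := by
  have h1 : rename Fin.castSucc = aeval (R := ℂ) (X ∘ Fin.castSucc : Fin 4 → MvPolynomial (Fin 5) ℂ) :=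
    algHom_ext fun i => by rw [rename_X, aeval_X, Function.comp_apply]
  rw [h1]
  refine aeval_mem_graded wtGrading (w := 1) (g := X ∘ Fin.castSucc) (fun i => ?_) hf
  have h := isWeightedHomogeneous_X ℂ wt i.castSucc
  rwa [wt_castSucc] at h

variable {M M' : Matrix (Fin 4) (Fin 4) ℂ} {a : Fin 2 → MvPowerSeries (Fin 2) ℂ}
  {R : Type*} [CommRing R] [IsLocalRing R] [Algebra ℂ R]

/-- A local ring `R` of a surface `XZ - YW = wⁿ(W - Y) + ∑ ℓₖ Qₖ = 0` at the vertex, with the functions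
`e k F = F / wᵏ` for `F` of weighted degree `2 k`, and with a homomorphism to power series given by
a parametrization. -/
structure VertexChart (M' : Matrix (Fin 4) (Fin 4) ℂ) (a : Fin 2 → MvPowerSeries (Fin 2) ℂ)
    (J : Ideal (MvPolynomial (Fin 5) ℂ)) (e : ℕ → MvPolynomial (Fin 5) ℂ → R)
    (Φ : R →ₐ[ℂ] MvPowerSeries (Fin 2) ℂ) : Prop where
  add : ∀ {k F G}, F ∈ wtGrading (2 * k) → G ∈ wtGrading (2 * k) → e k (F + G) = e k F + e k G
  mul : ∀ {k l F G}, F ∈ wtGrading (2 * k) → G ∈ wtGrading (2 * l) →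
    e (k + l) (F * G) = e k F * e l G
  eq_zero : ∀ {k F}, F ∈ wtGrading (2 * k) → F ∈ J → e k F = 0
  const : ∀ c, e 0 (C c) = algebraMap ℂ R c
  last : e 1 (X 4) = 1
  apply : ∀ {k F}, F ∈ wtGrading (2 * k) → Φ (e k F) = segreEval M' a F
  span : maximalIdeal R = Ideal.span
    (Set.range fun k : Fin 4 × Fin 4 => e 1 (X k.1.castSucc * X k.2.castSucc))
  residue : ∀ r, ∃ c, r - algebraMap ℂ R c ∈ maximalIdeal R

namespace VertexChart

variable {J : Ideal (MvPolynomial (Fin 5) ℂ)} {e : ℕ → MvPolynomial (Fin 5) ℂ → R}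
  {Φ : R →ₐ[ℂ] MvPowerSeries (Fin 2) ℂ}

theorem zero (hV : VertexChart M' a J e Φ) (k : ℕ) : e k 0 = 0 :=
  hV.eq_zero (zero_mem _) (zero_mem _)

theorem sum (hV : VertexChart M' a J e Φ) {ι : Type*} (s : Finset ι) {k : ℕ}
    {F : ι → MvPolynomial (Fin 5) ℂ}
    (hF : ∀ i ∈ s, F i ∈ wtGrading (2 * k)) : e k (∑ i ∈ s, F i) = ∑ i ∈ s, e k (F i) := by
  classical
  induction s using Finset.induction_on with
  | empty => simpa using hV.zero k
  | insert i s hi ih =>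
    rw [Finset.sum_insert hi, Finset.sum_insert hi, hV.add (hF i (Finset.mem_insert_self i s))
      (Submodule.sum_mem _ fun j hj => hF j (Finset.mem_insert_of_mem hj)),
      ih fun j hj => hF j (Finset.mem_insert_of_mem hj)]

theorem X_castSucc_mul_mem (i j : Fin 4) {n : ℕ} {F : MvPolynomial (Fin 5) ℂ}
    (hF : F ∈ wtGrading n) : X i.castSucc * (X j.castSucc * F) ∈ wtGrading (n + 2) := by
  have h1 : ∀ i : Fin 4, (X i.castSucc : MvPolynomial (Fin 5) ℂ) ∈ wtGrading 1 := fun i => by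
    simpa using X_castSucc_pow_mem i 1
  have := SetLike.mul_mem_graded (h1 i) (SetLike.mul_mem_graded (h1 j) hF)
  rwa [show 1 + (1 + n) = n + 2 by ring] at this

theorem X_castSucc_mul_X_castSucc_mem (i j : Fin 4) :
    (X i.castSucc * X j.castSucc : MvPolynomial (Fin 5) ℂ) ∈ wtGrading (2 * 1) := by
  have := X_castSucc_mul_mem i j (F := 1) (n := 0) SetLike.GradedOne.one_mem
  simpa using this

/-- Quadratic monomials over `w` lie in the maximal ideal. -/
theorem coord_mem (hV : VertexChart M' a J e Φ) (i j : Fin 4) :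
    e 1 (X i.castSucc * X j.castSucc) ∈ maximalIdeal R := by
  rw [hV.span]
  exact Ideal.subset_span ⟨(i, j), rfl⟩

/-- The variables of a monomial of degree `2 k` are grouped in pairs, each giving a factor `xᵢ xⱼ /
w` in the maximal ideal. -/
theorem apply_rename_mem_pow (hV : VertexChart M' a J e Φ) {k : ℕ} {f : MvPolynomial (Fin 4) ℂ}
    (hf : f ∈ stdGrading (2 * k)) : e k (rename Fin.castSucc f) ∈ maximalIdeal R ^ k := by
  induction k generalizing f with
  | zero => simp
  | succ k ih =>
    obtain ⟨g, hg, rfl⟩ := exists_sum_X_mul_of_isHomogeneous (n := 2 * k + 1) hf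
    choose g' hg' heq using fun i => exists_sum_X_mul_of_isHomogeneous (n := 2 * k) (hg i)
    have h1 : rename Fin.castSucc (∑ i, X i * g i) = ∑ i : Fin 4, ∑ j : Fin 4,
        X i.castSucc * (X j.castSucc * rename Fin.castSucc (g' i j)) := by
      rw [map_sum]
      refine Finset.sum_congr rfl fun i _ => ?_
      rw [heq i, ← Finset.mul_sum, map_mul, map_sum, rename_X]
      simp only [map_mul, rename_X]
    have h2 : ∀ i j : Fin 4, X i.castSucc * (X j.castSucc * rename Fin.castSucc (g' i j)) ∈
        wtGrading (2 * (k + 1)) := fun i j => X_castSucc_mul_mem i j (rename_castSucc_mem (hg' i j))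
    rw [h1, hV.sum _ fun i _ => Submodule.sum_mem _ fun j _ => h2 i j]
    refine Ideal.sum_mem _ fun i _ => ?_
    rw [hV.sum _ fun j _ => h2 i j]
    refine Ideal.sum_mem _ fun j _ => ?_
    rw [← mul_assoc, mul_comm, hV.mul (rename_castSucc_mem (hg' i j))
      (X_castSucc_mul_X_castSucc_mem i j), pow_succ]
    exact Ideal.mul_mem_mul (ih (hg' i j)) (hV.coord_mem i j)

/-- Every element of the `k`-th power of the maximal ideal is congruent to a form of degree `2 k`
divided by `wᵏ`. -/
theorem exists_sub_mem_pow_succ (hV : VertexChart M' a J e Φ) {k : ℕ} {r : R}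
    (hr : r ∈ maximalIdeal R ^ k) : ∃ f ∈ stdGrading (2 * k),
      r - e k (rename Fin.castSucc f) ∈ maximalIdeal R ^ (k + 1) := by
  have hadd : ∀ k : ℕ, ∀ r s : R, (∃ f ∈ stdGrading (2 * k),
      r - e k (rename Fin.castSucc f) ∈ maximalIdeal R ^ (k + 1)) → (∃ f ∈ stdGrading (2 * k),
      s - e k (rename Fin.castSucc f) ∈ maximalIdeal R ^ (k + 1)) → ∃ f ∈ stdGrading (2 * k),
      r + s - e k (rename Fin.castSucc f) ∈ maximalIdeal R ^ (k + 1) := by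
    rintro k r s ⟨f, hf, hrf⟩ ⟨g, hg, hsg⟩
    refine ⟨f + g, add_mem hf hg, ?_⟩
    rw [map_add, hV.add (rename_castSucc_mem hf) (rename_castSucc_mem hg)]
    have := add_mem hrf hsg
    convert this using 1
    ring
  -- The approximation property is multiplicative, through `r s - f g = r (s - g) + (r - f) g`; it
  -- then suffices to know it for constants and for the generators of the maximal ideal.
  have hmul : ∀ k l : ℕ, ∀ r s : R, r ∈ maximalIdeal R ^ k → (∃ f ∈ stdGrading (2 * k),
      r - e k (rename Fin.castSucc f) ∈ maximalIdeal R ^ (k + 1)) → (∃ f ∈ stdGrading (2 * l),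
      s - e l (rename Fin.castSucc f) ∈ maximalIdeal R ^ (l + 1)) → ∃ f ∈ stdGrading (2 * (k + l)),
      r * s - e (k + l) (rename Fin.castSucc f) ∈ maximalIdeal R ^ (k + l + 1) := by
    rintro k l r s hr ⟨f, hf, hrf⟩ ⟨g, hg, hsg⟩
    refine ⟨f * g, ?_, ?_⟩
    · have := SetLike.mul_mem_graded hf hg
      rwa [← mul_add] at this
    rw [map_mul, hV.mul (rename_castSucc_mem hf) (rename_castSucc_mem hg)]
    have h1 := Ideal.mul_mem_mul hr hsg
    have h2 := Ideal.mul_mem_mul hrf (hV.apply_rename_mem_pow hg)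
    rw [← pow_add] at h1 h2
    rw [← add_assoc] at h1
    rw [show k + 1 + l = k + l + 1 by ring] at h2
    have := add_mem h1 h2
    convert this using 1
    ring
  have h0 : ∀ r : R, ∃ f ∈ stdGrading (2 * 0),
      r - e 0 (rename Fin.castSucc f) ∈ maximalIdeal R ^ (0 + 1) := by
    intro r
    obtain ⟨c, hc⟩ := hV.residue r
    refine ⟨C c, isHomogeneous_C _ c, ?_⟩
    rw [rename_C, hV.const, zero_add, pow_one]
    exact hc
  induction k generalizing r with
  | zero => exact h0 r
  | succ k ih =>
    rw [pow_succ] at hr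
    refine Submodule.mul_induction_on hr (fun x hx y hy => ?_) (fun x y => hadd _ x y)
    refine hmul k 1 x y hx (ih hx) ?_
    rw [hV.span] at hy
    refine Submodule.span_induction ?_ ?_ (fun x y _ _ => hadd 1 x y) ?_ hy
    · rintro _ ⟨⟨i, j⟩, rfl⟩
      refine ⟨X i * X j, (isHomogeneous_X ℂ i).mul (isHomogeneous_X ℂ j), ?_⟩
      rw [map_mul, rename_X, rename_X, sub_self]
      exact zero_mem _
    · refine ⟨0, zero_mem _, ?_⟩
      rw [map_zero, hV.zero, sub_zero]
      exact zero_mem _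
    · intro r x hx hx2
      rw [smul_eq_mul]
      have := hmul 0 1 r x (by simp) (h0 r) hx2
      simpa using this

/-- The `xᵢ` have order at least two on the parametrized surface, so the generators `xᵢ xⱼ / w` have
order at least four. -/
theorem map_pow_mem (hV : VertexChart M' a J e Φ)
    (ha : ∀ i, a i - MvPowerSeries.X i ∈ orderIdeal (Fin 2) 2) {k : ℕ} {r : R}
    (hr : r ∈ maximalIdeal R ^ k) : Φ r ∈ orderIdeal (Fin 2) (4 * k) := by
  have h1 : maximalIdeal R ≤ (orderIdeal (Fin 2) 4).comap Φ := by
    rw [hV.span, Ideal.span_le]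
    rintro _ ⟨⟨i, j⟩, rfl⟩
    change Φ (e 1 (X i.castSucc * X j.castSucc)) ∈ orderIdeal (Fin 2) 4
    rw [hV.apply (X_castSucc_mul_X_castSucc_mem i j)]
    have := (segreEval_rename_mem (M' := M') a ha (n := 2)
      ((isHomogeneous_X ℂ i).mul (isHomogeneous_X ℂ j))).1
    simpa using this
  induction k generalizing r with
  | zero => exact mem_orderIdeal_zero _
  | succ k ih =>
    rw [pow_succ] at hr
    refine Submodule.mul_induction_on hr (fun x hx y hy => ?_) (fun x y hx hy => ?_)
    · rw [map_mul]
      exact mul_mem_orderIdeal (ih hx) (h1 hy)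
    · rw [map_add]
      exact add_mem hx hy

theorem mem_maximalIdeal_of_map_mem {r : R} (hr : Φ r ∈ orderIdeal (Fin 2) 1) :
    r ∈ maximalIdeal R := by
  rw [mem_maximalIdeal, mem_nonunits_iff]
  intro hu
  have h1 := Ideal.eq_top_of_isUnit_mem _ hr (hu.map Φ)
  have h2 : (1 : MvPowerSeries (Fin 2) ℂ) ∈ orderIdeal (Fin 2) 1 := h1 ▸ trivial
  have h3 := mem_orderIdeal.mp h2 0 (by simp)
  simp at h3

theorem apply_last_pow (hV : VertexChart M' a J e Φ) (n : ℕ) : e n (X 4 ^ n) = 1 := by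
  induction n with
  | zero =>
    have := hV.const 1
    rwa [map_one, map_one] at this
  | succ n ih =>
    have h1 : (X 4 : MvPolynomial (Fin 5) ℂ) ∈ wtGrading (2 * 1) := by
      simpa using X_last_pow_mem 1
    rw [pow_succ, hV.mul (X_last_pow_mem n) h1, ih, hV.last, mul_one]

/-- Multiples of `W - Y` vanish to higher order at the vertex. -/
theorem apply_mul_mem_pow_succ (hV : VertexChart M' a J e Φ) {n : ℕ}
    {Q L : Fin 4 → MvPolynomial (Fin 5) ℂ}
    (hQ : ∀ k, Q k ∈ linIdeal) (hQ' : ∀ k, Q k ∈ wtGrading (2 * n))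
    (hJ : X 4 ^ n * (L 3 - L 2) + ∑ k, L k * Q k ∈ J) {k : ℕ} {G : MvPolynomial (Fin 5) ℂ}
    (hG : ∀ i, L i * G ∈ wtGrading (2 * k)) (hG' : ∀ i, e k (L i * G) ∈ maximalIdeal R ^ k) :
    e k ((L 3 - L 2) * G) ∈ maximalIdeal R ^ (k + 1) := by
  have hl : (L 3 - L 2) * G ∈ wtGrading (2 * k) := by
    rw [sub_mul]
    exact sub_mem (hG 3) (hG 2)
  -- The value of `Qᵢ / wⁿ` on the parametrization has no constant term, so `Qᵢ / wⁿ` cannot be a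
  -- unit.
  have hQmem : ∀ i, e n (Q i) ∈ maximalIdeal R := fun i => by
    refine mem_maximalIdeal_of_map_mem (Φ := Φ) ?_
    rw [hV.apply (hQ' i)]
    exact segreEval_mem_of_mem_linIdeal a (fun _ => mem_orderIdeal_zero _) (hQ i)
  have hsum : ∀ i ∈ (Finset.univ : Finset (Fin 4)),
      Q i * (L i * G) ∈ wtGrading (2 * (n + k)) := fun i _ => by
    have := SetLike.mul_mem_graded (hQ' i) (hG i)
    rwa [← mul_add] at this
  have hX : X 4 ^ n * ((L 3 - L 2) * G) ∈ wtGrading (2 * (n + k)) := by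
    have := SetLike.mul_mem_graded (X_last_pow_mem n) hl
    rwa [← mul_add] at this
  have h3 : X 4 ^ n * ((L 3 - L 2) * G) + ∑ i, Q i * (L i * G) ∈ J := by
    have h3 := Ideal.mul_mem_right G _ hJ
    rw [add_mul, Finset.sum_mul, mul_assoc] at h3
    rwa [Finset.sum_congr rfl fun i _ => show Q i * (L i * G) = L i * Q i * G by ring]
  have h2 := hV.eq_zero (add_mem hX (Submodule.sum_mem _ hsum)) h3
  rw [hV.add hX (Submodule.sum_mem _ hsum), hV.sum _ hsum, hV.mul (X_last_pow_mem n) hl,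
    hV.apply_last_pow, one_mul, Finset.sum_congr rfl fun i _ => hV.mul (hQ' i) (hG i)] at h2
  -- Division of the equation by `w^(n + k)` expresses `(L₃ - L₂) G / wᵏ` as `-∑ (Qᵢ / wⁿ)(Lᵢ G /
  -- wᵏ)`.
  rw [eq_neg_of_add_eq_zero_left h2]
  refine neg_mem (Ideal.sum_mem _ fun i _ => ?_)
  rw [pow_succ']
  exact Ideal.mul_mem_mul (hQmem i) (hG' i)

/-- An element of the `k`-th power of the maximal ideal with vanishing leading term lies in the next
power. -/
theorem mem_pow_succ (hV : VertexChart M' a J e Φ) (h : M * M' = 1) (h' : M' * M = 1)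
    (ha : ∀ i, a i - MvPowerSeries.X i ∈ orderIdeal (Fin 2) 2) {n : ℕ}
    {Q : Fin 4 → MvPolynomial (Fin 5) ℂ}
    (hQ : ∀ k, Q k ∈ linIdeal) (hQ' : ∀ k, Q k ∈ wtGrading (2 * n))
    (hJ₀ : coneForm (M 0) * coneForm (M 1) - coneForm (M 2) * coneForm (M 3) ∈ J)
    (hJ₁ : X 4 ^ n * (coneForm (M 3) - coneForm (M 2)) + ∑ k, coneForm (M k) * Q k ∈ J)
    {k : ℕ} {r : R} (hr : r ∈ maximalIdeal R ^ k) (hΦ : Φ r ∈ orderIdeal (Fin 2) (4 * k + 1)) :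
    r ∈ maximalIdeal R ^ (k + 1) := by
  obtain ⟨f, hf, hrf⟩ := hV.exists_sub_mem_pow_succ hr
  -- Both `Φ r` and the image of the error term have order greater than `4 k`, so the form `f` has
  -- vanishing leading term.
  have h1 : segreEval M' a (rename Fin.castSucc f) ∈ orderIdeal (Fin 2) (2 * (2 * k) + 1) := by
    have h2 := sub_mem hΦ (orderIdeal_antitone (by omega : 4 * k + 1 ≤ _) (hV.map_pow_mem ha hrf))
    rw [map_sub, sub_sub_cancel, hV.apply (rename_castSucc_mem hf)] at h2
    rwa [show 2 * (2 * k) = 4 * k by ring]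
  obtain ⟨g₁, g₂, hg₁, hfg⟩ := exists_eq_of_segreEval_mem a h h' ha hf h1
  set G₁ := rename (Fin.castSucc : Fin 4 → Fin 5) g₁
  set G₂ := rename (Fin.castSucc : Fin 4 → Fin 5) g₂
  have hren : ∀ i, rename Fin.castSucc (linForm (M i) * g₁) = coneForm (M i) * G₁ := fun i =>
    map_mul _ _ _
  have hmem : ∀ i, coneForm (M i) * G₁ ∈ wtGrading (2 * k) := fun i =>
    hren i ▸ rename_castSucc_mem (hg₁ i)
  have hl : (coneForm (M 3) - coneForm (M 2)) * G₁ ∈ wtGrading (2 * k) := by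
    rw [sub_mul]
    exact sub_mem (hmem 3) (hmem 2)
  have hfg' : rename Fin.castSucc f = (coneForm (M 3) - coneForm (M 2)) * G₁ +
      (coneForm (M 0) * coneForm (M 1) - coneForm (M 2) * coneForm (M 3)) * G₂ := by
    rw [hfg, map_add, map_mul, map_mul, map_sub, map_sub, map_mul, map_mul]
    rfl
  have hσ : (coneForm (M 0) * coneForm (M 1) - coneForm (M 2) * coneForm (M 3)) * G₂ ∈
      wtGrading (2 * k) := by
    rw [← sub_eq_iff_eq_add'] at hfg'
    rw [← hfg']
    exact sub_mem (rename_castSucc_mem hf) hl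
  have hfinal : e k (rename Fin.castSucc f) ∈ maximalIdeal R ^ (k + 1) := by
    rw [hfg', hV.add hl hσ, hV.eq_zero hσ (Ideal.mul_mem_right _ _ hJ₀), add_zero]
    exact hV.apply_mul_mem_pow_succ (L := fun i => coneForm (M i)) hQ hQ' hJ₁ hmem fun i =>
      hren i ▸ hV.apply_rename_mem_pow (hg₁ i)
  simpa using add_mem hrf hfinal

/-- The completed local ring at the vertex is the ring of invariant power series. -/
theorem nonempty_adicCompletion_algEquiv (hV : VertexChart M' a J e Φ) (h : M * M' = 1)
    (h' : M' * M = 1) (ha : ∀ i, a i - MvPowerSeries.X i ∈ orderIdeal (Fin 2) 2) {n : ℕ}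
    {Q : Fin 4 → MvPolynomial (Fin 5) ℂ}
    (hQ : ∀ k, Q k ∈ linIdeal) (hQ' : ∀ k, Q k ∈ wtGrading (2 * n))
    (hJ₀ : coneForm (M 0) * coneForm (M 1) - coneForm (M 2) * coneForm (M 3) ∈ J)
    (hJ₁ : X 4 ^ n * (coneForm (M 3) - coneForm (M 2)) + ∑ k, coneForm (M k) * Q k ∈ J)
    (hΦ : ∀ r, Φ r ∈ cyclicInvariants 4 ![1, 1]) :
    Nonempty (AdicCompletion (maximalIdeal R) R ≃ₐ[ℂ] cyclicInvariants 4 ![1, 1]) := by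
  refine TypeII.nonempty_adicCompletion_algEquiv (maximalIdeal R) (Φ.codRestrict _ hΦ)
    invFiltration (fun i j hij f hf => ?_) (fun k r => ?_) (fun k f => ?_) (fun f hf => ?_)
    exists_sub_mem_invFiltration
  · exact orderIdeal_antitone (by omega : 4 * i ≤ 4 * j) hf
  · refine ⟨fun hr => ?_, fun hr => hV.map_pow_mem ha hr⟩
    induction k with
    | zero => simp
    | succ k ih =>
      have hr' : Φ r ∈ orderIdeal (Fin 2) (4 * (k + 1)) := hr
      exact hV.mem_pow_succ h h' ha hQ hQ' hJ₀ hJ₁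
        (ih (orderIdeal_antitone (by omega : 4 * k ≤ 4 * (k + 1)) hr'))
        (orderIdeal_antitone (by omega) hr')
  · induction k with
    | zero => exact ⟨0, mem_orderIdeal_zero _⟩
    | succ k ih =>
      obtain ⟨r, hr⟩ := ih
      have hr' : (f : MvPowerSeries (Fin 2) ℂ) - Φ r ∈ orderIdeal (Fin 2) (4 * k) := hr
      -- Successive approximation: correcting the leading term gains only one order, but invariance
      -- of the difference then raises it to the next multiple of four.
      obtain ⟨g, hg, hfg⟩ := exists_sub_segreEval_mem a h ha hr'
      refine ⟨r + e k (rename Fin.castSucc g), mem_invFiltration.mpr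
        (mem_orderIdeal_of_mem_cyclicInvariants (SetLike.coe_mem _) ?_)⟩
      change (f : MvPowerSeries (Fin 2) ℂ) - Φ (r + e k (rename Fin.castSucc g)) ∈ _
      rwa [map_add, hV.apply (rename_castSucc_mem hg), ← sub_sub]
  · exact Subtype.ext (eq_zero_of_forall_mem_orderIdeal fun n =>
      orderIdeal_antitone (by omega : n ≤ 4 * n) (hf n))

end VertexChart

end LocalRing

/-! ### The vertex as a point, and its stalk. -/

section VertexPoint

open MvPolynomial HomogeneousLocalization

variable (I : HomogeneousIdeal wtGrading)

theorem mem_basicOpen_last {y : projV wtGrading I}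
    (hy : ∀ i : Fin 4, y ∉ Proj.basicOpen (quotientGrading wtGrading I) (xq I i.castSucc)) :
    y ∈ Proj.basicOpen (quotientGrading wtGrading I) (xq I 4) := by
  obtain ⟨i, hi⟩ := exists_mem_basicOpen_xq I y
  induction i using Fin.lastCases with
  | last => exact hi
  | cast i => exact absurd hi (hy i)

theorem eq_C_of_mem_wtGrading_zero {f : MvPolynomial (Fin 5) ℂ} (hf : f ∈ wtGrading 0) :
    f = C (coeff 0 f) := by
  classical
  ext m
  rw [coeff_C]
  split_ifs with h
  · rw [h]
  · by_contra hm
    apply h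
    have h1 := hf hm
    rw [Finsupp.weight_apply, Finsupp.sum_fintype _ _ (by simp), Finset.sum_eq_zero_iff] at h1
    ext i
    have h2 := h1 i (Finset.mem_univ i)
    rw [smul_eq_mul, mul_eq_zero] at h2
    exact (h2.resolve_right (wt_pos i).ne').symm

/-- A homogeneous element is `c wʲ` plus a combination of the `xᵢ`. At a point where the `xᵢ` vanish
and `w` does not, it lies in the prime only if `c = 0`, and then it lies in every prime containing
the `xᵢ`. -/
theorem asHomogeneousIdeal_le_of_vertex {y y' : ProjectiveSpectrum (quotientGrading wtGrading I)}
    (h4 : xq I 4 ∉ y.asHomogeneousIdeal)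
    (hy : ∀ i : Fin 4, xq I i.castSucc ∈ y.asHomogeneousIdeal)
    (hy' : ∀ i : Fin 4, xq I i.castSucc ∈ y'.asHomogeneousIdeal) :
    y.asHomogeneousIdeal.toIdeal ≤ y'.asHomogeneousIdeal.toIdeal := by
  have hprime : y.asHomogeneousIdeal.toIdeal.IsPrime := ProjectiveSpectrum.isPrime y
  have key : ∀ (n : ℕ) (q : quotientGrading wtGrading I n), q.1 ∈ y.asHomogeneousIdeal.toIdeal →
      q.1 ∈ y'.asHomogeneousIdeal.toIdeal := by
    rintro n ⟨_, f, hf, rfl⟩ hq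
    change Ideal.Quotient.mk I.toIdeal f ∈ _ at hq
    change Ideal.Quotient.mk I.toIdeal f ∈ _
    have hunit : ∀ c : ℂ, Ideal.Quotient.mk I.toIdeal (C c) ∈ y.asHomogeneousIdeal.toIdeal →
        c = 0 := by
      intro c hc
      by_contra h0
      exact hprime.ne_top (Ideal.eq_top_of_isUnit_mem _ hc
        (((isUnit_iff_ne_zero.mpr h0).map C).map _))
    have hsum : ∀ (z : ProjectiveSpectrum (quotientGrading wtGrading I))
        (_ : ∀ i : Fin 4, xq I i.castSucc ∈ z.asHomogeneousIdeal)
        (P : Fin 4 → MvPolynomial (Fin 5) ℂ),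
        Ideal.Quotient.mk I.toIdeal (∑ i, X i.castSucc * P i) ∈ z.asHomogeneousIdeal.toIdeal := by
      intro z hz P
      rw [map_sum]
      refine Ideal.sum_mem _ fun i _ => ?_
      rw [map_mul]
      exact Ideal.mul_mem_right _ _ (hz i)
    cases n with
    | zero =>
      rw [eq_C_of_mem_wtGrading_zero hf] at hq ⊢
      rw [hunit _ hq, map_zero, map_zero]
      exact zero_mem _
    | succ n =>
      obtain ⟨P, -, hP⟩ := exists_sum_X_mul hf
      rw [hP] at hq ⊢
      rw [map_add, map_mul, map_pow] at hq ⊢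
      have h1 := (Ideal.add_mem_iff_left _ (hsum y hy P)).mp hq
      rcases hprime.mem_or_mem h1 with h2 | h2
      · rw [hunit _ h2, map_zero, map_zero, zero_mul, zero_add]
        exact hsum y' hy' P
      · exact absurd (hprime.mem_of_pow_mem _ h2) h4
  intro q hq
  classical
  rw [← DirectSum.sum_support_decompose (quotientGrading wtGrading I) q]
  exact Ideal.sum_mem _ fun n _ => key n _ (y.asHomogeneousIdeal.isHomogeneous n hq)

/-- There is at most one point where all the `xᵢ` vanish. -/
theorem eq_of_vertex {y y' : projV wtGrading I}
    (hy : ∀ i : Fin 4, y ∉ Proj.basicOpen (quotientGrading wtGrading I) (xq I i.castSucc))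
    (hy' : ∀ i : Fin 4, y' ∉ Proj.basicOpen (quotientGrading wtGrading I) (xq I i.castSucc)) :
    y = y' := by
  have h1 := asHomogeneousIdeal_le_of_vertex I (mem_basicOpen_last I hy)
    (fun i => not_not.mp (hy i)) (y' := y') fun i => not_not.mp (hy' i)
  have h2 := asHomogeneousIdeal_le_of_vertex I (mem_basicOpen_last I hy')
    (fun i => not_not.mp (hy' i)) (y' := y) fun i => not_not.mp (hy i)
  exact ProjectiveSpectrum.ext (HomogeneousIdeal.toIdeal_injective (le_antisymm h1 h2))

/-- A point of `V(I)` over a local ring with `w = 1` gives a point of `V₊(I)`. -/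
theorem exists_vertex {φ : MvPolynomial (Fin 5) ℂ →ₐ[ℂ] MvPowerSeries (Fin 2) ℂ}
    (hφ : ∀ f ∈ I.toIdeal, φ f = 0) (h4 : φ (X 4) = 1)
    (hx : ∀ i : Fin 4, φ (X i.castSucc) ∈ orderIdeal (Fin 2) 1) :
    ∃ b : projV wtGrading I, ∀ i : Fin 4,
      b ∉ Proj.basicOpen (quotientGrading wtGrading I) (xq I i.castSucc) := by
  let ψ : MvPolynomial (Fin 5) ℂ ⧸ I.toIdeal →+* MvPowerSeries (Fin 2) ℂ :=
    Ideal.Quotient.lift I.toIdeal (φ : MvPolynomial (Fin 5) ℂ →+* MvPowerSeries (Fin 2) ℂ) hφ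
  have hψ4 : ψ (xq I 4) = 1 := h4
  -- Taking constant terms of the power series specializes the given point to its closed point,
  -- which defines the vertex.
  let χ : Away (quotientGrading wtGrading I) (xq I 4) →+* ℂ :=
    (MvPowerSeries.constantCoeff).comp (awayEval ψ hψ4)
  let z : PrimeSpectrum (Away (quotientGrading wtGrading I) (xq I 4)) :=
    ⟨RingHom.ker χ, RingHom.ker_isPrime χ⟩
  refine ⟨Proj.awayι _ (xq I 4) (xq_mem I 4) (wt_pos 4) z, fun i hi => ?_⟩
  have h1 : z ∈ Proj.awayι _ (xq I 4) (xq_mem I 4) (wt_pos 4) ⁻¹ᵁ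
    Proj.basicOpen (quotientGrading wtGrading I) (xq I i.castSucc) := hi
  rw [Proj.awayι_preimage_basicOpen _ (xq_mem I 4) (wt_pos 4) (xq_castSucc_mem I i) one_pos] at h1
  apply h1
  change MvPowerSeries.constantCoeff (awayEval ψ hψ4 (Away.mk _ _ _ _ _)) = 0
  rw [awayEval_mk, map_pow]
  have h2 : ψ (xq I i.castSucc) = φ (X i.castSucc) := rfl
  have h3 : MvPowerSeries.constantCoeff (φ (X i.castSucc)) = 0 := by
    have := mem_orderIdeal.mp (hx i) 0 (by simp)
    simpa using this
  rw [h2, map_pow, h3]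
  exact zero_pow (wt_pos 4).ne'

end VertexPoint

section VertexStalk

open MvPolynomial HomogeneousLocalization

variable {I : HomogeneousIdeal wtGrading}

theorem mk_mem_smul {k : ℕ} {F : MvPolynomial (Fin 5) ℂ} (hF : F ∈ wtGrading (2 * k)) :
    Ideal.Quotient.mk I.toIdeal F ∈ quotientGrading wtGrading I (k • wt 4) := by
  refine mk_mem_quotientGrading wtGrading I ?_
  rwa [smul_eq_mul, show wt 4 = 2 from rfl, mul_comm]

theorem away_mk_add_mk {A τ : Type} [CommRing A] [SetLike τ A] [AddSubgroupClass τ A] {𝒜 : ℕ → τ}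
    [GradedRing 𝒜] {m : ℕ} {s : A} (hs : s ∈ 𝒜 m) (n : ℕ) (a a' : A)
    (ha : a ∈ 𝒜 (n • m)) (ha' : a' ∈ 𝒜 (n • m)) :
    Away.mk 𝒜 hs n a ha + Away.mk 𝒜 hs n a' ha' =
      Away.mk 𝒜 hs n (a + a') (add_mem ha ha') := by
  rw [ext_iff_val, val_add, Away.val_mk, Away.val_mk, Away.val_mk, Localization.add_mk_self]

open Classical in
/-- The germ at a point of `D₊(w)` of the function `F / wᵏ` for `F` of weighted degree `2 k`. -/
noncomputable def vertexGerm (b : projV wtGrading I)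
    (hb : b ∈ Proj.basicOpen (quotientGrading wtGrading I) (xq I 4)) (k : ℕ)
    (F : MvPolynomial (Fin 5) ℂ) : (projV wtGrading I).presheaf.stalk b :=
  if h : Ideal.Quotient.mk I.toIdeal F ∈ quotientGrading wtGrading I (k • wt 4) then
    awayGerm (xq I 4) b hb (Away.mk _ (xq_mem I 4) k (Ideal.Quotient.mk I.toIdeal F) h)
  else 0

variable {b : projV wtGrading I}
    (hb : b ∈ Proj.basicOpen (quotientGrading wtGrading I) (xq I 4))

theorem vertexGerm_eq {k : ℕ} {F : MvPolynomial (Fin 5) ℂ}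
    (h : Ideal.Quotient.mk I.toIdeal F ∈ quotientGrading wtGrading I (k • wt 4)) :
    vertexGerm b hb k F =
      awayGerm (xq I 4) b hb (Away.mk _ (xq_mem I 4) k (Ideal.Quotient.mk I.toIdeal F) h) := by
  rw [vertexGerm, dif_pos h]

theorem stalkAlgebraMap_projStr {A : Type} [CommRing A] [Algebra ℂ A] {𝒜 : ℕ → Submodule ℂ A}
    [GradedAlgebra 𝒜] {m : ℕ} (hm : 0 < m) {s : A} (hs : s ∈ 𝒜 m) (x : Proj 𝒜)
    (hx : x ∈ Proj.basicOpen 𝒜 s) (c : ℂ) :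
    stalkAlgebraMap (projStr 𝒜) x c = awayGerm s x hx (awayAlgebraMap 𝒜 s c) := by
  have h1 : (Scheme.ΓSpecIso (.of ℂ)).inv ≫ (projStr 𝒜).appTop ≫
      (Proj 𝒜).presheaf.germ ⊤ x trivial = CommRingCat.ofHom (awayAlgebraMap 𝒜 s) ≫
        Proj.awayToSection 𝒜 s ≫ (Proj 𝒜).presheaf.germ (Proj.basicOpen 𝒜 s) x hx := by
    rw [← Category.assoc (CommRingCat.ofHom _), ← projStr_appLE hm hs, Category.assoc]
    have h2 : (projStr 𝒜).appLE ⊤ (Proj.basicOpen 𝒜 s) le_top = (projStr 𝒜).appTop ≫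
        (Proj 𝒜).presheaf.map (homOfLE (le_top : Proj.basicOpen 𝒜 s ≤ ⊤)).op := rfl
    rw [h2, Category.assoc]
    congr 2
    exact ((Proj 𝒜).presheaf.germ_res (homOfLE le_top) x hx).symm
  exact congr($(h1).hom c)

variable {M' : Matrix (Fin 4) (Fin 4) ℂ} {a : Fin 2 → MvPowerSeries (Fin 2) ℂ}

/-- Evaluation on the parametrization is defined on the chart `w ≠ 0`. It sends functions not
vanishing at the vertex to series with nonzero constant term, so it extends to the local ring; the
equivariance of `a` makes its values invariant. -/
theorem exists_vertexChart (hb' : ∀ i : Fin 4,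
      b ∉ Proj.basicOpen (quotientGrading wtGrading I) (xq I i.castSucc))
    (ha' : ∀ ζ : ℂ, ζ ^ 4 = 1 → ∀ i, MvPowerSeries.rescale (fun _ => ζ) (a i) = ζ • a i)
    (hI : ∀ f ∈ I.toIdeal, segreEval M' a f = 0) :
    letI : Algebra ℂ ((projV wtGrading I).presheaf.stalk b) :=
      (stalkAlgebraMap (projStr (quotientGrading wtGrading I)) b).toAlgebra
    ∃ Φ : (projV wtGrading I).presheaf.stalk b →ₐ[ℂ] MvPowerSeries (Fin 2) ℂ,
      VertexChart M' a I.toIdeal (vertexGerm b hb) Φ ∧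
        ∀ r, Φ r ∈ cyclicInvariants 4 ![1, 1] := by
  let : Algebra ℂ ((projV wtGrading I).presheaf.stalk b) :=
    (stalkAlgebraMap (projStr (quotientGrading wtGrading I)) b).toAlgebra
  let E := Away (quotientGrading wtGrading I) (xq I 4)
  let R := (projV wtGrading I).presheaf.stalk b
  let γ : E →+* R := awayGerm (xq I 4) b hb
  let ψ : MvPolynomial (Fin 5) ℂ ⧸ I.toIdeal →+* MvPowerSeries (Fin 2) ℂ :=
    Ideal.Quotient.lift I.toIdeal
      (segreEval M' a : MvPolynomial (Fin 5) ℂ →+* MvPowerSeries (Fin 2) ℂ) hI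
  have hψ : ∀ f, ψ (Ideal.Quotient.mk I.toIdeal f) = segreEval M' a f := fun f => rfl
  have hψ4 : ψ (xq I 4) = 1 := segreEval_X_last a
  let χ : E →+* MvPowerSeries (Fin 2) ℂ := awayEval ψ hψ4
  have hχmk : ∀ k F h, χ (Away.mk _ (xq_mem I 4) k (Ideal.Quotient.mk I.toIdeal F) h) =
      segreEval M' a F := fun k F h => awayEval_mk (xq_mem I 4) ψ hψ4 k _ h
  let q : Ideal E := (IsLocalRing.maximalIdeal R).comap γ
  have hqp : q.IsPrime := Ideal.comap_isPrime _ _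
  let : Algebra E R := γ.toAlgebra
  have hloc : IsLocalization.AtPrime R q := isLocalization_awayGerm (wt_pos 4) (xq_mem I 4) b hb
  have hcoordq : ∀ i j, vertexCoord I i j ∈ q := by
    intro i j
    change γ _ ∈ IsLocalRing.maximalIdeal _
    rw [IsLocalRing.mem_maximalIdeal, mem_nonunits_iff]
    simp only [γ, vertexCoord]
    rw [isUnit_awayGerm_iff, Proj.basicOpen_mul]
    exact fun h => hb' i h.1
  have hx1 : ∀ i : Fin 4, segreEval M' a (X i.castSucc) ∈ orderIdeal (Fin 2) 1 := fun i =>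
    segreEval_X_castSucc_mem a (n := 0) (fun _ => mem_orderIdeal_zero _) i
  have hχconst : ∀ c, χ (awayAlgebraMap _ (xq I 4) c) = algebraMap ℂ _ c := by
    intro c
    rw [awayEval_awayAlgebraMap (xq_mem I 4) ψ hψ4]
    exact (segreEval M' a).commutes c
  -- Every function is a constant modulo the `xᵢ xⱼ / w`, and a nonzero constant does not vanish at
  -- the vertex.
  have hspan : q = Ideal.span (Set.range fun k : Fin 4 × Fin 4 => vertexCoord I k.1 k.2) := by
    refine le_antisymm (fun x hx => ?_) ?_
    · obtain ⟨c, hc⟩ := exists_sub_mem_span_vertexCoord I x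
      have hle : Ideal.span (Set.range fun k : Fin 4 × Fin 4 => vertexCoord I k.1 k.2) ≤ q := by
        rw [Ideal.span_le]
        rintro _ ⟨k, rfl⟩
        exact hcoordq _ _
      have h1 : awayAlgebraMap _ (xq I 4) c ∈ q := by
        have := sub_mem hx (hle hc)
        simpa using this
      have h2 : c = 0 := by
        by_contra h0
        exact hqp.ne_top (Ideal.eq_top_of_isUnit_mem _ h1 ((isUnit_iff_ne_zero.mpr h0).map _))
      rwa [h2, map_zero, sub_zero] at hc
    · rw [Ideal.span_le]
      rintro _ ⟨k, rfl⟩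
      exact hcoordq _ _
  -- The constant term of the value of `x` is the constant to which `x` reduces modulo the `xᵢ xⱼ /
  -- w`; if it were zero, `x` would lie in `q`.
  have hunit : ∀ x : q.primeCompl, IsUnit (χ x) := by
    intro x
    obtain ⟨c, hc⟩ := exists_sub_mem_span_vertexCoord I x.1
    have h1 : x.1 - awayAlgebraMap _ (xq I 4) c ∈ (orderIdeal (Fin 2) 1).comap χ := by
      refine (Ideal.span_le.mpr ?_ : Ideal.span _ ≤ (orderIdeal (Fin 2) 1).comap χ) hc
      rintro _ ⟨⟨i, j⟩, rfl⟩
      change χ (Away.mk _ (xq_mem I 4) 1 (Ideal.Quotient.mk I.toIdeal (X i.castSucc) *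
        Ideal.Quotient.mk I.toIdeal (X j.castSucc)) _) ∈ orderIdeal (Fin 2) 1
      rw [awayEval_mk, map_mul, hψ]
      exact Ideal.mul_mem_right _ _ (hx1 i)
    have h2 : MvPowerSeries.constantCoeff (χ x) = c := by
      have h3 : χ (x.1 - awayAlgebraMap _ (xq I 4) c) ∈ orderIdeal (Fin 2) 1 := h1
      have h4 := mem_orderIdeal.mp h3 0 (by simp)
      rw [MvPowerSeries.coeff_zero_eq_constantCoeff_apply, map_sub, map_sub, hχconst, sub_eq_zero]
        at h4
      simpa [MvPowerSeries.algebraMap_apply] using h4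
    rw [MvPowerSeries.isUnit_iff_constantCoeff, h2, isUnit_iff_ne_zero]
    rintro rfl
    rw [map_zero, sub_zero, ← hspan] at hc
    exact x.2 hc
  let Φ₀ : R →+* MvPowerSeries (Fin 2) ℂ := IsLocalization.lift (M := q.primeCompl) hunit
  have hΦ₀ : ∀ x, Φ₀ (γ x) = χ x := fun x => IsLocalization.lift_eq hunit x
  have halg : ∀ c, algebraMap ℂ R c = γ (awayAlgebraMap _ (xq I 4) c) := fun c =>
    stalkAlgebraMap_projStr (wt_pos 4) (xq_mem I 4) b hb c
  let Φ : R →ₐ[ℂ] MvPowerSeries (Fin 2) ℂ :=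
    { toRingHom := Φ₀
      commutes' := fun c => by
        change Φ₀ (algebraMap ℂ R c) = _
        rw [halg, hΦ₀, hχconst] }
  have hΦ : ∀ x, Φ (γ x) = χ x := hΦ₀
  have hinv : ∀ x, χ x ∈ cyclicInvariants 4 ![1, 1] := by
    intro x
    obtain ⟨n, f, hf, rfl⟩ := Away.mk_surjective _ (xq_mem I 4) x
    obtain ⟨F, hF, rfl⟩ : ∃ F ∈ wtGrading (n • wt 4), Ideal.Quotient.mk I.toIdeal F = f := id hf
    rw [hχmk, mem_cyclicInvariants_iff]
    intro ζ hζ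
    refine rescale_segreEval (n := n) hζ ?_ (ha' ζ hζ)
    rwa [smul_eq_mul, mul_comm] at hF
  refine ⟨Φ, ?_, ?_⟩
  · have hX4 : X 4 ∈ wtGrading (2 * 1) := by simpa using X_last_pow_mem 1
    refine ⟨fun {k F G} hF hG => ?_, fun {k l F G} hF hG => ?_, fun {k F} hF hFI => ?_, fun c => ?_,
      ?_, fun {k F} hF => ?_, ?_, fun r => ?_⟩
    · rw [vertexGerm_eq hb (mk_mem_smul hF), vertexGerm_eq hb (mk_mem_smul hG),
        vertexGerm_eq hb (mk_mem_smul (add_mem hF hG)), ← map_add, away_mk_add_mk]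
      rfl
    · have hFG : F * G ∈ wtGrading (2 * (k + l)) := by
        have := SetLike.mul_mem_graded hF hG
        rwa [← mul_add] at this
      rw [vertexGerm_eq hb (mk_mem_smul hF), vertexGerm_eq hb (mk_mem_smul hG),
        vertexGerm_eq hb (mk_mem_smul hFG), ← map_mul, away_mk_mul_mk]
      rfl
    · rw [vertexGerm_eq hb (mk_mem_smul hF), (away_mk_eq_zero_iff _ _ _ _).mpr, map_zero]
      exact ⟨0, by rw [Ideal.Quotient.eq_zero_iff_mem.mpr hFI, mul_zero]⟩
    · have h0 : C c ∈ wtGrading (2 * 0) := MvPolynomial.isWeightedHomogeneous_C _ c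
      refine (vertexGerm_eq hb (mk_mem_smul h0)).trans ?_
      rw [halg, awayAlgebraMap_eq_mk (xq_mem I 4) c (mk_mem_smul h0)]
      rfl
    · rw [vertexGerm_eq hb (mk_mem_smul hX4), ← map_one (awayGerm (xq I 4) b hb)]
      congr 1
      rw [ext_iff_val, Away.val_mk, val_one]
      refine (Localization.mk_eq_mk_iff.mpr ?_).trans Localization.mk_one
      rw [Localization.r_iff_exists]
      exact ⟨1, by simp [xq]⟩
    · rw [vertexGerm_eq hb (mk_mem_smul hF)]
      exact (hΦ _).trans (hχmk _ _ _)
    · rw [← IsLocalization.AtPrime.map_eq_maximalIdeal q R, hspan, Ideal.map_span, ← Set.range_comp]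
      congr 2
      funext ⟨i, j⟩
      rw [vertexGerm_eq hb (mk_mem_smul (VertexChart.X_castSucc_mul_X_castSucc_mem i j))]
      rfl
    · refine ⟨MvPowerSeries.constantCoeff (Φ r), ?_⟩
      refine VertexChart.mem_maximalIdeal_of_map_mem (Φ := Φ) ?_
      rw [map_sub, AlgHom.commutes, mem_orderIdeal]
      intro s hs
      obtain rfl : s = 0 := by
        rw [← Finsupp.degree_eq_zero_iff]
        omega
      simp [MvPowerSeries.algebraMap_apply]
  · intro r
    obtain ⟨x, s, rfl⟩ := IsLocalization.exists_mk'_eq q.primeCompl r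
    rw [mem_cyclicInvariants_iff]
    intro ζ hζ
    -- Invariance passes to fractions: numerator and denominator have invariant values, and the
    -- value of the denominator is a unit.
    have h1 : Φ (IsLocalization.mk' R x s) * χ s = χ x := by
      rw [← hΦ, ← hΦ, ← map_mul]
      congr 1
      exact IsLocalization.mk'_spec R x s
    have h2 := congr(MvPowerSeries.rescale (fun _ => ζ) $h1)
    rw [map_mul, mem_cyclicInvariants_iff.mp (hinv _) ζ hζ,
      mem_cyclicInvariants_iff.mp (hinv _) ζ hζ, ← h1] at h2
    exact (hunit s).mul_right_cancel h2

end VertexStalk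

/-! ### The normal form at the vertex in odd degree. -/

section OddMember

open MvPolynomial

/-- The expansion at the vertex of a weighted homogeneous polynomial of odd degree. -/
theorem exists_eq_sum_X_mul_of_odd {m : ℕ} {q : MvPolynomial (Fin 5) ℂ}
    (hq : q ∈ wtGrading (2 * (m + 1) + 1)) :
    ∃ R : Fin 4 → MvPolynomial (Fin 5) ℂ, (∀ i, R i ∈ linIdeal) ∧
      (∀ i, R i ∈ wtGrading (2 * (m + 1))) ∧
      q = ∑ i : Fin 4, X i.castSucc *
        (C (coeff (Finsupp.single 4 (m + 1) + Finsupp.single i.castSucc 1) q) * X 4 ^ (m + 1) +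
          R i) := by
  classical
  obtain ⟨P, hP, hqP⟩ := exists_sum_X_mul hq
  -- In odd degree there is no pure power of `w`, which is why the surface passes through the
  -- vertex.
  have h0 : coeff (Finsupp.single 4 ((2 * (m + 1) + 1) / 2)) q = 0 := by
    by_contra h
    have h1 := hq h
    rw [Finsupp.weight_single, smul_eq_mul, show wt 4 = 2 from rfl] at h1
    omega
  rw [h0, C_0, zero_mul, zero_add] at hqP
  have hc : ∀ i : Fin 4, coeff (Finsupp.single 4 (m + 1) + Finsupp.single i.castSucc 1) q =
      coeff (Finsupp.single 4 (m + 1)) (P i) := by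
    intro i
    rw [hqP, coeff_sum, Finset.sum_eq_single i]
    · rw [add_comm, coeff_X_mul]
    · intro j _ hji
      rw [coeff_X_mul', if_neg]
      rw [Finsupp.mem_support_iff, not_not, Finsupp.add_apply,
        Finsupp.single_eq_of_ne (show j.castSucc ≠ 4 from (Fin.castSucc_lt_last j).ne),
        Finsupp.single_eq_of_ne fun h => hji (Fin.castSucc_injective _ h), add_zero]
    · simp
  have hR : ∀ i, P i - C (coeff (Finsupp.single 4 (m + 1)) (P i)) * X 4 ^ (m + 1) ∈ linIdeal := by
    intro i
    obtain ⟨T, -, hT⟩ := exists_sum_X_mul (n := 2 * m + 1) (hP i)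
    rw [show (2 * m + 1 + 1) / 2 = m + 1 by omega] at hT
    rw [sub_eq_iff_eq_add'.mpr hT]
    exact Ideal.sum_mem _ fun j _ => Ideal.mul_mem_right _ _ (Ideal.subset_span ⟨j, rfl⟩)
  refine ⟨_, hR, fun i => sub_mem (hP i) ?_, ?_⟩
  · rw [C_mul']
    exact Submodule.smul_mem _ _ (X_last_pow_mem (m + 1))
  · simp_rw [hc, add_sub_cancel]
    exact hqP

theorem C_mul_mem_wtGrading {n : ℕ} (c : ℂ) {F : MvPolynomial (Fin 5) ℂ} (hF : F ∈ wtGrading n) :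
    C c * F ∈ wtGrading n := by
  rw [C_mul']
  exact Submodule.smul_mem _ _ hF

/-- Near the vertex a general pair `σ, p` with `p` of odd degree has the normal form
`ℓ₀ ℓ₁ - ℓ₂ ℓ₃`, `wⁿ (ℓ₃ - ℓ₂) + ⋯`. -/
theorem exists_vertexNormalForm {σ : stdGrading 2} {N N' : Matrix (Fin 4) (Fin 4) ℂ} (h : N * N' = 1)
    (h' : N' * N = 1) (hN : (σ : MvPolynomial (Fin 4) ℂ) = ∑ i, linForm (N i) ^ 2) {m : ℕ}
    {q : MvPolynomial (Fin 5) ℂ} (hq : q ∈ wtGrading (2 * (m + 1) + 1))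
    (hk : ∑ i, (∑ j : Fin 4, coeff (Finsupp.single 4 (m + 1) + Finsupp.single j.castSucc 1) q *
      N' j i) ^ 2 ≠ 0) :
    ∃ (M M' : Matrix (Fin 4) (Fin 4) ℂ) (κ : ℂ) (Q : Fin 4 → MvPolynomial (Fin 5) ℂ),
      M * M' = 1 ∧ M' * M = 1 ∧ κ ≠ 0 ∧ (∀ k, Q k ∈ linIdeal) ∧
      (∀ k, Q k ∈ wtGrading (2 * (m + 1))) ∧
      (coneEq σ : MvPolynomial (Fin 5) ℂ) =
        coneForm (M 0) * coneForm (M 1) - coneForm (M 2) * coneForm (M 3) ∧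
      q = C κ * (X 4 ^ (m + 1) * (coneForm (M 3) - coneForm (M 2)) +
        ∑ k, coneForm (M k) * Q k) := by
  obtain ⟨R, hR, hR', hqR⟩ := exists_eq_sum_X_mul_of_odd hq
  obtain ⟨c, hc⟩ : ∃ c : Fin 4 → ℂ, ∀ j,
    coeff (Finsupp.single 4 (m + 1) + Finsupp.single j.castSucc 1) q = c j := ⟨_, fun _ => rfl⟩
  simp only [hc] at hk hqR
  -- The vector `kᵢ = ∑ⱼ cⱼ N'ⱼᵢ` lists the coefficients in the `ℓᵢ` of the linear form `∑ cⱼ xⱼ`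
  -- multiplying `w^(m + 1)`; the split coordinates are chosen so that this form is `κ (W - Y)`.
  obtain ⟨M, M', κ, hM, hM', hκ, hσM, hlin⟩ := exists_split_form h h' _ hk
  have hcone : (coneEq σ : MvPolynomial (Fin 5) ℂ) =
      coneForm (M 0) * coneForm (M 1) - coneForm (M 2) * coneForm (M 3) := by
    change rename Fin.castSucc (σ : MvPolynomial (Fin 4) ℂ) = _
    rw [hN, hσM]
    simp only [map_sub, map_mul, coneForm]
  have hlin' : ∑ j : Fin 4, X j.castSucc * C (c j) =
      C κ * (coneForm (M 3) - coneForm (M 2)) := by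
    have h1 := congr(rename (Fin.castSucc (n := 4)) $hlin)
    simp only [map_sum, map_mul, map_sub, rename_C] at h1
    simp only [coneForm]
    rw [← h1]
    simp only [← sum_coneForm h', coneForm, Finset.sum_mul]
    rw [Finset.sum_comm]
    exact Finset.sum_congr rfl fun i _ => Finset.sum_congr rfl fun j _ => by ring
  have hrest : ∑ i : Fin 4, X i.castSucc * R i =
      ∑ k, coneForm (M k) * ∑ i, C (M' i k) * R i := by
    simp only [← sum_coneForm hM', Finset.sum_mul, Finset.mul_sum]
    rw [Finset.sum_comm]
    exact Finset.sum_congr rfl fun i _ => Finset.sum_congr rfl fun j _ => by ring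
  refine ⟨M, M', κ, fun k => C κ⁻¹ * ∑ i, C (M' i k) * R i, hM, hM', hκ, fun k => ?_, fun k => ?_,
    hcone, ?_⟩
  · exact Ideal.mul_mem_left _ _ (Ideal.sum_mem _ fun i _ => Ideal.mul_mem_left _ _ (hR i))
  · exact C_mul_mem_wtGrading _ (sum_mem fun i _ => C_mul_mem_wtGrading _ (hR' i))
  · have hκ' : (C κ * C κ⁻¹ : MvPolynomial (Fin 5) ℂ) = 1 := by
      rw [← C_mul, mul_inv_cancel₀ hκ, C_1]
    have hexp : ∑ i : Fin 4, X i.castSucc * (C (c i) * X 4 ^ (m + 1) + R i) =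
        X 4 ^ (m + 1) * (∑ j : Fin 4, X j.castSucc * C (c j)) + ∑ i : Fin 4, X i.castSucc * R i := by
      rw [Finset.mul_sum, ← Finset.sum_add_distrib]
      exact Finset.sum_congr rfl fun i _ => by ring
    refine hqR.trans (hexp.trans ?_)
    rw [hlin', hrest, mul_add, mul_left_comm (C κ) (X 4 ^ (m + 1))]
    refine congrArg (X 4 ^ (m + 1) * (C κ * (coneForm (M 3) - coneForm (M 2))) + ·) ?_
    rw [Finset.mul_sum]
    refine Finset.sum_congr rfl fun k _ => ?_
    rw [mul_left_comm (coneForm (M k)), ← mul_assoc (C κ), hκ', one_mul]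

/-- A general member of odd degree has a `¼(1,1)` singularity at the vertex and is smooth
elsewhere. -/
theorem exists_vertex_of_odd {σ : stdGrading 2} {N N' : Matrix (Fin 4) (Fin 4) ℂ} (h : N * N' = 1)
    (h' : N' * N = 1) (hN : (σ : MvPolynomial (Fin 4) ℂ) = ∑ i, linForm (N i) ^ 2) {m d : ℕ}
    (hd : d = 2 * (m + 1) + 1) {p : wtGrading d} (hp : IsAdmissible σ p)
    (hk : ∑ i, (∑ j : Fin 4, coeff (Finsupp.single 4 (m + 1) + Finsupp.single j.castSucc 1)
      (p : MvPolynomial (Fin 5) ℂ) * N' j i) ^ 2 ≠ 0) :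
    ∃ b : surfB σ p, IsVertex σ (surfB.toY σ p b) ∧
      IsCyclicQuotientSingularity 4 ![1, 1] (surfB.str σ p) b ∧
      ∃ U : (surfB σ p).Opens, (U : Set (surfB σ p)) = {b}ᶜ ∧
        SmoothOfRelativeDimension 2 (U.ι ≫ surfB.str σ p) := by
  subst hd
  obtain ⟨M, M', κ, Q, hM, hM', hκ, hQ, hQ', hcone, hpQ⟩ := exists_vertexNormalForm h h' hN p.2 hk
  obtain ⟨a, ha, ha', haQ⟩ := exists_segreEval_eq_zero hM hQ hQ'
  let I := span₂ wtGrading (coneEq σ) p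
  have hI : ∀ f ∈ I.toIdeal, segreEval M' a f = 0 := by
    intro f hf
    obtain ⟨r, s, rfl⟩ := (mem_span₂_iff _ _ _ _).mp hf
    have h0 : segreEval M' a (coneEq σ) = 0 := by
      rw [hcone, map_sub, map_mul, map_mul, segreEval_coneForm a hM, segreEval_coneForm a hM,
        segreEval_coneForm a hM, segreEval_coneForm a hM]
      simp [segrePoint]
      ring
    have h1 : segreEval M' a p = 0 := by
      rw [hpQ, map_mul, haQ, mul_zero]
    simp [h0, h1]
  have hx1 : ∀ i : Fin 4, segreEval M' a (X i.castSucc) ∈ orderIdeal (Fin 2) 1 := fun i =>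
    segreEval_X_castSucc_mem a (n := 0) (fun _ => mem_orderIdeal_zero _) i
  obtain ⟨b, hb⟩ := exists_vertex I hI (segreEval_X_last a) hx1
  refine ⟨b, fun i hi => hb i hi, ?_,
    ⨆ i : Fin 4, Proj.basicOpen (quotientGrading wtGrading I) (xq I i.castSucc), ?_, ?_⟩
  · let : Algebra ℂ ((surfB σ p).presheaf.stalk b) := (stalkAlgebraMap (surfB.str σ p) b).toAlgebra
    obtain ⟨Φ, hV, hΦ⟩ := exists_vertexChart (mem_basicOpen_last I hb) hb ha' hI
    refine hV.nonempty_adicCompletion_algEquiv hM hM' ha hQ hQ' ?_ ?_ hΦ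
    · rw [← hcone]
      exact Ideal.subset_span (Or.inl rfl)
    · have h1 : (p : MvPolynomial (Fin 5) ℂ) ∈ I.toIdeal := Ideal.subset_span (Or.inr rfl)
      rw [hpQ] at h1
      have h2 := I.toIdeal.mul_mem_left (C κ⁻¹) h1
      rwa [← mul_assoc, ← C_mul, inv_mul_cancel₀ hκ, C_1, one_mul] at h2
  · ext y
    rw [SetLike.mem_coe, TopologicalSpace.Opens.mem_iSup, Set.mem_compl_iff, Set.mem_singleton_iff]
    refine ⟨?_, fun hy => ?_⟩
    · rintro ⟨i, hi⟩ rfl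
      exact hb i hi
    · by_contra! hy'
      exact hy (eq_of_vertex I hy' hb)
  · refine smooth_of_forall_exists_pow_mem (coneEq σ) p hp.2 _ fun w => ?_
    exact TopologicalSpace.Opens.mem_iSup.mp w.2

end OddMember
end TypeII

theorem mainTheorem7 (σ : TypeII.stdGrading 2) (hσ : TypeII.IsSmoothQuadric σ) (d : ℕ) :
    (Odd d → 5 ≤ d → TypeII.ForGeneral d fun p =>
      TypeII.IsDegenerationOfPairs d (TypeII.surfB.toY σ p) (TypeII.coneY.str σ) ∧
      ∃ b : TypeII.surfB σ p,
        TypeII.IsVertex σ (TypeII.surfB.toY σ p b) ∧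
        TypeII.IsCyclicQuotientSingularity 4 ![1, 1] (TypeII.surfB.str σ p) b ∧
        ∃ U : (TypeII.surfB σ p).Opens, (U : Set (TypeII.surfB σ p)) = {b}ᶜ ∧
          SmoothOfRelativeDimension 2 (U.ι ≫ TypeII.surfB.str σ p)) ∧
    (Even d → 4 ≤ d → TypeII.ForGeneral d fun p =>
      TypeII.IsDegenerationOfPairs d (TypeII.surfB.toY σ p) (TypeII.coneY.str σ) ∧
      TypeII.IsCompleteIntersection 2 d (TypeII.surfB.toY σ p ≫ TypeII.coneY.ι σ) ∧
      SmoothOfRelativeDimension 2 (TypeII.surfB.str σ p)) := by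
  -- One diagonalization is fixed for all `p`, so that the anisotropy condition defining the open
  -- set is the one used in the local analysis at the vertex.
  obtain ⟨N, N', h, h', hN⟩ := TypeII.exists_sum_sq σ hσ
  refine ⟨fun hd hd5 => ?_, fun hd hd4 => ?_⟩
  · obtain ⟨m, rfl⟩ : ∃ m, d = 2 * m + 3 + 2 := by
      obtain ⟨k, rfl⟩ := hd
      exact ⟨k - 2, by omega⟩
    obtain ⟨F, hF, hP⟩ := TypeII.forGeneral_odd σ h h' hN m
    refine ⟨F, hF, fun p hp => ?_⟩
    obtain ⟨hadm, hk⟩ := hP p hp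
    exact ⟨TypeII.isDegenerationOfPairs hσ hadm.1,
      TypeII.exists_vertex_of_odd (m := m + 1) h h' hN (by omega) hadm hk⟩
  · obtain ⟨m, rfl⟩ : ∃ m, d = 2 * m + 2 + 2 := by
      obtain ⟨k, rfl⟩ := hd
      exact ⟨k - 2, by omega⟩
    obtain ⟨F, hF, hP⟩ := TypeII.forGeneral_even σ hσ m
    refine ⟨F, hF, fun p hp => ?_⟩
    obtain ⟨hadm, hc⟩ := hP p hp
    exact ⟨TypeII.isDegenerationOfPairs hσ hadm.1,
      TypeII.isCompleteIntersection hσ (by omega) hadm.1,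
      TypeII.smooth_even (m := m + 1) (by omega) hadm hc⟩
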